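/- **Setting.** Let $k\ge 1$ be an integer, $T>0$, $\sigma\in\mathbb R$, let $\alpha\in C^\infty([0,2\pi])$ with $\alpha(0)=\alpha(2\pi)$ ($\alpha$ may vanish and change sign) and $g\in C^\infty([0,2\pi]\times[0,T])$. Consider $$u_t+(\alpha u)_x=g\ \text{ on }[0,2\pi]\times[0,T],\qquad u(\cdot,0)=u_0,\qquad u(0,t)=u(2\pi,t).$$ A solution is a continuous function $u$ on $[0,2\pi]\times[0,T]$ for which $u_t$ and $(\alpha u)_x$ exist and satisfy these relations at every point. *Mesh.* Let $0=x_{1/2}<x_{3/2}<\dots<x_{N+1/2}=2\pi$, $\mathbf V_i=[x_{i-1/2},x_{i+1/2}]$, $h_i=x_{i+1/2}-x_{i-1/2}$, $h=\max_i h_i$, with $h\le\sigma h_i$ for all $i$ (shape regularity). In each element choose reference points $-1=s_0<s_1<\dots<s_{k+1}=1$ (they may depend on $i$), and put $x_{i,j}=\frac{h_i}{2}s_j+\frac12(x_{i-1/2}+x_{i+1/2})$. With $L_n$ the Legendre polynomial of degree $n$: * LSV: in every element, $s_1,\dots,s_k$ are the zeros of $L_k$. * RSV: if $\alpha(x_{i-1/2})>0$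 and $\alpha(x_{i+1/2})>0$, then $s_1,\dots,s_{k+1}$ are the zeros of $L_{k+1}-L_k$ (right Radau points); if $\alpha(x_{i-1/2})<0$ and $\alpha(x_{i+1/2})<0$, then $s_0,\dots,s_k$ are the zeros of $L_{k+1}+L_k$ (left Radau points); in every other element either of the two choices is used. *Scheme.* $V_h$ is the space of functions whose restriction to each $\mathbf V_i$ is a polynomial of degree at most $k$. A solution of the semi-discrete scheme is a $u_h(\cdot,t)\in V_h$, differentiable in $t\in[0,T]$, with $$\int_{x_{i,j}}^{x_{i,j+1}}(u_h)_t\,dx+\alpha\hat u_h|_{x_{i,j+1}}-\alpha\hat u_h|_{x_{i,j}}=\int_{x_{i,j}}^{x_{i,j+1}}g\,dx,\qquad 1\le i\le N,\ 0\le j\le k,$$ where $\hat u_h=u_h$ at the points interior to an element, and at $x_{i+1/2}$ the value $\hat u_h$ is the left limit $u_h^-$ if $\alpha(x_{i+1/2})>0$ and the right limit $u_h^+$ if $\alpha(x_{i+1/2})\le0$, the end points $0$ and $2\pi$ being identified. *Interpolation and norms.* For continuous $\phi$, $I_h\phi\in V_h$ agrees with $\phi$, on each $\mathbf V_i$, at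 the points $x_{i,1},\dots,x_{i,k+1}$ if $\alpha(x_{i-1/2})\ge0$ and $\alpha(x_{i+1/2})>0$; at $x_{i,0},\dots,x_{i,k}$ if $\alpha(x_{i-1/2})\le0$ and $\alpha(x_{i+1/2})<0$; and at $x_{i,0},\dots,x_{i,k-1},x_{i,k+1}$ otherwise. Put $$\|v\|_\alpha^2=\sum_{i=1}^N\big(\alpha(x_{i-1/2})^2+\alpha(x_{i+1/2})^2\big)\int_{\mathbf V_i}v^2\,dx,$$ and let $\|\cdot\|_{m,\infty}$ be the norm of $W^{m,\infty}(0,2\pi)$, the maximum of the $L^\infty$ norms of the weak derivatives of orders $0,\dots,m$. **Corollary 5.1.** There is a constant $C>0$, depending only on $k,\alpha,g,T,\sigma$ (not on the mesh, $u_0$, $u$, $u_h$ or $t$), such that the following holds. Let $u$ be a solution with $u(\cdot,t)\in W^{k+3,\infty}(0,2\pi)$ for every $t\in[0,T]$, and let $u_h$ be a solution of the RSV scheme ($k\ge1$) or of the LSV scheme ($k\ge2$) with $u_h(\cdot,0)=I_hu_0$. Then $$\|(u_h-I_hu)(\cdot,t)\|_\alpha\le C\,h^{k+2}\sup_{\tau\in[0,T]}\|u(\cdot,\tau)\|_{k+3,\infty}\qquad\text{for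 all }t\in[0,T].$$ -/

import Mathlib

open Set MeasureTheory Polynomial
open scoped ContDiff ENNReal

noncomputable section

namespace SpectralVolume

/-! ### Sobolev norms of order `m` in the sense of `L^∞` -/

/-- `d j` is the `j`-th weak derivative of `f` on the open interval `(a, b)`, for every `j ≤ m`. -/
def IsWeakDerivFamily (a b : ℝ) (m : ℕ) (f : ℝ → ℝ) (d : ℕ → ℝ → ℝ) : Prop :=
  d 0 = f ∧
  ∀ j ≤ m, AEStronglyMeasurable (d j) (volume.restrict (Ioo a b)) ∧
    ∀ φ : ℝ → ℝ, ContDiff ℝ ∞ φ → HasCompactSupport φ → tsupport φ ⊆ Ioo a b →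
      ∫ y in Ioo a b, f y * iteratedDeriv j φ y = (-1) ^ j * ∫ y in Ioo a b, d j y * φ y

/-- The norm of `W^{m,∞}(a, b)`: the maximum over `j ≤ m` of the essential suprema of the weak
derivatives of order `j`. Weak derivatives being unique almost everywhere, the infimum ranges over
equal numbers; it is `⊤` exactly when `f` is not in `W^{m,∞}(a, b)`. -/
def sobolevInftyNorm (a b : ℝ) (m : ℕ) (f : ℝ → ℝ) : ℝ≥0∞ :=
  ⨅ (d : ℕ → ℝ → ℝ) (_ : IsWeakDerivFamily a b m f d),
    ⨆ j ∈ Finset.range (m + 1), eLpNorm (d j) ⊤ (volume.restrict (Ioo a b))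

/-- Membership in `W^{m,∞}(a, b)`. -/
def MemSobolevInfty (a b : ℝ) (m : ℕ) (f : ℝ → ℝ) : Prop :=
  sobolevInftyNorm a b m f < ⊤

/-! ### The continuous problem -/

/-- `u` solves `u_t + (α u)_x = g` on `[0, 2π] × [0, T]` with `u(·, 0) = u₀` and the periodic
boundary condition. -/
structure IsPDESolution (α : ℝ → ℝ) (g : ℝ → ℝ → ℝ) (T : ℝ) (u₀ : ℝ → ℝ) (u : ℝ → ℝ → ℝ) :
    Prop where
  continuousOn :
    ContinuousOn (Function.uncurry u) (Icc 0 (2 * Real.pi) ×ˢ Icc 0 T)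
  equation : ∀ y ∈ Icc 0 (2 * Real.pi), ∀ t ∈ Icc 0 T, ∃ ut : ℝ,
    HasDerivWithinAt (fun τ => u y τ) ut (Icc 0 T) t ∧
    HasDerivWithinAt (fun z => α z * u z t) (g y t - ut) (Icc 0 (2 * Real.pi)) y
  initial : ∀ y ∈ Icc 0 (2 * Real.pi), u y 0 = u₀ y
  periodic : ∀ t ∈ Icc 0 T, u 0 t = u (2 * Real.pi) t

/-! ### Meshes and control volumes -/

/-- A partition of `[0, 2π]` into `N` elements. -/
structure Mesh (N : ℕ) where
  node : Fin (N + 1) → ℝ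
  strictMono : StrictMono node
  first : node 0 = 0
  last : node (Fin.last N) = 2 * Real.pi

namespace Mesh

variable {N : ℕ} (x : Mesh N)

/-- Left end point of the element `i`. -/
def left (i : Fin N) : ℝ := x.node i.castSucc

/-- Right end point of the element `i`. -/
def right (i : Fin N) : ℝ := x.node i.succ

/-- Length of the element `i`. -/
def len (i : Fin N) : ℝ := x.right i - x.left i

/-- The mesh size `h = max_i h_i`. -/
def size : ℝ := ⨆ i, x.len i

/-- Shape regularity with constant `σ`. -/
def ShapeRegular (σ : ℝ) : Prop := ∀ i, x.size ≤ σ * x.len i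

/-- Image in the element `i` of the reference point `s i j ∈ [-1, 1]`. -/
def pt {k : ℕ} (s : Fin N → Fin (k + 2) → ℝ) (i : Fin N) (j : Fin (k + 2)) : ℝ :=
  x.len i / 2 * s i j + (x.left i + x.right i) / 2

end Mesh

/-- The Legendre polynomial of degree `n` on `[-1, 1]` (Rodrigues' formula). -/
def legendre (n : ℕ) : ℝ[X] :=
  C (1 / (2 ^ n * (n.factorial : ℝ))) * derivative^[n] ((X ^ 2 - 1) ^ n)

/-- `-1 = p_0 < p_1 < ⋯ < p_{k+1} = 1`. -/
def IsRefPartition {k : ℕ} (p : Fin (k + 2) → ℝ) : Prop :=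
  StrictMono p ∧ p 0 = -1 ∧ p (Fin.last (k + 1)) = 1

/-- The interior points `p_1, …, p_k` are the zeros of `L_k`. -/
def IsGaussPartition {k : ℕ} (p : Fin (k + 2) → ℝ) : Prop :=
  IsRefPartition p ∧
    ∀ j : Fin (k + 2), j ≠ 0 → j ≠ Fin.last (k + 1) → (legendre k).IsRoot (p j)

/-- The points `p_1, …, p_{k+1}` are the zeros of `L_{k+1} - L_k`. -/
def IsRightRadauPartition {k : ℕ} (p : Fin (k + 2) → ℝ) : Prop :=
  IsRefPartition p ∧
    ∀ j : Fin (k + 2), j ≠ 0 → (legendre (k + 1) - legendre k).IsRoot (p j)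

/-- The points `p_0, …, p_k` are the zeros of `L_{k+1} + L_k`. -/
def IsLeftRadauPartition {k : ℕ} (p : Fin (k + 2) → ℝ) : Prop :=
  IsRefPartition p ∧
    ∀ j : Fin (k + 2), j ≠ Fin.last (k + 1) → (legendre (k + 1) + legendre k).IsRoot (p j)

/-- The choice of the partition points in the LSV method. -/
def IsLSV {N k : ℕ} (s : Fin N → Fin (k + 2) → ℝ) : Prop :=
  ∀ i, IsGaussPartition (s i)

/-- The choice of the partition points in the RSV method: right (left) Radau points in the elements
at both end points of which `α` is positive (negative), and either of the two in all others. -/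
def IsRSV {N k : ℕ} (α : ℝ → ℝ) (x : Mesh N) (s : Fin N → Fin (k + 2) → ℝ) : Prop :=
  ∀ i,
    (0 < α (x.left i) → 0 < α (x.right i) → IsRightRadauPartition (s i)) ∧
    (α (x.left i) < 0 → α (x.right i) < 0 → IsLeftRadauPartition (s i)) ∧
    (IsRightRadauPartition (s i) ∨ IsLeftRadauPartition (s i))

/-! ### The spectral volume scheme

A function of the finite element space `V_h` is given by its restrictions to the elements, that is,
by one polynomial of degree at most `k` (in the global variable) for each element. -/

/-- Upwind value of `v` at the right end point of the element `i`; the element that follows the last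
one is the first one. -/
def upwind {N : ℕ} (α : ℝ → ℝ) (x : Mesh N) (v : Fin N → ℝ[X]) (i : Fin N) : ℝ :=
  if 0 < α (x.right i) then (v i).eval (x.right i)
  else (v (finRotate N i)).eval (x.left (finRotate N i))

/-- The numerical flux `α v̂` at the point `j` of the element `i`. -/
def flux {N k : ℕ} (α : ℝ → ℝ) (x : Mesh N) (s : Fin N → Fin (k + 2) → ℝ)
    (v : Fin N → ℝ[X]) (i : Fin N) (j : Fin (k + 2)) : ℝ :=
  if j = 0 then α (x.left i) * upwind α x v ((finRotate N).symm i)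
  else if j = Fin.last (k + 1) then α (x.right i) * upwind α x v i
  else α (x.pt s i j) * (v i).eval (x.pt s i j)

/-- `uh t ∈ V_h`, `t ∈ [0, T]`, is a solution of the semi-discrete spectral volume scheme. -/
structure IsSVSolution {N k : ℕ} (α : ℝ → ℝ) (g : ℝ → ℝ → ℝ) (T : ℝ) (x : Mesh N)
    (s : Fin N → Fin (k + 2) → ℝ) (uh : ℝ → Fin N → ℝ[X]) : Prop where
  degree_le : ∀ t ∈ Icc 0 T, ∀ i, (uh t i).natDegree ≤ k
  differentiableOn : ∀ i m, DifferentiableOn ℝ (fun t => (uh t i).coeff m) (Icc 0 T)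
  scheme : ∀ t ∈ Icc 0 T, ∀ (i : Fin N) (j : Fin (k + 1)),
    (∫ y in (x.pt s i j.castSucc)..(x.pt s i j.succ),
        derivWithin (fun τ => (uh τ i).eval y) (Icc 0 T) t)
      + flux α x s (uh t) i j.succ - flux α x s (uh t) i j.castSucc
      = ∫ y in (x.pt s i j.castSucc)..(x.pt s i j.succ), g y t

/-- The one of the `k + 2` points of an element that is not an interpolation node, given the values
`a` and `b` of `α` at the left and at the right end point of the element. -/
def omitted (k : ℕ) (a b : ℝ) : Fin (k + 2) :=
  if 0 ≤ a ∧ 0 < b then 0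
  else if a ≤ 0 ∧ b < 0 then Fin.last (k + 1)
  else (Fin.last k).castSucc

/-- The piecewise Lagrange interpolant `I_h φ ∈ V_h` of a continuous function `φ`. -/
def interp {N k : ℕ} (α : ℝ → ℝ) (x : Mesh N) (s : Fin N → Fin (k + 2) → ℝ) (φ : ℝ → ℝ)
    (i : Fin N) : ℝ[X] :=
  Lagrange.interpolate (Finset.univ.erase (omitted k (α (x.left i)) (α (x.right i))))
    (x.pt s i) (fun j => φ (x.pt s i j))

/-- The norm `‖v‖_α`, with `‖v‖_α² = ∑_i (α(left)² + α(right)²) ∫_{V_i} v²`. -/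
def weightedNorm {N : ℕ} (α : ℝ → ℝ) (x : Mesh N) (v : Fin N → ℝ[X]) : ℝ :=
  Real.sqrt (∑ i, (α (x.left i) ^ 2 + α (x.right i) ^ 2) *
    ∫ y in (x.left i)..(x.right i), (v i).eval y ^ 2)

end SpectralVolume

end

/-! The scheme is a Petrov-Galerkin method whose test functions are constant on the control volumes.
A polynomial `w` on the reference element is sent to the step function that starts at `w(-1)` and
jumps by `A l * w'(p l)` at `p l`, where `A` are quadrature weights on the partition points
(`exists_test_function`). Testing the flux differences gives `fluxPairing`, a discrete integration
by parts. Because the Gauss and Radau rules are exact below degree `2k`, testing the time derivative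
gives a symmetric form: the integral of `v w` plus a nonnegative multiple of the product of top
coefficients (`fluxPairing_primitive`). Test each element with the finite element function itself,
weighted by `α(left)² + α(right)²`. Upwinding then leaves nonnegative interface jumps up to terms of
order `h` (`neg_sum_fluxPairing_le`), and Gronwall's inequality yields `exists_stability_const`.

Consistency of `I_h u` alone is one order short. Away from the zeros of `α` its fluxes are exact at
all points, but the integral of `u_t - I_h u_t` remains. Its leading part is `c ω`, with `ω` the
nodal polynomial and `c` close to `∂_x^{k+1} u_t / (k+1)!`. Hence `u_h` is compared with `I_h u + c
q`, where `α q` equals the primitive of `ω` at the interpolation points (`correction`,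
`flux_error_of_far`). The Radau polynomials, and the Gauss ones for `k ≥ 2`, make the integral of
`ω` over the element vanish, so `q` is zero at the upwind end and the interface fluxes stay exact.
The size of `q` is `h^{k+2} / |α|`, which the weight renders harmless. Where `|α(left)| ≤ 2Λh`, with
`Λ` a Lipschitz constant of `α`, no correction is made: there the square root of the weight is
itself of order `h` and supplies the missing power (`abs_residual_le`).

The factor `c` has to be differentiable in time although `u` has only `k + 3` bounded space
derivatives. Since `u_t = g - (α u)_x`, it is replaced by finite differences of `g` and `α u`
(`leadCoeff`). Their time derivative is the same expression in `g_t` and `α u_t`, and is bounded.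

The estimate contains only norms of `u`, whereas the analysis also needs norms of `g`. A source that
is not identically zero forces every solution to have a norm bounded below (`exists_lower_bound`),
so fixed bounds of `g` can be absorbed in the constant; a vanishing source contributes nothing. -/

noncomputable section

namespace SpectralVolume

/-! ### Integration of polynomials over the reference element -/

/-- The integral of a polynomial over `[-1, 1]`, as a linear form. -/
def refInt : ℝ[X] →ₗ[ℝ] ℝ where
  toFun f := ∫ s in (-1 : ℝ)..1, f.eval s
  map_add' f g := by
    simp only [eval_add]
    exact intervalIntegral.integral_add (f.continuous.intervalIntegrable _ _)
      (g.continuous.intervalIntegrable _ _)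
  map_smul' c f := by simp

lemma refInt_apply (f : ℝ[X]) : refInt f = ∫ s in (-1 : ℝ)..1, f.eval s := rfl

lemma integral_eval_derivative (f : ℝ[X]) (a b : ℝ) :
    ∫ s in a..b, (derivative f).eval s = f.eval b - f.eval a :=
  intervalIntegral.integral_eq_sub_of_hasDerivAt (fun s _ => f.hasDerivAt s)
    ((derivative f).continuous.intervalIntegrable _ _)

lemma refInt_derivative (f : ℝ[X]) : refInt (derivative f) = f.eval 1 - f.eval (-1) :=
  integral_eval_derivative f (-1) 1

lemma refInt_derivative_mul (f g : ℝ[X]) :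
    refInt (derivative f * g) =
      f.eval 1 * g.eval 1 - f.eval (-1) * g.eval (-1) - refInt (f * derivative g) := by
  have h := refInt_derivative (f * g)
  rw [derivative_mul, map_add, eval_mul, eval_mul] at h
  linarith

lemma refInt_sq_nonneg (f : ℝ[X]) : 0 ≤ refInt (f * f) := by
  rw [refInt_apply]
  refine intervalIntegral.integral_nonneg (by norm_num) fun s _ => ?_
  rw [eval_mul]
  exact mul_self_nonneg _

lemma natDegree_lt_of_degree_lt {f : ℝ[X]} {n : ℕ} (hn : 0 < n) (h : f.degree < n) :
    f.natDegree < n := by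
  rcases eq_or_ne f 0 with rfl | hf
  · simpa using hn
  · exact (natDegree_lt_iff_degree_lt hf).2 h

/-! ### Legendre polynomials -/

lemma natDegree_X_sq_sub_one_pow (n : ℕ) : (((X : ℝ[X]) ^ 2 - 1) ^ n).natDegree = 2 * n := by
  have h : ((X : ℝ[X]) ^ 2 - 1).natDegree = 2 := by
    have := natDegree_X_pow_sub_C (R := ℝ) (n := 2) (r := 1)
    simpa using this
  rw [natDegree_pow, h, mul_comm]

lemma monic_X_sq_sub_one_pow (n : ℕ) : (((X : ℝ[X]) ^ 2 - 1) ^ n).Monic := by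
  have h : ((X : ℝ[X]) ^ 2 - C 1).Monic := monic_X_pow_sub_C 1 (by norm_num)
  simpa using h.pow n

lemma natDegree_legendre_le (n : ℕ) : (legendre n).natDegree ≤ n := by
  refine (natDegree_C_mul_le _ _).trans ((natDegree_iterate_derivative _ _).trans ?_)
  rw [natDegree_X_sq_sub_one_pow]
  omega

lemma coeff_legendre_self_ne_zero (n : ℕ) : (legendre n).coeff n ≠ 0 := by
  rw [legendre, coeff_C_mul, coeff_iterate_derivative]
  have h : (((X : ℝ[X]) ^ 2 - 1) ^ n).coeff (n + n) = 1 := by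
    have := (monic_X_sq_sub_one_pow n).coeff_natDegree
    rwa [natDegree_X_sq_sub_one_pow, two_mul] at this
  rw [h]
  have h1 : (n.factorial : ℝ) ≠ 0 := by exact_mod_cast n.factorial_ne_zero
  have h2 : (n + n).descFactorial n ≠ 0 := by
    rw [Nat.ne_zero_iff_zero_lt, Nat.pos_iff_ne_zero, Ne, Nat.descFactorial_eq_zero_iff_lt]
    omega
  refine mul_ne_zero (by positivity) ?_
  rw [nsmul_eq_mul, mul_one]
  exact_mod_cast h2

lemma eval_iterate_derivative_X_sq_sub_one_pow {j n : ℕ} (h : j < n) {s : ℝ} (hs : s ^ 2 = 1) :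
    (derivative^[j] (((X : ℝ[X]) ^ 2 - 1) ^ n)).eval s = 0 := by
  obtain ⟨q, hq⟩ := pow_sub_dvd_iterate_derivative_pow ((X : ℝ[X]) ^ 2 - 1) n j
  rw [hq, eval_mul, eval_pow]
  simp [hs, Nat.sub_ne_zero_of_lt h]

/-- Integration by parts `j` times: `(X ^ 2 - 1) ^ n` vanishes to order `n` at both end points, so
no boundary terms appear. -/
lemma refInt_iterate_derivative_mul (n j : ℕ) (hj : j ≤ n) (q : ℝ[X]) :
    refInt (derivative^[j] (((X : ℝ[X]) ^ 2 - 1) ^ n) * q) =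
      (-1) ^ j * refInt ((X ^ 2 - 1) ^ n * derivative^[j] q) := by
  induction j generalizing q with
  | zero => simp
  | succ j ih =>
    rw [Function.iterate_succ_apply', refInt_derivative_mul,
      eval_iterate_derivative_X_sq_sub_one_pow (by omega) (by norm_num),
      eval_iterate_derivative_X_sq_sub_one_pow (by omega) (by norm_num), ih (by omega),
      ← Function.iterate_succ_apply]
    ring

lemma refInt_legendre_mul {n : ℕ} {q : ℝ[X]} (hq : q.natDegree < n) :
    refInt (legendre n * q) = 0 := by
  rw [legendre, mul_assoc, ← smul_eq_C_mul, map_smul, refInt_iterate_derivative_mul n n le_rfl,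
    iterate_derivative_eq_zero hq]
  simp

/-! ### Quadrature on the points of a partition -/

/-- The rule with points `p` and weights `A` integrates polynomials of degree `< 2k` exactly, and
does not overestimate the integral of `s ^ (2k)`. -/
structure IsQuadrature {k : ℕ} (p A : Fin (k + 2) → ℝ) : Prop where
  exact : ∀ f : ℝ[X], f.natDegree < 2 * k → refInt f = ∑ l, A l * f.eval (p l)
  top : ∑ l, A l * p l ^ (2 * k) ≤ refInt (X ^ (2 * k))

/-- Gauss's argument for interpolatory quadrature. Divide `f` by the nodal polynomial: the quotient
has degree below `k` and drops out of the integral by orthogonality, while the remainder agrees with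
`f` at the points and equals its own interpolant. -/
lemma exists_weights_of_orthogonal {k m : ℕ} (hk : 1 ≤ k) {p : Fin m → ℝ}
    (hp : Function.Injective p) (S : Finset (Fin m))
    (horth : ∀ q : ℝ[X], q.natDegree < k → refInt (Lagrange.nodal S p * q) = 0) :
    ∃ A : Fin m → ℝ, (∀ l, l ∉ S → A l = 0) ∧
      ∀ f : ℝ[X], f.natDegree < S.card + k → refInt f = ∑ l, A l * f.eval (p l) := by
  classical
  refine ⟨fun l => if l ∈ S then refInt (Lagrange.basis S p l) else 0,
    fun l hl => if_neg hl, fun f hf => ?_⟩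
  have hmon : (Lagrange.nodal S p).Monic := Lagrange.nodal_monic
  have hdeg : (Lagrange.nodal S p).natDegree = S.card := Lagrange.natDegree_nodal
  have hsplit := modByMonic_add_div f (Lagrange.nodal S p)
  set r := f %ₘ Lagrange.nodal S p with hr
  have hrdeg : r.degree < S.card := by
    have := degree_modByMonic_lt f hmon
    rwa [Lagrange.degree_nodal] at this
  have heval : ∀ l ∈ S, r.eval (p l) = f.eval (p l) := fun l hl => by
    conv_rhs => rw [← hsplit]
    rw [eval_add, eval_mul, Lagrange.eval_nodal_at_node hl, zero_mul, add_zero]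
  have hint : refInt f = refInt r := by
    conv_lhs => rw [← hsplit]
    rw [map_add, horth _ (by rw [natDegree_divByMonic _ hmon, hdeg]; omega), add_zero]
  have hrr : r = Lagrange.interpolate S p (fun l => r.eval (p l)) :=
    Lagrange.eq_interpolate hp.injOn hrdeg
  rw [hint, hrr, Lagrange.interpolate_apply, map_sum]
  simp only [ite_mul, zero_mul, Finset.sum_ite_mem, Finset.univ_inter]
  refine Finset.sum_congr rfl fun l hl => ?_
  rw [← smul_eq_C_mul, map_smul, smul_eq_mul, heval l hl, mul_comm]

lemma isQuadrature_of_exact {k : ℕ} {p A : Fin (k + 2) → ℝ}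
    (h : ∀ f : ℝ[X], f.natDegree < 2 * k + 1 → refInt f = ∑ l, A l * f.eval (p l)) :
    IsQuadrature p A where
  exact f hf := h f (by omega)
  top := by
    rw [h (X ^ (2 * k)) (by rw [natDegree_X_pow]; omega)]
    simp

lemma eq_C_mul_nodal {m : ℕ} {p : Fin m → ℝ} (hp : Function.Injective p) (S : Finset (Fin m))
    {Q : ℝ[X]} (hQ : Q.natDegree ≤ S.card) (hroot : ∀ l ∈ S, Q.IsRoot (p l)) :
    Q = C (Q.coeff S.card) * Lagrange.nodal S p := by
  rw [← sub_eq_zero]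
  refine Polynomial.eq_zero_of_degree_lt_of_eval_index_eq_zero S (v := p) hp.injOn ?_ fun l hl => ?_
  · rw [degree_lt_iff_coeff_zero]
    intro j hj
    have hdeg : (Lagrange.nodal S p).natDegree = S.card := Lagrange.natDegree_nodal
    have hmon : (Lagrange.nodal S p).Monic := Lagrange.nodal_monic
    rw [coeff_sub, coeff_C_mul]
    rcases hj.eq_or_lt with rfl | hj
    · have := hmon.coeff_natDegree
      rw [hdeg] at this
      rw [this]; ring
    · rw [coeff_eq_zero_of_natDegree_lt (hQ.trans_lt hj),
        coeff_eq_zero_of_natDegree_lt (hdeg.trans_lt hj)]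
      ring
  · rw [eval_sub, eval_mul, Lagrange.eval_nodal_at_node hl, (hroot l hl).eq_zero]
    ring

lemma refInt_nodal_mul_of_root {m : ℕ} {p : Fin m → ℝ} (hp : Function.Injective p)
    (S : Finset (Fin m)) {Q q : ℝ[X]} (hQ : Q.natDegree ≤ S.card) (hc : Q.coeff S.card ≠ 0)
    (hroot : ∀ l ∈ S, Q.IsRoot (p l)) (h : refInt (Q * q) = 0) :
    refInt (Lagrange.nodal S p * q) = 0 := by
  rw [eq_C_mul_nodal hp S hQ hroot, mul_assoc, ← smul_eq_C_mul, map_smul, smul_eq_mul] at h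
  exact (mul_eq_zero.mp h).resolve_left hc

/-- Weights and moment conditions at the points suited to transport to the right. -/
def IsRightAdapted {k : ℕ} (p A : Fin (k + 2) → ℝ) : Prop :=
  A 0 = 0 ∧ refInt (Lagrange.nodal (Finset.univ.erase 0) p) = 0

/-- Weights and moment conditions at the points suited to transport to the left. -/
def IsLeftAdapted {k : ℕ} (p A : Fin (k + 2) → ℝ) : Prop :=
  A (Fin.last (k + 1)) = 0 ∧
    refInt (Lagrange.nodal (Finset.univ.erase (Fin.last (k + 1))) p) = 0

lemma card_univ_erase {k : ℕ} (o : Fin (k + 2)) :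
    (Finset.univ.erase o : Finset (Fin (k + 2))).card = k + 1 := by
  simp

/-- The nodal polynomial of the Radau points is a multiple of `L_{k+1} - L_k`, hence orthogonal to
degrees below `k`. On `k + 1` points this gives exactness up to degree `2k`; orthogonality to `1` is
the moment condition and uses `k ≥ 1`. -/
lemma IsRightRadauPartition.exists_weights {k : ℕ} (hk : 1 ≤ k) {p : Fin (k + 2) → ℝ}
    (hp : IsRightRadauPartition p) : ∃ A, IsQuadrature p A ∧ IsRightAdapted p A := by
  have hinj := hp.1.1.injective
  have horth : ∀ q : ℝ[X], q.natDegree < k →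
      refInt (Lagrange.nodal (Finset.univ.erase 0) p * q) = 0 := fun q hq => by
    refine refInt_nodal_mul_of_root hinj _ (Q := legendre (k + 1) - legendre k) ?_ ?_ ?_ ?_
    · rw [card_univ_erase]
      exact (natDegree_sub_le _ _).trans
        (max_le (natDegree_legendre_le _) ((natDegree_legendre_le _).trans (by omega)))
    · rw [card_univ_erase, coeff_sub, coeff_eq_zero_of_natDegree_lt (n := k + 1)
        ((natDegree_legendre_le k).trans_lt (by omega)), sub_zero]
      exact coeff_legendre_self_ne_zero _
    · exact fun l hl => hp.2 l (Finset.ne_of_mem_erase hl)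
    · rw [sub_mul, map_sub, refInt_legendre_mul (by omega), refInt_legendre_mul hq, sub_zero]
  obtain ⟨A, hA0, hA⟩ := exists_weights_of_orthogonal hk hinj (Finset.univ.erase 0) horth
  rw [card_univ_erase] at hA
  refine ⟨A, isQuadrature_of_exact fun f hf => hA f (by omega), hA0 0 (by simp), ?_⟩
  simpa using horth 1 (by rw [natDegree_one]; omega)

lemma IsLeftRadauPartition.exists_weights {k : ℕ} (hk : 1 ≤ k) {p : Fin (k + 2) → ℝ}
    (hp : IsLeftRadauPartition p) : ∃ A, IsQuadrature p A ∧ IsLeftAdapted p A := by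
  have hinj := hp.1.1.injective
  have horth : ∀ q : ℝ[X], q.natDegree < k →
      refInt (Lagrange.nodal (Finset.univ.erase (Fin.last (k + 1))) p * q) = 0 := fun q hq => by
    refine refInt_nodal_mul_of_root hinj _ (Q := legendre (k + 1) + legendre k) ?_ ?_ ?_ ?_
    · rw [card_univ_erase]
      exact (natDegree_add_le _ _).trans
        (max_le (natDegree_legendre_le _) ((natDegree_legendre_le _).trans (by omega)))
    · rw [card_univ_erase, coeff_add, coeff_eq_zero_of_natDegree_lt (n := k + 1)
        ((natDegree_legendre_le k).trans_lt (by omega)), add_zero]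
      exact coeff_legendre_self_ne_zero _
    · exact fun l hl => hp.2 l (Finset.ne_of_mem_erase hl)
    · rw [add_mul, map_add, refInt_legendre_mul (by omega), refInt_legendre_mul hq, add_zero]
  obtain ⟨A, hA0, hA⟩ :=
    exists_weights_of_orthogonal hk hinj (Finset.univ.erase (Fin.last (k + 1))) horth
  rw [card_univ_erase] at hA
  refine ⟨A, isQuadrature_of_exact fun f hf => hA f (by omega), hA0 _ (by simp), ?_⟩
  simpa using horth 1 (by rw [natDegree_one]; omega)

/-- The rule lives on the `k` interior points, so both end weights vanish. The nodal polynomial of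
all points but one end is the interior one times a linear factor, and orthogonality of `L_k` to
linear polynomials is where `k ≥ 2` enters. -/
lemma IsGaussPartition.exists_weights {k : ℕ} (hk : 2 ≤ k) {p : Fin (k + 2) → ℝ}
    (hp : IsGaussPartition p) :
    ∃ A, IsQuadrature p A ∧ IsRightAdapted p A ∧ IsLeftAdapted p A := by
  have hinj := hp.1.1.injective
  have h0l : (0 : Fin (k + 2)) ≠ Fin.last (k + 1) := (Fin.last_pos).ne
  set S : Finset (Fin (k + 2)) := (Finset.univ.erase 0).erase (Fin.last (k + 1)) with hS
  have hcard : S.card = k := by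
    rw [hS, Finset.card_erase_of_mem (by simp [h0l.symm]), card_univ_erase, Nat.add_sub_cancel]
  have horth : ∀ q : ℝ[X], q.natDegree < k → refInt (Lagrange.nodal S p * q) = 0 := fun q hq => by
    refine refInt_nodal_mul_of_root hinj _ (Q := legendre k) ?_ ?_ ?_ (refInt_legendre_mul hq)
    · rw [hcard]; exact natDegree_legendre_le _
    · rw [hcard]; exact coeff_legendre_self_ne_zero _
    · intro l hl
      simp only [hS, Finset.mem_erase] at hl
      exact hp.2 l hl.2.1 hl.1
  obtain ⟨A, hA0, hA⟩ := exists_weights_of_orthogonal (by omega) hinj S horth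
  rw [hcard, ← two_mul] at hA
  have hmon : (Lagrange.nodal S p).Monic := Lagrange.nodal_monic
  have hdeg : (Lagrange.nodal S p).natDegree = k := by rw [Lagrange.natDegree_nodal, hcard]
  have hlin : ∀ c : ℝ, refInt (Lagrange.nodal S p * (X - C c)) = 0 := fun c =>
    horth _ (by rw [natDegree_X_sub_C]; omega)
  have hmono2 : (Lagrange.nodal S p * Lagrange.nodal S p).Monic := hmon.mul hmon
  refine ⟨A, ⟨hA, ?_⟩, ⟨hA0 0 (by simp [hS]), ?_⟩, ⟨hA0 _ (by simp [hS]), ?_⟩⟩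
  -- The squared nodal polynomial is monic of degree `2 * k` and vanishes at the points with nonzero
  -- weight. The rule applied to `X ^ (2 * k)` therefore returns its integral minus that of the
  -- square, which is nonnegative.
  · have hlt : (X ^ (2 * k) - Lagrange.nodal S p * Lagrange.nodal S p).natDegree < 2 * k := by
      have h1 : (Lagrange.nodal S p * Lagrange.nodal S p).natDegree = 2 * k := by
        rw [hmon.natDegree_mul hmon, hdeg, two_mul]
      refine natDegree_lt_of_degree_lt (by omega) ?_
      refine lt_of_lt_of_eq (degree_sub_lt_left ?_ (monic_X_pow _).ne_zero ?_) (degree_X_pow (2 * k))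
      · rw [degree_X_pow, degree_eq_natDegree hmono2.ne_zero, h1]
      · rw [hmono2.leadingCoeff, (monic_X_pow _).leadingCoeff]
    have h2 := hA _ hlt
    rw [map_sub] at h2
    have h3 : ∑ l, A l * (X ^ (2 * k) - Lagrange.nodal S p * Lagrange.nodal S p).eval (p l) =
        ∑ l, A l * p l ^ (2 * k) := by
      refine Finset.sum_congr rfl fun l _ => ?_
      by_cases hl : l ∈ S
      · simp [Lagrange.eval_nodal_at_node hl]
      · simp [hA0 l hl]
    have h4 := refInt_sq_nonneg (Lagrange.nodal S p)
    linarith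
  · rw [Lagrange.nodal_eq_mul_nodal_erase (i := Fin.last (k + 1)) (by simp [h0l.symm]), mul_comm]
    exact hlin _
  · rw [Lagrange.nodal_eq_mul_nodal_erase (i := 0) (by simp [h0l]), mul_comm,
      Finset.erase_right_comm]
    exact hlin _

/-! ### Admissible partitions form a finite set -/

/-- The partitions of the reference element that occur in the LSV and RSV schemes. -/
def IsAdmissible {k : ℕ} (p : Fin (k + 2) → ℝ) : Prop :=
  IsGaussPartition p ∨ IsRightRadauPartition p ∨ IsLeftRadauPartition p

lemma IsAdmissible.refPartition {k : ℕ} {p : Fin (k + 2) → ℝ} (hp : IsAdmissible p) :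
    IsRefPartition p := by
  rcases hp with h | h | h <;> exact h.1

lemma IsRefPartition.mem_Icc {k : ℕ} {p : Fin (k + 2) → ℝ} (hp : IsRefPartition p)
    (l : Fin (k + 2)) : p l ∈ Icc (-1 : ℝ) 1 :=
  ⟨hp.2.1 ▸ hp.1.monotone (Fin.zero_le l), hp.2.2 ▸ hp.1.monotone (Fin.le_last l)⟩

/-- Every point is `-1`, `1` or a root of one of three fixed nonzero polynomials. Finiteness makes
the constants below independent of the element and of the mesh without any explicit knowledge of the
points. -/
lemma finite_setOf_isAdmissible (k : ℕ) :
    {p : Fin (k + 2) → ℝ | IsAdmissible p}.Finite := by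
  have hc1 : (legendre (k + 1)).coeff (k + 1) ≠ 0 := coeff_legendre_self_ne_zero _
  have hc0 : (legendre k).coeff (k + 1) = 0 :=
    coeff_eq_zero_of_natDegree_lt ((natDegree_legendre_le k).trans_lt (by omega))
  have h1 : legendre k ≠ 0 := fun h => coeff_legendre_self_ne_zero k (by rw [h, coeff_zero])
  have h2 : legendre (k + 1) - legendre k ≠ 0 := fun h => hc1 (by
    have := congrArg (fun f => f.coeff (k + 1)) h
    simpa [hc0] using this)
  have h3 : legendre (k + 1) + legendre k ≠ 0 := fun h => hc1 (by
    have := congrArg (fun f => f.coeff (k + 1)) h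
    simpa [hc0] using this)
  have hroots : ∀ f : ℝ[X], f ≠ 0 → {s | f.IsRoot s}.Finite := fun f hf =>
    Set.not_infinite.1 fun h => hf (eq_zero_of_infinite_isRoot f h)
  have hR : ({s | (legendre k).IsRoot s} ∪ {s | (legendre (k + 1) - legendre k).IsRoot s} ∪
      {s | (legendre (k + 1) + legendre k).IsRoot s} ∪ {-1, 1}).Finite :=
    (((hroots _ h1).union (hroots _ h2)).union (hroots _ h3)).union (Set.toFinite _)
  refine (Set.Finite.pi fun _ : Fin (k + 2) => hR).subset fun p hp l _ => ?_
  by_cases h0 : l = 0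
  · exact Or.inr (by rw [h0, hp.refPartition.2.1]; simp)
  by_cases hl : l = Fin.last (k + 1)
  · exact Or.inr (by rw [hl, hp.refPartition.2.2]; simp)
  rcases hp with h | h | h
  · exact Or.inl (Or.inl (Or.inl (h.2 l h0 hl)))
  · exact Or.inl (Or.inl (Or.inr (h.2 l h0)))
  · exact Or.inl (Or.inr (h.2 l hl))

/-- A bound available for each admissible partition holds with a uniform constant. -/
lemma exists_uniform_const {k : ℕ} {P : (Fin (k + 2) → ℝ) → ℝ → Prop}
    (hmono : ∀ p C C', C ≤ C' → P p C → P p C') (h : ∀ p, IsAdmissible p → ∃ C, P p C) :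
    ∃ C, 1 ≤ C ∧ ∀ p, IsAdmissible p → P p C := by
  choose! f hf using h
  obtain ⟨B, hB⟩ := ((finite_setOf_isAdmissible k).image f).bddAbove
  exact ⟨max B 1, le_max_right _ _, fun p hp =>
    hmono p _ _ ((hB (mem_image_of_mem f hp)).trans (le_max_left _ _)) (hf p hp)⟩

lemma exists_uniform_weights {k : ℕ} (hk : 1 ≤ k) :
    ∃ W : ℝ, 1 ≤ W ∧ ∀ p : Fin (k + 2) → ℝ,
      (IsRightRadauPartition p →
        ∃ A, IsQuadrature p A ∧ IsRightAdapted p A ∧ ∀ l, |A l| ≤ W) ∧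
      (IsLeftRadauPartition p →
        ∃ A, IsQuadrature p A ∧ IsLeftAdapted p A ∧ ∀ l, |A l| ≤ W) ∧
      (2 ≤ k → IsGaussPartition p →
        ∃ A, IsQuadrature p A ∧ IsRightAdapted p A ∧ IsLeftAdapted p A ∧ ∀ l, |A l| ≤ W) := by
  have hbd : ∀ A : Fin (k + 2) → ℝ, ∃ W, ∀ l, |A l| ≤ W := fun A =>
    ⟨∑ l, |A l|, fun l => Finset.single_le_sum (f := fun l => |A l|) (fun _ _ => abs_nonneg _)
      (Finset.mem_univ l)⟩
  obtain ⟨W1, hW1, h1⟩ := exists_uniform_const (k := k) (P := fun p W => IsRightRadauPartition p →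
    ∃ A, IsQuadrature p A ∧ IsRightAdapted p A ∧ ∀ l, |A l| ≤ W)
    (fun p C C' hC h hp => let ⟨A, hA, hA', hW⟩ := h hp; ⟨A, hA, hA', fun l => (hW l).trans hC⟩)
    (fun p _ => by
      by_cases hp : IsRightRadauPartition p
      · obtain ⟨A, hA, hA'⟩ := hp.exists_weights hk
        obtain ⟨W, hW⟩ := hbd A
        exact ⟨W, fun _ => ⟨A, hA, hA', hW⟩⟩
      · exact ⟨0, fun h => absurd h hp⟩)
  obtain ⟨W2, hW2, h2⟩ := exists_uniform_const (k := k) (P := fun p W => IsLeftRadauPartition p →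
    ∃ A, IsQuadrature p A ∧ IsLeftAdapted p A ∧ ∀ l, |A l| ≤ W)
    (fun p C C' hC h hp => let ⟨A, hA, hA', hW⟩ := h hp; ⟨A, hA, hA', fun l => (hW l).trans hC⟩)
    (fun p _ => by
      by_cases hp : IsLeftRadauPartition p
      · obtain ⟨A, hA, hA'⟩ := hp.exists_weights hk
        obtain ⟨W, hW⟩ := hbd A
        exact ⟨W, fun _ => ⟨A, hA, hA', hW⟩⟩
      · exact ⟨0, fun h => absurd h hp⟩)
  obtain ⟨W3, hW3, h3⟩ := exists_uniform_const (k := k) (P := fun p W => 2 ≤ k →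
    IsGaussPartition p →
    ∃ A, IsQuadrature p A ∧ IsRightAdapted p A ∧ IsLeftAdapted p A ∧ ∀ l, |A l| ≤ W)
    (fun p C C' hC h hk hp =>
      let ⟨A, hA, hA', hA'', hW⟩ := h hk hp; ⟨A, hA, hA', hA'', fun l => (hW l).trans hC⟩)
    (fun p _ => by
      by_cases hp : 2 ≤ k ∧ IsGaussPartition p
      · obtain ⟨A, hA, hA', hA''⟩ := hp.2.exists_weights hp.1
        obtain ⟨W, hW⟩ := hbd A
        exact ⟨W, fun _ _ => ⟨A, hA, hA', hA'', hW⟩⟩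
      · exact ⟨0, fun h h' => absurd ⟨h, h'⟩ hp⟩)
  refine ⟨max W1 (max W2 W3), hW1.trans (le_max_left _ _), fun p => ⟨fun hp => ?_, fun hp => ?_,
    fun hk hp => ?_⟩⟩
  · obtain ⟨A, hA, hA', hW⟩ := h1 p (Or.inr (Or.inl hp)) hp
    exact ⟨A, hA, hA', fun l => (hW l).trans (le_max_left _ _)⟩
  · obtain ⟨A, hA, hA', hW⟩ := h2 p (Or.inr (Or.inr hp)) hp
    exact ⟨A, hA, hA', fun l => (hW l).trans ((le_max_left _ _).trans (le_max_right _ _))⟩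
  · obtain ⟨A, hA, hA', hA'', hW⟩ := h3 p (Or.inl hp) hk hp
    exact ⟨A, hA, hA', hA'', fun l => (hW l).trans ((le_max_right _ _).trans (le_max_right _ _))⟩

/-- Uniform stability of Lagrange interpolation at `k + 1` of the `k + 2` points. -/
lemma exists_lebesgue_const (k : ℕ) :
    ∃ W : ℝ, 1 ≤ W ∧ ∀ p : Fin (k + 2) → ℝ, IsAdmissible p →
      ∀ (o : Fin (k + 2)) (f : ℝ[X]) (B : ℝ), f.natDegree ≤ k → (∀ l, l ≠ o → |f.eval (p l)| ≤ B) →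
        ∀ s ∈ Icc (-1 : ℝ) 1, |f.eval s| ≤ W * B := by
  have hB0 : ∀ (p : Fin (k + 2) → ℝ) (o : Fin (k + 2)) (f : ℝ[X]) (B : ℝ),
      (∀ l, l ≠ o → |f.eval (p l)| ≤ B) → 0 ≤ B := fun p o f B h => by
    obtain ⟨l, hl⟩ := exists_ne o
    exact (abs_nonneg _).trans (h l hl)
  refine exists_uniform_const (P := fun p W => ∀ (o : Fin (k + 2)) (f : ℝ[X]) (B : ℝ),
    f.natDegree ≤ k → (∀ l, l ≠ o → |f.eval (p l)| ≤ B) →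
        ∀ s ∈ Icc (-1 : ℝ) 1, |f.eval s| ≤ W * B)
    (fun p C C' hC h o f B hf hB s hs => (h o f B hf hB s hs).trans
      (mul_le_mul_of_nonneg_right hC (hB0 p o f B hB))) fun p hp => ?_
  have hinj := hp.refPartition.1.injective
  have hbas : ∀ o l : Fin (k + 2), ∃ C, ∀ s ∈ Icc (-1 : ℝ) 1,
      |(Lagrange.basis (Finset.univ.erase o) p l).eval s| ≤ C := fun o l => by
    obtain ⟨C, hC⟩ := isCompact_Icc.exists_bound_of_continuousOn (s := Icc (-1 : ℝ) 1)
      (Lagrange.basis (Finset.univ.erase o) p l).continuous.continuousOn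
    exact ⟨C, fun s hs => by simpa using hC s hs⟩
  choose C hC using hbas
  have hC0 : ∀ o l, 0 ≤ C o l := fun o l =>
    (abs_nonneg _).trans (hC o l 0 (by norm_num))
  -- Summing over all omitted indices `o` gives one constant for every choice of interpolation
  -- nodes.
  refine ⟨∑ o, ∑ l, C o l, fun o f B hf hB s hs => ?_⟩
  have hdeg : f.degree < (Finset.univ.erase o : Finset (Fin (k + 2))).card := by
    rw [card_univ_erase]
    exact (degree_le_of_natDegree_le hf).trans_lt (by exact_mod_cast Nat.lt_succ_self k)
  have hB' := hB0 p o f B hB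
  rw [Lagrange.eq_interpolate (v := p) hinj.injOn hdeg, Lagrange.interpolate_apply, eval_finsetSum]
  calc _ ≤ ∑ l ∈ Finset.univ.erase o, C o l * B := by
        refine (Finset.abs_sum_le_sum_abs _ _).trans (Finset.sum_le_sum fun l hl => ?_)
        rw [eval_mul, eval_C, abs_mul, mul_comm]
        exact mul_le_mul (hC o l s hs) (hB l (Finset.ne_of_mem_erase hl)) (abs_nonneg _) (hC0 o l)
    _ ≤ (∑ l, C o l) * B := by
        rw [Finset.sum_mul]
        exact Finset.sum_le_sum_of_subset_of_nonneg (Finset.erase_subset _ _)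
          fun l _ _ => mul_nonneg (hC0 o l) hB'
    _ ≤ (∑ o, ∑ l, C o l) * B :=
        mul_le_mul_of_nonneg_right (Finset.single_le_sum (f := fun o => ∑ l, C o l)
          (fun o _ => Finset.sum_nonneg fun l _ => hC0 o l) (Finset.mem_univ o)) hB'

/-! ### Equivalence of norms on polynomials of bounded degree -/

/-- The `L²` norm of a polynomial on the reference element. -/
def refNorm (f : ℝ[X]) : ℝ := Real.sqrt (refInt (f * f))

lemma refNorm_nonneg (f : ℝ[X]) : 0 ≤ refNorm f := Real.sqrt_nonneg _

lemma refNorm_sq (f : ℝ[X]) : refNorm f ^ 2 = refInt (f * f) := Real.sq_sqrt (refInt_sq_nonneg f)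

lemma refInt_sq_pos {f : ℝ[X]} (hf : f ≠ 0) : 0 < refInt (f * f) := by
  rw [refInt_apply]
  refine intervalIntegral.integral_pos (by norm_num) (f * f).continuous.continuousOn
    (fun s _ => by rw [eval_mul]; exact mul_self_nonneg _) ?_
  by_contra! h
  refine hf (eq_zero_of_infinite_isRoot f ((Icc_infinite (by norm_num : (-1 : ℝ) < 1)).mono ?_))
  intro s hs
  have := h s hs
  rw [eval_mul] at this
  exact mul_self_eq_zero.1 (le_antisymm this (mul_self_nonneg _))

/-- Compactness: the continuous form `refInt (f * f)` has a positive minimum `μ` on the unit sphere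
of coefficient vectors, and homogeneity extends the bound. -/
lemma exists_coeff_le_refNorm (k : ℕ) :
    ∃ K : ℝ, 1 ≤ K ∧ ∀ f : ℝ[X], f.natDegree ≤ k → ∀ m, |f.coeff m| ≤ K * refNorm f := by
  let P : (Fin (k + 1) → ℝ) → ℝ[X] := fun c => ∑ m, C (c m) * X ^ (m : ℕ)
  have hcoeff : ∀ c m, (P c).coeff (m : Fin (k + 1)) = c m := fun c m => by
    simp only [P, finsetSum_coeff, coeff_C_mul_X_pow, Fin.val_inj]
    simp
  have hcont : Continuous fun c => refInt (P c * P c) := by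
    have : (fun c => refInt (P c * P c)) = fun c => ∑ m : Fin (k + 1), ∑ n : Fin (k + 1),
        c m * c n * refInt (X ^ (m : ℕ) * X ^ (n : ℕ)) := by
      funext c
      simp only [P]
      rw [Finset.sum_mul_sum, map_sum]
      refine Finset.sum_congr rfl fun m _ => ?_
      rw [map_sum]
      refine Finset.sum_congr rfl fun n _ => ?_
      rw [← smul_eq_mul (c m * c n), ← map_smul, smul_eq_C_mul, C_mul]
      congr 1; ring
    rw [this]
    fun_prop
  obtain ⟨c₀, hc₀, hmin⟩ := (isCompact_sphere (0 : Fin (k + 1) → ℝ) 1).exists_isMinOn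
    (NormedSpace.sphere_nonempty.2 zero_le_one) hcont.continuousOn
  have hPne : P c₀ ≠ 0 := fun h => by
    have : c₀ = 0 := funext fun m => by rw [← hcoeff c₀ m, h, coeff_zero]; rfl
    rw [this] at hc₀
    simp at hc₀
  have hμ := refInt_sq_pos hPne
  set μ := refInt (P c₀ * P c₀) with hμdef
  have hsq : 0 < Real.sqrt μ := Real.sqrt_pos.2 hμ
  refine ⟨max 1 (1 / Real.sqrt μ), le_max_left _ _, fun f hf m => ?_⟩
  have hn := refNorm_nonneg f
  rcases lt_or_ge k m with hm | hm
  · rw [coeff_eq_zero_of_natDegree_lt (hf.trans_lt hm), abs_zero]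
    positivity
  let c : Fin (k + 1) → ℝ := fun j => f.coeff j
  have hfP : f = P c := by
    conv_lhs => rw [as_sum_range_C_mul_X_pow' f (Nat.lt_succ_of_le hf)]
    rw [← Fin.sum_univ_eq_sum_range (fun i => C (f.coeff i) * X ^ i)]
  suffices h : Real.sqrt μ * ‖c‖ ≤ refNorm f by
    have h1 : |f.coeff m| ≤ ‖c‖ := norm_le_pi_norm c ⟨m, Nat.lt_succ_of_le hm⟩
    have h2 : ‖c‖ ≤ 1 / Real.sqrt μ * refNorm f := by
      rw [div_mul_eq_mul_div, one_mul, le_div_iff₀ hsq]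
      linarith
    exact h1.trans (h2.trans (mul_le_mul_of_nonneg_right (le_max_right _ _) hn))
  rcases eq_or_ne c 0 with h0 | h0
  · rw [h0, norm_zero, mul_zero]
    exact hn
  have hc := norm_pos_iff.2 h0
  have hmem : ‖c‖⁻¹ • c ∈ Metric.sphere (0 : Fin (k + 1) → ℝ) 1 := by
    rw [mem_sphere_zero_iff_norm, norm_smul, norm_inv, norm_norm, inv_mul_cancel₀ hc.ne']
  have hle : μ ≤ refInt (P (‖c‖⁻¹ • c) * P (‖c‖⁻¹ • c)) := hmin hmem
  have hP : P (‖c‖⁻¹ • c) = ‖c‖⁻¹ • P c := by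
    simp only [P, Finset.smul_sum, Pi.smul_apply, smul_eq_mul, C_mul, smul_eq_C_mul, mul_assoc]
  rw [hP, smul_mul_smul_comm, map_smul, ← hfP, smul_eq_mul, ← mul_inv, inv_mul_eq_div,
    le_div_iff₀ (by positivity)] at hle
  rw [refNorm]
  refine Real.le_sqrt_of_sq_le ?_
  rw [mul_pow, Real.sq_sqrt hμ.le, sq ‖c‖]
  exact hle

/-- Polynomials of degree at most `k`, their derivatives and coefficients are bounded by their
`L²` norm on the reference element. -/
lemma exists_inverse_const (k : ℕ) :
    ∃ K : ℝ, 1 ≤ K ∧ ∀ f : ℝ[X], f.natDegree ≤ k →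
      (∀ m, |f.coeff m| ≤ K * refNorm f) ∧
      ∀ s ∈ Icc (-1 : ℝ) 1, |f.eval s| ≤ K * refNorm f ∧
        |(derivative f).eval s| ≤ K * refNorm f := by
  obtain ⟨K, hK, h⟩ := exists_coeff_le_refNorm k
  have hpow : ∀ s ∈ Icc (-1 : ℝ) 1, ∀ n, |s ^ n| ≤ 1 := fun s hs n => by
    rw [abs_pow]
    exact pow_le_one₀ (abs_nonneg _) (abs_le.2 hs)
  have hk : (0 : ℝ) ≤ k := k.cast_nonneg
  have hK1 : K ≤ (k + 1) ^ 2 * K := le_mul_of_one_le_left (by linarith) (by nlinarith)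
  refine ⟨(k + 1) ^ 2 * K, hK.trans hK1, fun f hf => ?_⟩
  have hn := refNorm_nonneg f
  refine ⟨fun m => (h f hf m).trans (mul_le_mul_of_nonneg_right hK1 hn), fun s hs => ⟨?_, ?_⟩⟩
  · rw [eval_eq_sum_range' (Nat.lt_succ_of_le hf)]
    calc _ ≤ ∑ _i ∈ Finset.range (k + 1), K * refNorm f := by
          refine (Finset.abs_sum_le_sum_abs _ _).trans (Finset.sum_le_sum fun i _ => ?_)
          rw [abs_mul]
          exact (mul_le_of_le_one_right (abs_nonneg _) (hpow s hs i)).trans (h f hf i)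
      _ ≤ _ := by
          rw [Finset.sum_const, Finset.card_range, nsmul_eq_mul]
          push_cast
          have : 0 ≤ k * (k + 1) * (K * refNorm f) := by positivity
          linarith
  · rw [eval_eq_sum_range' (n := k + 1) (Nat.lt_succ_of_le ((natDegree_derivative_le f).trans
      ((Nat.sub_le _ _).trans hf)))]
    calc _ ≤ ∑ _i ∈ Finset.range (k + 1), (k + 1) * (K * refNorm f) := by
          refine (Finset.abs_sum_le_sum_abs _ _).trans (Finset.sum_le_sum fun i hi => ?_)
          rw [abs_mul]
          refine (mul_le_of_le_one_right (abs_nonneg _) (hpow s hs i)).trans ?_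
          rw [coeff_derivative, abs_mul, mul_comm]
          refine mul_le_mul ?_ (h f hf _) (abs_nonneg _) (by positivity)
          rw [abs_of_nonneg (by positivity)]
          have : (i : ℝ) < k + 1 := by exact_mod_cast Finset.mem_range.1 hi
          have : (i : ℝ) ≤ k := by
            exact_mod_cast Nat.lt_succ_iff.1 (Finset.mem_range.1 hi)
          linarith
      _ ≤ _ := by
          rw [Finset.sum_const, Finset.card_range, nsmul_eq_mul]
          push_cast
          apply le_of_eq; ring

/-! ### Test functions constant on the control volumes -/

lemma sum_ite_le_sub {n : ℕ} (F : Fin (n + 1) → ℝ) (l : Fin (n + 1)) :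
    ∑ j : Fin n, (if l ≤ j.castSucc then F j.succ - F j.castSucc else 0) = F (Fin.last n) - F l := by
  induction n with
  | zero =>
    obtain rfl : l = 0 := by omega
    simp
  | succ n ih =>
    rw [Fin.sum_univ_castSucc]
    refine Fin.lastCases ?_ (fun l => ?_) l
    · rw [Finset.sum_eq_zero fun j _ => if_neg (not_le.2 ?_), if_neg (not_le.2 ?_)]
      · simp
      · exact Fin.castSucc_lt_last _
      · exact Fin.castSucc_lt_last _
    · have h := ih (fun j => F j.castSucc) l
      simp only [Fin.castSucc_le_castSucc_iff, Fin.le_last, if_true, Fin.succ_last]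
      rw [show (∑ j : Fin n, if l ≤ j.castSucc then
        F j.castSucc.succ - F j.castSucc.castSucc else 0) = F (Fin.last n).castSucc - F l.castSucc
        from h]
      simp

/-- Summation by parts on the control volumes of an element. -/
lemma sum_partial_mul_sub {n : ℕ} (a F : Fin (n + 1) → ℝ) :
    ∑ j : Fin n, (∑ l, if l ≤ j.castSucc then a l else 0) * (F j.succ - F j.castSucc) =
      ∑ l, a l * (F (Fin.last n) - F l) := by
  simp_rw [← sum_ite_le_sub, Finset.mul_sum, Finset.sum_mul]
  rw [Finset.sum_comm]
  refine Finset.sum_congr rfl fun l _ => Finset.sum_congr rfl fun j _ => ?_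
  split_ifs <;> simp

/-- The pairing of the point values `F` of a flux with the test function that comes from `w`. -/
def fluxPairing {k : ℕ} (p A : Fin (k + 2) → ℝ) (w : ℝ[X]) (F : Fin (k + 2) → ℝ) : ℝ :=
  w.eval 1 * F (Fin.last (k + 1)) - w.eval (-1) * F 0 -
    ∑ l, A l * (derivative w).eval (p l) * F l

/-- The step function takes on the `j`-th control volume the value `w(-1)` plus the quadrature jumps
at the points up to its left end. Exactness on `w'` makes all jumps add up to `w(1) - w(-1)`, so
summation by parts produces exactly the boundary values of `w`. -/
lemma exists_test_function {k : ℕ} (hk : 1 ≤ k) {p A : Fin (k + 2) → ℝ} (hA : IsQuadrature p A)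
    (hp : IsRefPartition p) {K W : ℝ} (hW : ∀ l, |A l| ≤ W) {w : ℝ[X]} (hw : w.natDegree ≤ k)
    (hK : ∀ s ∈ Icc (-1 : ℝ) 1, |w.eval s| ≤ K ∧ |(derivative w).eval s| ≤ K) :
    ∃ c : Fin (k + 1) → ℝ, (∀ j, |c j| ≤ (1 + (k + 2) * W) * K) ∧
      ∀ F : Fin (k + 2) → ℝ,
        ∑ j, c j * (F j.succ - F j.castSucc) = fluxPairing p A w F := by
  let a : Fin (k + 2) → ℝ := fun l => A l * (derivative w).eval (p l)
  have hsum : ∑ l, a l = w.eval 1 - w.eval (-1) := by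
    rw [← refInt_derivative, hA.exact _ ((natDegree_derivative_le w).trans_lt (by omega))]
  refine ⟨fun j => w.eval (-1) + ∑ l, if l ≤ j.castSucc then a l else 0, fun j => ?_, fun F => ?_⟩
  · have hW0 : 0 ≤ W := (abs_nonneg _).trans (hW 0)
    have hK0 : 0 ≤ K := (abs_nonneg _).trans (hK 0 (by norm_num)).1
    have h1 := (hK (-1) (by norm_num)).1
    have h2 : |∑ l, if l ≤ j.castSucc then a l else 0| ≤ ∑ _l : Fin (k + 2), W * K := by
      refine (Finset.abs_sum_le_sum_abs _ _).trans (Finset.sum_le_sum fun l _ => ?_)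
      split_ifs
      · rw [abs_mul]
        exact mul_le_mul (hW l) (hK _ (hp.mem_Icc l)).2 (abs_nonneg _) hW0
      · rw [abs_zero]; positivity
    rw [Finset.sum_const, Finset.card_univ, Fintype.card_fin, nsmul_eq_mul] at h2
    push_cast at h2
    refine (abs_add_le _ _).trans ?_
    linarith
  · simp only [add_mul, Finset.sum_add_distrib, ← Finset.mul_sum]
    rw [sum_partial_mul_sub]
    have h3 := sum_ite_le_sub F 0
    simp only [Fin.zero_le, if_true] at h3
    rw [h3, fluxPairing]
    simp only [mul_sub, Finset.sum_sub_distrib, ← Finset.sum_mul, hsum]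
    simp only [a]
    ring

/-! ### The mass form -/

/-- The bilinear form `∫ v w + κ v_k w_k`. -/
def massForm (k : ℕ) (κ : ℝ) : ℝ[X] →ₗ[ℝ] ℝ[X] →ₗ[ℝ] ℝ :=
  LinearMap.mk₂ ℝ (fun v w => refInt (v * w) + κ * (v.coeff k * w.coeff k))
    (fun v v' w => by simp only [add_mul, map_add, coeff_add]; ring)
    (fun c v w => by simp only [smul_mul_assoc, map_smul, coeff_smul, smul_eq_mul]; ring)
    (fun v w w' => by simp only [mul_add, map_add, coeff_add]; ring)
    (fun c v w => by simp only [mul_smul_comm, map_smul, coeff_smul, smul_eq_mul]; ring)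

lemma massForm_apply (k : ℕ) (κ : ℝ) (v w : ℝ[X]) :
    massForm k κ v w = refInt (v * w) + κ * (v.coeff k * w.coeff k) := rfl

lemma massForm_comm (k : ℕ) (κ : ℝ) (v w : ℝ[X]) : massForm k κ v w = massForm k κ w v := by
  rw [massForm_apply, massForm_apply, mul_comm v, mul_comm (v.coeff k)]

lemma refNorm_sq_le_massForm {k : ℕ} {κ : ℝ} (hκ : 0 ≤ κ) (v : ℝ[X]) :
    refNorm v ^ 2 ≤ massForm k κ v v := by
  rw [massForm_apply, refNorm_sq]
  have := mul_nonneg hκ (mul_self_nonneg (v.coeff k))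
  linarith

lemma exists_antiderivative (v : ℝ[X]) :
    ∃ G : ℝ[X], derivative G = v ∧ G.eval (-1) = 0 ∧ G.natDegree ≤ v.natDegree + 1 := by
  let G : ℝ[X] := ∑ i ∈ Finset.range (v.natDegree + 1), C (v.coeff i / (i + 1)) * X ^ (i + 1)
  have hG : derivative G = v := by
    conv_rhs => rw [v.as_sum_range_C_mul_X_pow]
    simp only [G, derivative_sum]
    refine Finset.sum_congr rfl fun i _ => ?_
    rw [derivative_C_mul_X_pow, Nat.add_sub_cancel]
    congr 2
    push_cast
    field_simp
  have hdeg : G.natDegree ≤ v.natDegree + 1 :=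
    natDegree_sum_le_of_forall_le _ _ fun i hi => (natDegree_C_mul_X_pow_le _ _).trans
      (Nat.succ_le_of_lt (Finset.mem_range.1 hi))
  refine ⟨G - C (G.eval (-1)), by simp [hG], by simp, ?_⟩
  exact natDegree_sub_C.trans_le hdeg

/-- The weight of the leading coefficients in the mass form induced by a quadrature rule. -/
def massDefect {k : ℕ} (p A : Fin (k + 2) → ℝ) : ℝ :=
  k / (k + 1) * (refInt (X ^ (2 * k)) - ∑ l, A l * p l ^ (2 * k))

lemma massDefect_nonneg {k : ℕ} {p A : Fin (k + 2) → ℝ} (hA : IsQuadrature p A) :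
    0 ≤ massDefect p A :=
  mul_nonneg (by positivity) (sub_nonneg.2 hA.top)

lemma massDefect_le {k : ℕ} {p A : Fin (k + 2) → ℝ} (hp : IsRefPartition p) {W : ℝ}
    (hW : ∀ l, |A l| ≤ W) : massDefect p A ≤ 2 + (k + 2) * W := by
  have hpow : ∀ s ∈ Icc (-1 : ℝ) 1, ∀ n, |s ^ n| ≤ 1 := fun s hs n => by
    rw [abs_pow]
    exact pow_le_one₀ (abs_nonneg _) (abs_le.2 hs)
  have hW0 : 0 ≤ W := (abs_nonneg _).trans (hW 0)
  have h1 : refInt (X ^ (2 * k)) ≤ 2 := by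
    have : ∫ s in (-1 : ℝ)..1, (X ^ (2 * k) : ℝ[X]).eval s ≤ ∫ _s in (-1 : ℝ)..1, (1 : ℝ) := by
      refine intervalIntegral.integral_mono_on (by norm_num)
        ((X ^ (2 * k) : ℝ[X]).continuous.intervalIntegrable _ _) (by simp) fun s hs => ?_
      rw [eval_pow, eval_X]
      exact (le_abs_self _).trans (hpow s hs _)
    rw [refInt_apply]
    refine this.trans ?_
    simp
    norm_num
  have h2 : -(∑ l, A l * p l ^ (2 * k)) ≤ (k + 2) * W := by
    refine (neg_le_abs _).trans ((Finset.abs_sum_le_sum_abs _ _).trans ?_)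
    refine (Finset.sum_le_sum (g := fun _ => W) fun l _ => ?_).trans (by simp)
    rw [abs_mul]
    exact (mul_le_of_le_one_right (abs_nonneg _) (hpow _ (hp.mem_Icc l) _)).trans (hW l)
  have h3 : (k : ℝ) / (k + 1) ≤ 1 := by
    rw [div_le_one (by positivity)]; linarith
  have h4 : (0 : ℝ) ≤ k / (k + 1) := by positivity
  have h5 : 0 ≤ 2 + (k + 2) * W := by positivity
  rw [massDefect]
  calc (k : ℝ) / (k + 1) * (refInt (X ^ (2 * k)) - ∑ l, A l * p l ^ (2 * k))
      ≤ k / (k + 1) * (2 + (k + 2) * W) := mul_le_mul_of_nonneg_left (by linarith) h4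
    _ ≤ 1 * (2 + (k + 2) * W) := mul_le_mul_of_nonneg_right h3 h5
    _ = _ := one_mul _

/-- Pairing the primitive of `v` with `w` gives the mass form. -/
lemma fluxPairing_primitive {k : ℕ} (hk : 1 ≤ k) {p A : Fin (k + 2) → ℝ} (hA : IsQuadrature p A)
    (hp : IsRefPartition p) {v w : ℝ[X]} (hv : v.natDegree ≤ k) (hw : w.natDegree ≤ k) :
    fluxPairing p A w (fun l => ∫ s in (-1 : ℝ)..p l, v.eval s) =
      massForm k (massDefect p A) v w := by
  obtain ⟨G, rfl, hG0, hGdeg⟩ := exists_antiderivative v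
  have hGk : G.natDegree ≤ k + 1 := hGdeg.trans (by omega)
  have hwk : (derivative w).natDegree ≤ k - 1 := (natDegree_derivative_le w).trans (by omega)
  have hprod : (derivative w * G).natDegree ≤ 2 * k :=
    natDegree_mul_le.trans ((add_le_add hwk hGk).trans (by omega))
  set c := (derivative w * G).coeff (2 * k) with hc
  -- The top coefficient of `w'` is `k` times that of `w`, and the top coefficient of the primitive
  -- `G` is that of `v` divided by `k + 1`; this explains the factor in `massDefect`.
  have hcval : c = k / (k + 1) * ((derivative G).coeff k * w.coeff k) := by
    have h1 := coeff_mul_add_eq_of_natDegree_le hwk hGk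
    rw [show k - 1 + (k + 1) = 2 * k by omega] at h1
    rw [hc, h1, coeff_derivative, coeff_derivative, Nat.sub_add_cancel hk, Nat.cast_sub hk]
    have : (k : ℝ) + 1 ≠ 0 := by positivity
    field_simp
    push_cast
    ring
  -- The rule is exact only below degree `2 * k`, so the top term is split off; its quadrature error
  -- is the additional term of the mass form.
  have hlt : (derivative w * G - C c * X ^ (2 * k)).natDegree < 2 * k := by
    refine natDegree_lt_of_degree_lt (by omega) ((degree_lt_iff_coeff_zero _ _).2 fun j hj => ?_)
    rw [coeff_sub, coeff_C_mul_X_pow]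
    rcases hj.eq_or_lt with rfl | hj
    · simp [hc]
    · rw [coeff_eq_zero_of_natDegree_lt (hprod.trans_lt hj), if_neg hj.ne', sub_zero]
  have hq := hA.exact _ hlt
  simp only [map_sub, ← smul_eq_C_mul, map_smul, eval_sub, eval_smul, eval_mul, eval_pow, eval_X,
    smul_eq_mul, mul_sub, Finset.sum_sub_distrib] at hq
  have hparts := refInt_derivative_mul w G
  rw [mul_comm w] at hparts
  simp only [fluxPairing, integral_eval_derivative, hG0, sub_zero, hp.2.1, hp.2.2, massForm_apply,
    massDefect]
  have e1 : ∑ l, A l * ((derivative w).eval (p l) * G.eval (p l)) =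
      ∑ l, A l * (derivative w).eval (p l) * G.eval (p l) :=
    Finset.sum_congr rfl fun l _ => by ring
  have e2 : ∑ l, A l * (c * p l ^ (2 * k)) = c * ∑ l, A l * p l ^ (2 * k) := by
    rw [Finset.mul_sum]
    exact Finset.sum_congr rfl fun l _ => by ring
  have e3 : k / (k + 1) * (refInt (X ^ (2 * k)) - ∑ l, A l * p l ^ (2 * k)) *
      ((derivative G).coeff k * w.coeff k) =
      c * (refInt (X ^ (2 * k)) - ∑ l, A l * p l ^ (2 * k)) := by
    rw [hcval]; ring
  rw [e1, e2] at hq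
  rw [e3]
  rw [hG0] at hparts
  linarith

/-! ### Functions with bounded derivatives and Lipschitz top derivative -/

/-- `f` has derivatives up to order `n` on `I`, bounded by `M`, the last one being `M`-Lipschitz. -/
def Reg (I : Set ℝ) : ℕ → ℝ → (ℝ → ℝ) → Prop
  | 0, M, f => (∀ y ∈ I, |f y| ≤ M) ∧ ∀ y ∈ I, ∀ z ∈ I, |f y - f z| ≤ M * |y - z|
  | n + 1, M, f => (∀ y ∈ I, |f y| ≤ M) ∧
      ∃ f' : ℝ → ℝ, (∀ y ∈ I, HasDerivWithinAt f (f' y) I y) ∧ Reg I n M f'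

namespace Reg

variable {I : Set ℝ} {n : ℕ} {M K : ℝ} {f g : ℝ → ℝ}

lemma abs_le (h : Reg I n M f) {y : ℝ} (hy : y ∈ I) : |f y| ≤ M := by
  cases n with
  | zero => exact h.1 y hy
  | succ n => exact h.1 y hy

lemma mono_const (hMK : M ≤ K) (h : Reg I n M f) : Reg I n K f := by
  induction n generalizing f with
  | zero => exact ⟨fun y hy => (h.1 y hy).trans hMK, fun y hy z hz => (h.2 y hy z hz).trans
      (mul_le_mul_of_nonneg_right hMK (abs_nonneg _))⟩
  | succ n ih =>
    obtain ⟨h1, f', hf', h2⟩ := h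
    exact ⟨fun y hy => (h1 y hy).trans hMK, f', hf', ih h2⟩

lemma congr (h : Reg I n M f) (hfg : ∀ y ∈ I, g y = f y) : Reg I n M g := by
  cases n with
  | zero =>
    exact ⟨fun y hy => by rw [hfg y hy]; exact h.1 y hy,
      fun y hy z hz => by rw [hfg y hy, hfg z hz]; exact h.2 y hy z hz⟩
  | succ n =>
    obtain ⟨h1, f', hf', h2⟩ := h
    exact ⟨fun y hy => by rw [hfg y hy]; exact h1 y hy, f',
      fun y hy => (hf' y hy).congr hfg (hfg y hy), h2⟩

lemma of_succ (hI : Convex ℝ I) (h : Reg I (n + 1) M f) : Reg I n M f := by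
  induction n generalizing f with
  | zero =>
    obtain ⟨h1, f', hf', h2⟩ := h
    refine ⟨h1, fun y hy z hz => ?_⟩
    exact hI.norm_image_sub_le_of_norm_hasDerivWithin_le hf' (fun x hx => h2.1 x hx) hz hy
  | succ n ih =>
    obtain ⟨h1, f', hf', h2⟩ := h
    exact ⟨h1, f', hf', ih h2⟩

lemma add (hf : Reg I n M f) (hg : Reg I n K g) : Reg I n (M + K) (fun y => f y + g y) := by
  induction n generalizing f g with
  | zero =>
    refine ⟨fun y hy => (abs_add_le _ _).trans (add_le_add (hf.1 y hy) (hg.1 y hy)),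
      fun y hy z hz => ?_⟩
    rw [add_sub_add_comm, add_mul]
    exact (abs_add_le _ _).trans (add_le_add (hf.2 y hy z hz) (hg.2 y hy z hz))
  | succ n ih =>
    obtain ⟨h1, f', hf', h2⟩ := hf
    obtain ⟨h3, g', hg', h4⟩ := hg
    exact ⟨fun y hy => (abs_add_le _ _).trans (add_le_add (h1 y hy) (h3 y hy)),
      fun y => f' y + g' y, fun y hy => (hf' y hy).add (hg' y hy), ih h2 h4⟩

lemma neg (hf : Reg I n M f) : Reg I n M (fun y => -f y) := by
  induction n generalizing f with
  | zero =>
    refine ⟨fun y hy => by rw [abs_neg]; exact hf.1 y hy, fun y hy z hz => ?_⟩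
    rw [← neg_sub', abs_neg]
    exact hf.2 y hy z hz
  | succ n ih =>
    obtain ⟨h1, f', hf', h2⟩ := hf
    exact ⟨fun y hy => by rw [abs_neg]; exact h1 y hy, fun y => -f' y,
      fun y hy => (hf' y hy).neg, ih h2⟩

lemma sub (hf : Reg I n M f) (hg : Reg I n K g) : Reg I n (M + K) (fun y => f y - g y) :=
  (hf.add hg.neg).congr fun _ _ => sub_eq_add_neg _ _

/-- The product rule doubles the constant at each order, the Lipschitz bound at order zero
accounting for the first factor two. -/
lemma mul (hI : Convex ℝ I) (hM : 0 ≤ M) (hK : 0 ≤ K) (hf : Reg I n M f) (hg : Reg I n K g) :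
    Reg I n (2 ^ (n + 1) * (M * K)) (fun y => f y * g y) := by
  have hMK : 0 ≤ M * K := mul_nonneg hM hK
  have hle : ∀ n : ℕ, M * K ≤ 2 ^ n * (M * K) := fun n =>
    le_mul_of_one_le_left hMK (one_le_pow₀ one_le_two)
  induction n generalizing f g with
  | zero =>
    refine ⟨fun y hy => ?_, fun y hy z hz => ?_⟩
    · rw [abs_mul]
      exact (mul_le_mul (hf.1 y hy) (hg.1 y hy) (abs_nonneg _) hM).trans (hle _)
    · have h1 := mul_le_mul (hf.1 y hy) (hg.2 y hy z hz) (abs_nonneg _) hM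
      have h2 := mul_le_mul (hg.1 z hz) (hf.2 y hy z hz) (abs_nonneg _) hK
      rw [← abs_mul] at h1 h2
      have h3 : f y * g y - f z * g z = f y * (g y - g z) + g z * (f y - f z) := by ring
      rw [h3]
      refine (abs_add_le _ _).trans ((add_le_add h1 h2).trans (le_of_eq ?_))
      ring
  | succ n ih =>
    have hf₀ := hf.of_succ hI
    have hg₀ := hg.of_succ hI
    obtain ⟨h1, f', hf', h2⟩ := hf
    obtain ⟨h3, g', hg', h4⟩ := hg
    refine ⟨fun y hy => ?_, fun y => f' y * g y + f y * g' y,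
      fun y hy => (hf' y hy).mul (hg' y hy), ?_⟩
    · rw [abs_mul]
      exact (mul_le_mul (h1 y hy) (h3 y hy) (abs_nonneg _) hM).trans (hle _)
    · exact ((ih h2 hg₀).add (ih hf₀ h4)).mono_const (le_of_eq (by ring))

lemma continuousOn_of_succ (h : Reg I (n + 1) M f) : ContinuousOn f I := by
  obtain ⟨-, f', hf', -⟩ := h
  exact fun y hy => (hf' y hy).continuousWithinAt

lemma continuousOn (h : Reg I n M f) : ContinuousOn f I := by
  cases n with
  | zero =>
    have : LipschitzOnWith M.toNNReal f I := LipschitzOnWith.of_dist_le_mul fun y hy z hz => by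
      rw [Real.dist_eq, Real.dist_eq]
      exact (h.2 y hy z hz).trans (mul_le_mul_of_nonneg_right (Real.le_coe_toNNReal M)
        (abs_nonneg _))
    exact this.continuousOn
  | succ n => exact h.continuousOn_of_succ

end Reg

/-! ### Local polynomial approximation -/

lemma exists_polynomial_of_deriv {f f' : ℝ → ℝ} {c d ε : ℝ} (hcd : c ≤ d)
    (hf : ∀ y ∈ Icc c d, HasDerivWithinAt f (f' y) (Icc c d) y) {Q : ℝ[X]}
    (hQ : ∀ y ∈ Icc c d, |f' y - Q.eval y| ≤ ε) :
    ∃ P : ℝ[X], derivative P = Q ∧ P.natDegree ≤ Q.natDegree + 1 ∧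
      ∀ y ∈ Icc c d, |f y - P.eval y| ≤ ε * (d - c) := by
  obtain ⟨G, hG, -, hdeg⟩ := exists_antiderivative Q
  have hε : 0 ≤ ε := (abs_nonneg _).trans (hQ c (left_mem_Icc.2 hcd))
  refine ⟨G + C (f c - G.eval c), by simp [hG], ?_, fun y hy => ?_⟩
  · rw [natDegree_add_C]; exact hdeg
  · have hder : ∀ z ∈ Icc c d,
        HasDerivWithinAt (fun z => f z - G.eval z) (f' z - Q.eval z) (Icc c d) z := fun z hz => by
      have := (G.hasDerivAt z).hasDerivWithinAt (s := Icc c d)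
      rw [hG] at this
      exact (hf z hz).sub this
    have h := (convex_Icc c d).norm_image_sub_le_of_norm_hasDerivWithin_le hder
      (fun z hz => hQ z hz) (left_mem_Icc.2 hcd) hy
    rw [Real.norm_eq_abs, Real.norm_eq_abs, abs_of_nonneg (sub_nonneg.2 hy.1)] at h
    rw [eval_add, eval_C]
    calc |f y - (G.eval y + (f c - G.eval c))| = |f y - G.eval y - (f c - G.eval c)| := by
          congr 1; ring
      _ ≤ ε * (y - c) := h
      _ ≤ ε * (d - c) := mul_le_mul_of_nonneg_left (by linarith [hy.2]) hε

/-- Taylor approximation on a subinterval. -/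
lemma Reg.exists_polynomial {I : Set ℝ} {n : ℕ} {M : ℝ} {f : ℝ → ℝ} (h : Reg I n M f)
    {c d : ℝ} (hcd : c ≤ d) (hI : Icc c d ⊆ I) :
    ∃ P : ℝ[X], P.natDegree ≤ n ∧ ∀ y ∈ Icc c d, |f y - P.eval y| ≤ M * (d - c) ^ (n + 1) := by
  induction n generalizing f with
  | zero =>
    refine ⟨C (f c), by simp, fun y hy => ?_⟩
    have hM : 0 ≤ M := (abs_nonneg _).trans (h.1 c (hI (left_mem_Icc.2 hcd)))
    rw [eval_C, zero_add, pow_one]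
    refine (h.2 y (hI hy) c (hI (left_mem_Icc.2 hcd))).trans (mul_le_mul_of_nonneg_left ?_ hM)
    rw [abs_of_nonneg (sub_nonneg.2 hy.1)]
    linarith [hy.2]
  | succ n ih =>
    obtain ⟨-, f', hf', h2⟩ := h
    obtain ⟨Q, hQdeg, hQ⟩ := ih h2
    obtain ⟨P, -, hP, hPf⟩ := exists_polynomial_of_deriv hcd
      (fun y hy => (hf' y (hI hy)).mono hI) hQ
    refine ⟨P, hP.trans (by omega), fun y hy => (hPf y hy).trans (le_of_eq ?_)⟩
    ring

/-! ### Smooth functions on a rectangle -/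

section Rectangle

variable {a b c d : ℝ} {G : ℝ × ℝ → ℝ}

/-- The partial derivative on the rectangle `[a, b] × [c, d]` in the direction `e`. -/
def rectDeriv (a b c d : ℝ) (G : ℝ × ℝ → ℝ) (e : ℝ × ℝ) (p : ℝ × ℝ) : ℝ :=
  fderivWithin ℝ G (Icc a b ×ˢ Icc c d) p e

lemma contDiffOn_rectDeriv (hab : a < b) (hcd : c < d)
    (hG : ContDiffOn ℝ ∞ G (Icc a b ×ˢ Icc c d)) (e : ℝ × ℝ) :
    ContDiffOn ℝ ∞ (rectDeriv a b c d G e) (Icc a b ×ˢ Icc c d) :=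
  (hG.fderivWithin ((uniqueDiffOn_Icc hab).prod (uniqueDiffOn_Icc hcd)) (by simp)).clm_apply
    contDiffOn_const

lemma hasFDerivWithinAt_rect (hG : ContDiffOn ℝ ∞ G (Icc a b ×ˢ Icc c d)) {y t : ℝ}
    (hy : y ∈ Icc a b) (ht : t ∈ Icc c d) :
    HasFDerivWithinAt G (fderivWithin ℝ G (Icc a b ×ˢ Icc c d) (y, t)) (Icc a b ×ˢ Icc c d)
      (y, t) :=
  ((hG.differentiableOn (by simp)) (y, t) ⟨hy, ht⟩).hasFDerivWithinAt

lemma hasDerivWithinAt_fst (hG : ContDiffOn ℝ ∞ G (Icc a b ×ˢ Icc c d)) {y t : ℝ}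
    (hy : y ∈ Icc a b) (ht : t ∈ Icc c d) :
    HasDerivWithinAt (fun z => G (z, t)) (rectDeriv a b c d G (1, 0) (y, t)) (Icc a b) y :=
  (hasFDerivWithinAt_rect hG hy ht).comp_hasDerivWithinAt (f := fun z => (z, t)) y
    ((hasDerivWithinAt_id y _).prodMk (hasDerivWithinAt_const y _ t)) fun _ hz => ⟨hz, ht⟩

lemma hasDerivWithinAt_snd (hG : ContDiffOn ℝ ∞ G (Icc a b ×ˢ Icc c d)) {y t : ℝ}
    (hy : y ∈ Icc a b) (ht : t ∈ Icc c d) :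
    HasDerivWithinAt (fun τ => G (y, τ)) (rectDeriv a b c d G (0, 1) (y, t)) (Icc c d) t :=
  (hasFDerivWithinAt_rect hG hy ht).comp_hasDerivWithinAt (f := fun τ => (y, τ)) t
    ((hasDerivWithinAt_const t _ y).prodMk (hasDerivWithinAt_id t _)) fun _ hz => ⟨hy, hz⟩

/-- Compactness of the rectangle makes the bound uniform in the second variable. It serves for `g`,
for its time derivative and for `α`. -/
lemma exists_reg_of_contDiffOn (hab : a < b) (hcd : c < d)
    (hG : ContDiffOn ℝ ∞ G (Icc a b ×ˢ Icc c d)) (n : ℕ) :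
    ∃ K, 0 ≤ K ∧ ∀ t ∈ Icc c d, Reg (Icc a b) n K (fun y => G (y, t)) := by
  have hbdd : ∀ G : ℝ × ℝ → ℝ, ContDiffOn ℝ ∞ G (Icc a b ×ˢ Icc c d) →
      ∃ K, 0 ≤ K ∧ ∀ t ∈ Icc c d, ∀ y ∈ Icc a b, |G (y, t)| ≤ K := fun G hG => by
    obtain ⟨K, hK⟩ := (isCompact_Icc.prod isCompact_Icc).exists_bound_of_continuousOn
      hG.continuousOn
    exact ⟨max K 0, le_max_right _ _, fun t ht y hy => (hK (y, t) ⟨hy, ht⟩).trans (le_max_left _ _)⟩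
  induction n generalizing G with
  | zero =>
    obtain ⟨K, hK0, hK⟩ := hbdd G hG
    obtain ⟨L, hL0, hL⟩ := hbdd _ (contDiffOn_rectDeriv hab hcd hG (1, 0))
    refine ⟨max K L, hK0.trans (le_max_left _ _), fun t ht =>
      ⟨fun y hy => (hK t ht y hy).trans (le_max_left _ _), fun y hy z hz => ?_⟩⟩
    exact (convex_Icc a b).norm_image_sub_le_of_norm_hasDerivWithin_le
      (fun y hy => hasDerivWithinAt_fst hG hy ht)
      (fun y hy => (hL t ht y hy).trans (le_max_right _ _)) hz hy
  | succ n ih =>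
    obtain ⟨K, hK0, hK⟩ := hbdd G hG
    obtain ⟨L, hL0, hL⟩ := ih (contDiffOn_rectDeriv hab hcd hG (1, 0))
    refine ⟨max K L, hK0.trans (le_max_left _ _), fun t ht => ?_⟩
    exact ⟨fun y hy => (hK t ht y hy).trans (le_max_left _ _), _,
      fun y hy => hasDerivWithinAt_fst hG hy ht, (hL t ht).mono_const (le_max_right _ _)⟩

end Rectangle

/-! ### Weak derivatives of bounded functions on an interval -/

section Weak

variable {a b : ℝ}

/-- `d` is a weak derivative of `f` on `(a, b)`. -/
def IsWeakDeriv (a b : ℝ) (f d : ℝ → ℝ) : Prop :=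
  ∀ φ : ℝ → ℝ, ContDiff ℝ ∞ φ → HasCompactSupport φ → tsupport φ ⊆ Ioo a b →
    ∫ y in Ioo a b, f y * deriv φ y = -∫ y in Ioo a b, d y * φ y

/-- The family relates each `d j` only to `f`. Using `deriv φ` as a test function at order `j` and
`φ` at order `j + 1` links consecutive members. -/
lemma IsWeakDerivFamily.isWeakDeriv {m : ℕ} {f : ℝ → ℝ} {d : ℕ → ℝ → ℝ}
    (h : IsWeakDerivFamily a b m f d) {j : ℕ} (hj : j < m) : IsWeakDeriv a b (d j) (d (j + 1)) := by
  intro φ hφ hc hs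
  have h1 := (h.2 (j + 1) hj).2 φ hφ hc hs
  have h2 := (h.2 j hj.le).2 (deriv φ) (hφ.deriv' (n := ∞)) hc.deriv (tsupport_deriv_subset.trans hs)
  rw [← iteratedDeriv_succ', h1, pow_succ] at h2
  have h3 : ((-1 : ℝ) ^ j) ≠ 0 := by positivity
  have h4 : (-1 : ℝ) ^ j * -∫ y in Ioo a b, d (j + 1) y * φ y =
      (-1) ^ j * ∫ y in Ioo a b, d j y * deriv φ y := by
    rw [← h2]; ring
  exact (mul_left_cancel₀ h3 h4).symm

lemma exists_Icc_of_tsupport_subset_Ioo (hab : a < b) {φ : ℝ → ℝ} (hc : HasCompactSupport φ)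
    (hs : tsupport φ ⊆ Ioo a b) :
    ∃ c d, a < c ∧ d < b ∧ c ≤ d ∧ ∀ y, y ∉ Icc c d → φ y = 0 := by
  rcases (tsupport φ).eq_empty_or_nonempty with h | h
  · rw [tsupport_eq_empty_iff] at h
    exact ⟨(a + b) / 2, (a + b) / 2, by linarith, by linarith, le_rfl, fun y _ => by simp [h]⟩
  · obtain ⟨c, hc1, hc2⟩ := hc.isCompact.exists_isLeast h
    obtain ⟨d, hd1, hd2⟩ := hc.isCompact.exists_isGreatest h
    refine ⟨c, d, (hs hc1).1, (hs hd1).2, hc2 hd1, fun y hy => ?_⟩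
    by_contra hne
    have hy' : y ∈ tsupport φ := subset_tsupport φ hne
    exact hy ⟨hc2 hy', hd2 hy'⟩

/-- A test function with zero mean has a primitive that is a test function. -/
lemma exists_primitive_test {φ : ℝ → ℝ} (hφ : ContDiff ℝ ∞ φ) (hc : HasCompactSupport φ)
    (hs : tsupport φ ⊆ Ioo a b) (hab : a < b) (h0 : ∫ y, φ y = 0) :
    ∃ χ : ℝ → ℝ, ContDiff ℝ ∞ χ ∧ HasCompactSupport χ ∧ tsupport χ ⊆ Ioo a b ∧ deriv χ = φ := by
  obtain ⟨c, d, hac, hdb, -, hz⟩ := exists_Icc_of_tsupport_subset_Ioo hab hc hs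
  have hder : ∀ y, HasDerivAt (fun y => ∫ z in a..y, φ z) (φ y) y := fun y =>
    intervalIntegral.integral_hasDerivAt_right (hφ.continuous.intervalIntegrable _ _)
      (hφ.continuous.stronglyMeasurableAtFilter _ _) hφ.continuous.continuousAt
  have hderiv : deriv (fun y => ∫ z in a..y, φ z) = φ := funext fun y => (hder y).deriv
  have hzero : ∀ y, y ∉ Icc c d → ∫ z in a..y, φ z = 0 := fun y hy => by
    rcases lt_or_ge y c with hyc | hyc
    · rw [intervalIntegral.integral_congr (g := fun _ => (0 : ℝ)) fun z hz' => ?_]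
      · simp
      · refine hz z fun hz2 => ?_
        have := (mem_uIcc.1 hz')
        rcases this with h | h <;> linarith [hz2.1, h.1, h.2]
    · have hyd : d < y := lt_of_not_ge fun h => hy ⟨hyc, h⟩
      rw [intervalIntegral.integral_eq_integral_of_support_subset, h0]
      intro z hz'
      have hz2 : z ∈ Icc c d := by
        by_contra h
        exact hz' (hz z h)
      exact ⟨by linarith [hz2.1], by linarith [hz2.2]⟩
  have hsub : tsupport (fun y => ∫ z in a..y, φ z) ⊆ Icc c d :=
    closure_minimal (fun y hy => by
      by_contra h
      exact hy (hzero y h)) isClosed_Icc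
  refine ⟨_, ?_, isCompact_Icc.of_isClosed_subset (isClosed_tsupport _) hsub,
    hsub.trans fun y hy => ⟨hac.trans_le hy.1, hy.2.trans_lt hdb⟩, hderiv⟩
  rw [contDiff_infty_iff_deriv, hderiv]
  exact ⟨fun y => (hder y).differentiableAt, hφ⟩

/-- A function with vanishing weak derivative is constant. -/
lemma ae_const_of_integral_deriv_eq_zero (hab : a < b) {f : ℝ → ℝ}
    (hf : IntegrableOn f (Ioo a b))
    (h : ∀ φ : ℝ → ℝ, ContDiff ℝ ∞ φ → HasCompactSupport φ → tsupport φ ⊆ Ioo a b →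
      ∫ y in Ioo a b, f y * deriv φ y = 0) :
    ∃ c : ℝ, ∀ᵐ y, y ∈ Ioo a b → f y = c := by
  let B : ContDiffBump ((a + b) / 2) := ⟨(b - a) / 8, (b - a) / 4, by linarith, by linarith⟩
  let ψ : ℝ → ℝ := B.normed volume
  have hψ : ContDiff ℝ ∞ ψ := B.contDiff_normed
  have hψc : HasCompactSupport ψ := B.hasCompactSupport_normed
  have hψs : tsupport ψ ⊆ Ioo a b := by
    rw [B.tsupport_normed_eq, Real.closedBall_eq_Icc]
    intro y hy
    simp only [B, mem_Icc] at hy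
    exact ⟨by linarith [hy.1], by linarith [hy.2]⟩
  have hψ1 : ∫ y, ψ y = 1 := B.integral_normed
  have hmul : ∀ φ : ℝ → ℝ, Continuous φ → HasCompactSupport φ →
      IntegrableOn (fun y => f y * φ y) (Ioo a b) := fun φ hφ hc => by
    obtain ⟨C, hC⟩ := hc.exists_bound_of_continuous hφ
    exact hf.mul_bdd (c := C) hφ.aestronglyMeasurable (Filter.Eventually.of_forall hC)
  set c := ∫ y in Ioo a b, f y * ψ y with hcdef
  refine ⟨c, ?_⟩
  have hloc : LocallyIntegrableOn (fun y => f y - c) (Ioo a b) :=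
    (hf.sub (integrableOn_const (by simp))).locallyIntegrableOn
  have := isOpen_Ioo.ae_eq_zero_of_integral_contDiff_smul_eq_zero hloc fun φ hφ hc hs => ?_
  · filter_upwards [this] with y hy hy' using sub_eq_zero.1 (hy hy')
  set I := ∫ y, φ y with hI
  have hφi : Integrable φ := hφ.continuous.integrable_of_hasCompactSupport hc
  have hψi : Integrable ψ := hψ.continuous.integrable_of_hasCompactSupport hψc
  have hsupp : tsupport (fun y => φ y - I * ψ y) ⊆ tsupport φ ∪ tsupport ψ := by
    refine closure_minimal (fun y hy => ?_) ((isClosed_tsupport _).union (isClosed_tsupport _))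
    by_contra hn
    rw [mem_union, not_or] at hn
    exact hy (by simp [image_eq_zero_of_notMem_tsupport hn.1, image_eq_zero_of_notMem_tsupport hn.2])
  -- Subtracting the multiple `I` of the normalized bump removes the mean of `φ`, so that the
  -- difference is the derivative of a test function.
  obtain ⟨χ, hχ, hχc, hχs, hχd⟩ := exists_primitive_test (a := a) (b := b)
    (φ := fun y => φ y - I * ψ y) (hφ.sub (contDiff_const.mul hψ))
    ((hc.isCompact.union hψc.isCompact).of_isClosed_subset (isClosed_tsupport _) hsupp)
    (hsupp.trans (union_subset hs hψs)) hab
    (by rw [integral_sub hφi (hψi.const_mul I), integral_const_mul, hψ1, mul_one, sub_self])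
  have h1 := h χ hχ hχc hχs
  rw [hχd] at h1
  have h2 : ∫ y in Ioo a b, f y * φ y = I * c := by
    have h3 : ∀ y, f y * (φ y - I * ψ y) = f y * φ y - I * (f y * ψ y) := fun y => by ring
    simp only [h3] at h1
    rw [integral_sub (hmul φ hφ.continuous hc) ((hmul ψ hψ.continuous hψc).const_mul I),
      integral_const_mul] at h1
    linarith
  have hout : ∀ y, y ∉ Ioo a b → φ y = 0 := fun y hy =>
    image_eq_zero_of_notMem_tsupport fun h => hy (hs h)
  have h4 : ∫ y, φ y • (f y - c) = ∫ y in Ioo a b, φ y • (f y - c) :=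
    (setIntegral_eq_integral_of_forall_compl_eq_zero fun y hy => by rw [hout y hy, zero_smul]).symm
  have h5 : ∫ y in Ioo a b, φ y = I := setIntegral_eq_integral_of_forall_compl_eq_zero hout
  have h6 : ∀ y, φ y • (f y - c) = f y * φ y - c * φ y := fun y => by rw [smul_eq_mul]; ring
  rw [h4]
  simp only [h6]
  rw [integral_sub (hmul φ hφ.continuous hc) (hφi.integrableOn.const_mul c), integral_const_mul, h2,
    h5]
  ring

/-- The primitive of `d` is absolutely continuous, so integration by parts shows that it has weak
derivative `d`. Its difference with `f` has weak derivative zero and is constant. -/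
lemma IsWeakDeriv.ae_eq_primitive (hab : a < b) {f d : ℝ → ℝ} (h : IsWeakDeriv a b f d)
    (hf : IntegrableOn f (Ioo a b)) (hd : IntegrableOn d (Ioo a b)) :
    ∃ c : ℝ, ∀ᵐ y, y ∈ Ioo a b → f y = c + ∫ z in a..y, d z := by
  have hdi : IntervalIntegrable d volume a b :=
    (intervalIntegrable_iff_integrableOn_Ioo_of_le hab.le).2 hd
  let D : ℝ → ℝ := fun y => ∫ z in a..y, d z
  have hD : AbsolutelyContinuousOnInterval D a b :=
    hdi.absolutelyContinuousOnInterval_intervalIntegral left_mem_uIcc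
  have hDi : IntegrableOn D (Ioo a b) := by
    have := hD.continuousOn
    rw [uIcc_of_le hab.le] at this
    exact (this.integrableOn_Icc).mono_set Ioo_subset_Icc_self
  obtain ⟨c, hc⟩ := ae_const_of_integral_deriv_eq_zero hab (hf.sub hDi) fun φ hφ hc hs => by
    have hφ' : Continuous (deriv φ) := hφ.continuous_deriv (by simp)
    obtain ⟨C, hC⟩ := hc.deriv.exists_bound_of_continuous hφ'
    have hout : ∀ y, y ∉ Ioo a b → φ y = 0 := fun y hy =>
      image_eq_zero_of_notMem_tsupport fun h => hy (hs h)
    have hbp := hD.integral_mul_deriv_eq_deriv_mul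
      ((hφ.of_le (by simp)).contDiffOn.absolutelyContinuousOnInterval (f := φ))
    rw [hout a (by simp), hout b (by simp), mul_zero, mul_zero, sub_zero, zero_sub] at hbp
    have hder : ∫ y in a..b, deriv D y * φ y = ∫ y in a..b, d y * φ y := by
      refine intervalIntegral.integral_congr_ae ?_
      filter_upwards [hdi.ae_hasDerivAt_integral] with y hy hy'
      rw [(hy (uIoc_subset_uIcc hy') a left_mem_uIcc).deriv]
    rw [hder, intervalIntegral.integral_of_le hab.le, intervalIntegral.integral_of_le hab.le,
      integral_Ioc_eq_integral_Ioo, integral_Ioc_eq_integral_Ioo] at hbp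
    have hm : ∀ F : ℝ → ℝ, IntegrableOn F (Ioo a b) →
        IntegrableOn (fun y => F y * deriv φ y) (Ioo a b) := fun F hF =>
      hF.mul_bdd (c := C) hφ'.aestronglyMeasurable (Filter.Eventually.of_forall hC)
    simp only [Pi.sub_apply, sub_mul]
    rw [integral_sub (hm f hf) (hm D hDi), h φ hφ hc hs, hbp, sub_self]
  refine ⟨c, ?_⟩
  filter_upwards [hc] with y hy hy'
  have := hy hy'
  simp only [Pi.sub_apply] at this
  linarith

/-- Both `min |F| M` and `|F|` are continuous and agree almost everywhere, hence everywhere on the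
closed interval. -/
lemma abs_le_of_ae_abs_le (hab : a < b) {F : ℝ → ℝ} (hF : ContinuousOn F (Icc a b)) {M : ℝ}
    (h : ∀ᵐ y, y ∈ Ioo a b → |F y| ≤ M) {y : ℝ} (hy : y ∈ Icc a b) : |F y| ≤ M := by
  have h1 : (fun y => min |F y| M) =ᵐ[volume.restrict (Icc a b)] fun y => |F y| := by
    rw [← restrict_Ioo_eq_restrict_Icc, Filter.EventuallyEq, ae_restrict_iff' measurableSet_Ioo]
    filter_upwards [h] with y hy hy' using min_eq_left (hy hy')
  have h2 := Measure.eqOn_Icc_of_ae_eq volume hab.ne h1 (hF.abs.inf continuousOn_const) hF.abs hy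
  exact min_eq_left_iff.1 h2

/-- Induction on the order: the regular representative of `d 1` is continuous, so its primitive is a
differentiable representative of `d 0`. At the bottom, a primitive of a function bounded by `M` is
`M`-Lipschitz. -/
lemma exists_reg_of_weakDerivs (hab : a < b) {M : ℝ} (n : ℕ) {d : ℕ → ℝ → ℝ}
    (hw : ∀ j ≤ n, IsWeakDeriv a b (d j) (d (j + 1)))
    (hm : ∀ j ≤ n + 1, AEStronglyMeasurable (d j) (volume.restrict (Ioo a b)))
    (hb : ∀ j ≤ n + 1, ∀ᵐ y, y ∈ Ioo a b → |d j y| ≤ M) :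
    ∃ F, Reg (Icc a b) n M F ∧ ∀ᵐ y, y ∈ Ioo a b → d 0 y = F y := by
  have hint : ∀ j ≤ n + 1, IntegrableOn (d j) (Ioo a b) := fun j hj =>
    IntegrableOn.of_bound (by simp) (hm j hj) M ((ae_restrict_iff' measurableSet_Ioo).2 (hb j hj))
  obtain ⟨c, hc⟩ := (hw 0 (by omega)).ae_eq_primitive hab (hint 0 (by omega)) (hint 1 (by omega))
  have hbd : ∀ F : ℝ → ℝ, ContinuousOn F (Icc a b) → (∀ᵐ y, y ∈ Ioo a b → d 0 y = F y) →
      ∀ y ∈ Icc a b, |F y| ≤ M := fun F hF hd y hy => by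
    refine abs_le_of_ae_abs_le hab hF ?_ hy
    filter_upwards [hd, hb 0 (by omega)] with y h1 h2 hy'
    rw [← h1 hy']
    exact h2 hy'
  induction n generalizing d c with
  | zero =>
    refine ⟨_, ⟨?_, fun y hy z hz => ?_⟩, hc⟩
    swap
    · have hi : ∀ y ∈ Icc a b, IntervalIntegrable (d 1) volume a y := fun y hy =>
        ((intervalIntegrable_iff_integrableOn_Ioo_of_le hab.le).2 (hint 1 (by omega))).mono_set
          (by rw [uIcc_of_le hy.1, uIcc_of_le hab.le]; exact Icc_subset_Icc_right hy.2)
      rw [add_sub_add_left_eq_sub, intervalIntegral.integral_interval_sub_left (hi y hy) (hi z hz)]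
      refine intervalIntegral.norm_integral_le_of_norm_le_const_ae (f := d 1) ?_
      -- The bound on `d 1` is known on the open interval only, while the interval of integration
      -- may contain its right end `b`.
      have hne : ∀ᵐ x : ℝ, x ≠ b := by simp [ae_iff]
      filter_upwards [hb 1 (by omega), hne] with x hx hxb hx'
      refine hx ⟨?_, ?_⟩
      · exact (le_min hz.1 hy.1).trans_lt hx'.1
      · exact lt_of_le_of_ne (hx'.2.trans (max_le hz.2 hy.2)) hxb
    · refine hbd _ ?_ hc
      have := ((intervalIntegrable_iff_integrableOn_Ioo_of_le hab.le).2
        (hint 1 (by omega))).absolutelyContinuousOnInterval_intervalIntegral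
          (left_mem_uIcc (a := a) (b := b))
      have h2 := this.continuousOn
      rw [uIcc_of_le hab.le] at h2
      exact continuousOn_const.add h2
  | succ n ih =>
    obtain ⟨c', hc'⟩ := (hw 1 (by omega)).ae_eq_primitive hab (hint 1 (by omega))
      (hint 2 (by omega))
    obtain ⟨F₁, hF₁, hd⟩ := ih (d := fun j => d (j + 1)) (fun j hj => hw (j + 1) (by omega))
      (fun j hj => hm (j + 1) (by omega)) (fun j hj => hb (j + 1) (by omega))
      (fun j hj => hint (j + 1) (by omega)) c' hc' (fun F hF hd y hy => by
        refine abs_le_of_ae_abs_le hab hF ?_ hy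
        filter_upwards [hd, hb 1 (by omega)] with y h1 h2 hy'
        rw [← h1 hy']
        exact h2 hy')
    -- A continuous extension to the line makes the primitive differentiable at the end points too.
    let G : ℝ → ℝ := IccExtend hab.le ((Icc a b).domRestrict F₁)
    have hG : Continuous G := (continuousOn_iff_continuous_domRestrict.1 hF₁.continuousOn).Icc_extend'
    have hGF : ∀ y ∈ Icc a b, G y = F₁ y := fun y hy => IccExtend_of_mem _ _ hy
    have hder : ∀ y, HasDerivAt (fun y => c + ∫ z in a..y, G z) (G y) y := fun y =>
      (intervalIntegral.integral_hasDerivAt_right (hG.intervalIntegrable _ _)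
        (hG.stronglyMeasurableAtFilter _ _) hG.continuousAt).const_add c
    have hae : ∀ᵐ y, y ∈ Ioo a b → d 0 y = c + ∫ z in a..y, G z := by
      filter_upwards [hc] with y hy hy'
      rw [hy hy']
      congr 1
      refine intervalIntegral.integral_congr_ae ?_
      filter_upwards [hd] with z hz hz'
      rw [uIoc_of_le hy'.1.le] at hz'
      have hz2 : z ∈ Ioo a b := ⟨hz'.1, hz'.2.trans_lt hy'.2⟩
      rw [hGF z (Ioo_subset_Icc_self hz2)]
      exact hz hz2
    refine ⟨_, ⟨hbd _ (fun y _ => (hder y).continuousAt.continuousWithinAt) hae, F₁,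
      fun y hy => ?_, hF₁⟩, hae⟩
    rw [← hGF y hy]
    exact (hder y).hasDerivWithinAt

/-- A continuous function in `W^{n+1,∞}` has classical derivatives up to order `n`. -/
lemma reg_of_sobolevInftyNorm_lt (hab : a < b) {n : ℕ} {M : ℝ} {f : ℝ → ℝ}
    (hf : ContinuousOn f (Icc a b)) (h : sobolevInftyNorm a b (n + 1) f < ENNReal.ofReal M) :
    Reg (Icc a b) n M f := by
  simp only [sobolevInftyNorm, iInf_lt_iff] at h
  obtain ⟨d, hd, hlt⟩ := h
  have hM : 0 < M := by
    by_contra hM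
    rw [ENNReal.ofReal_eq_zero.2 (not_lt.1 hM)] at hlt
    exact not_lt_zero hlt
  have hb : ∀ j ≤ n + 1, ∀ᵐ y, y ∈ Ioo a b → |d j y| ≤ M := fun j hj => by
    have h1 : eLpNorm (d j) ⊤ (volume.restrict (Ioo a b)) ≤ ENNReal.ofReal M :=
      (le_iSup₂ (f := fun j (_ : j ∈ Finset.range (n + 1 + 1)) =>
        eLpNorm (d j) ⊤ (volume.restrict (Ioo a b))) j
        (Finset.mem_range.2 (Nat.lt_succ_of_le hj))).trans hlt.le
    rw [eLpNorm_exponent_top] at h1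
    rw [← ae_restrict_iff' measurableSet_Ioo]
    filter_upwards [ae_le_eLpNormEssSup (f := d j) (μ := volume.restrict (Ioo a b))] with y hy
    have h2 := hy.trans h1
    rw [← ofReal_norm, ENNReal.ofReal_le_ofReal_iff hM.le] at h2
    exact h2
  obtain ⟨F, hF, hdF⟩ := exists_reg_of_weakDerivs hab n (d := d)
    (fun j hj => hd.isWeakDeriv (Nat.lt_succ_of_le hj)) (fun j hj => (hd.2 j hj).1) hb
  refine hF.congr fun y hy => ?_
  refine Measure.eqOn_Icc_of_ae_eq volume hab.ne ?_ hf hF.continuousOn hy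
  rw [← restrict_Ioo_eq_restrict_Icc, Filter.EventuallyEq, ae_restrict_iff' measurableSet_Ioo]
  rw [hd.1] at hdF
  exact hdF

end Weak

/-! ### Finite differences -/

/-- The forward difference of order `n` with step `δ` at `a`. -/
def finiteDiff (n : ℕ) (a δ : ℝ) (f : ℝ → ℝ) : ℝ :=
  ∑ j ∈ Finset.range (n + 1), (-1) ^ (n - j) * (n.choose j : ℝ) * f (a + j * δ)

/-- After the affine change of variable to unit step, the `n`-th difference kills degrees below `n`
and multiplies the coefficient of degree `n` by `n!`. -/
lemma finiteDiff_eval {n : ℕ} (a δ : ℝ) (hδ : δ ≠ 0) {P : ℝ[X]} (hP : P.natDegree ≤ n) :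
    finiteDiff n a δ (fun y => P.eval y) = n.factorial * δ ^ n * P.coeff n := by
  let Q : ℝ[X] := P.comp (C δ * X + C a)
  have hlin : (C δ * X + C a : ℝ[X]).natDegree = 1 := natDegree_linear hδ
  have hQdeg : Q.natDegree = P.natDegree := by rw [natDegree_comp, hlin, mul_one]
  have hsum : finiteDiff n a δ (fun y => P.eval y) = (fwdDiff 1)^[n] Q.eval 0 := by
    rw [fwdDiff_iter_eq_sum_shift, finiteDiff]
    refine Finset.sum_congr rfl fun j _ => ?_
    simp only [Q, eval_comp, eval_add, eval_mul, eval_C, eval_X, zsmul_eq_mul, nsmul_eq_mul]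
    push_cast
    congr 2
    ring
  rw [hsum]
  rcases hP.lt_or_eq with h | h
  · rw [Polynomial.fwdDiff_iter_eq_zero_of_degree_lt (hQdeg.trans_lt h),
      coeff_eq_zero_of_natDegree_lt h]
    simp
  · have h1 := Polynomial.fwdDiff_iter_degree_eq_factorial Q
    rw [hQdeg, h] at h1
    have h2 : Q.leadingCoeff = P.leadingCoeff * δ ^ n := by
      rw [leadingCoeff_comp (by rw [hlin]; exact one_ne_zero), leadingCoeff_linear hδ, h]
    rw [h1, h2, leadingCoeff, h]
    simp
    ring

lemma finiteDiff_sub (n : ℕ) (a δ : ℝ) (f g : ℝ → ℝ) :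
    finiteDiff n a δ (fun y => f y - g y) = finiteDiff n a δ f - finiteDiff n a δ g := by
  simp only [finiteDiff, mul_sub, Finset.sum_sub_distrib]

lemma abs_finiteDiff_le {n : ℕ} {a δ ε : ℝ} {f : ℝ → ℝ}
    (h : ∀ j ≤ n, |f (a + j * δ)| ≤ ε) : |finiteDiff n a δ f| ≤ 2 ^ n * ε := by
  refine (Finset.abs_sum_le_sum_abs _ _).trans ?_
  have h2 : (2 : ℝ) ^ n = ∑ j ∈ Finset.range (n + 1), (n.choose j : ℝ) := by
    exact_mod_cast (Nat.sum_range_choose n).symm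
  rw [h2, Finset.sum_mul]
  refine Finset.sum_le_sum fun j hj => ?_
  rw [abs_mul, abs_mul, abs_pow, abs_neg, abs_one, one_pow, one_mul, Nat.abs_cast]
  exact mul_le_mul_of_nonneg_left (h j (Nat.lt_succ_iff.1 (Finset.mem_range.1 hj)))
    (Nat.cast_nonneg _)

lemma hasDerivWithinAt_finiteDiff {n : ℕ} {a δ : ℝ} {F : ℝ → ℝ → ℝ} {F' : ℝ → ℝ} {S : Set ℝ}
    {t : ℝ} (h : ∀ j ≤ n, HasDerivWithinAt (fun τ => F τ (a + j * δ)) (F' (a + j * δ)) S t) :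
    HasDerivWithinAt (fun τ => finiteDiff n a δ (F τ)) (finiteDiff n a δ F') S t :=
  HasDerivWithinAt.fun_sum fun j hj =>
    (h j (Nat.lt_succ_iff.1 (Finset.mem_range.1 hj))).const_mul _

/-! ### Interpolation on an element -/

section Element

variable {k : ℕ} {a b : ℝ}

/-- The image in `[a, b]` of the reference point `s`. -/
def elemMap (a b s : ℝ) : ℝ := (b - a) / 2 * s + (a + b) / 2

lemma elemMap_mem (hab : a ≤ b) {s : ℝ} (hs : s ∈ Icc (-1 : ℝ) 1) : elemMap a b s ∈ Icc a b := by
  have h : 0 ≤ (b - a) / 2 := by linarith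
  rw [elemMap]
  constructor <;> nlinarith [hs.1, hs.2]

lemma exists_elemMap_eq (hab : a < b) {y : ℝ} (hy : y ∈ Icc a b) :
    ∃ s ∈ Icc (-1 : ℝ) 1, elemMap a b s = y := by
  have h : 0 < b - a := sub_pos.2 hab
  refine ⟨(2 * y - a - b) / (b - a), ⟨?_, ?_⟩, ?_⟩
  · rw [le_div_iff₀ h]; linarith [hy.1]
  · rw [div_le_iff₀ h]; linarith [hy.2]
  · rw [elemMap]; field_simp; ring

lemma elemMap_injective (hab : a < b) : Function.Injective (elemMap a b) := fun s t h => by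
  have h1 : (b - a) / 2 ≠ 0 := by linarith
  rw [elemMap, elemMap] at h
  exact mul_left_cancel₀ h1 (by linarith)

/-- The pullback of a polynomial on `[a, b]` to the reference element. -/
def pull (a b : ℝ) (v : ℝ[X]) : ℝ[X] := v.comp (C ((b - a) / 2) * X + C ((a + b) / 2))

lemma eval_pull (v : ℝ[X]) (s : ℝ) : (pull a b v).eval s = v.eval (elemMap a b s) := by
  simp [pull, elemMap]

lemma natDegree_pull_le (v : ℝ[X]) : (pull a b v).natDegree ≤ v.natDegree := by
  refine natDegree_comp_le.trans ?_
  exact (Nat.mul_le_mul_left _ natDegree_linear_le).trans (by omega)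

/-- Stability of interpolation, on a physical element: `W` is the constant of the reference
partition `p`. -/
def LebesgueBound {k : ℕ} (p : Fin (k + 2) → ℝ) (W : ℝ) : Prop :=
  ∀ (o : Fin (k + 2)) (f : ℝ[X]) (B : ℝ), f.natDegree ≤ k → (∀ l, l ≠ o → |f.eval (p l)| ≤ B) →
        ∀ s ∈ Icc (-1 : ℝ) 1, |f.eval s| ≤ W * B

lemma LebesgueBound.elem {p : Fin (k + 2) → ℝ} {W : ℝ} (hW : LebesgueBound p W) (hab : a < b)
    (o : Fin (k + 2)) {f : ℝ[X]} {B : ℝ} (hf : f.natDegree ≤ k)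
    (hB : ∀ l, l ≠ o → |f.eval (elemMap a b (p l))| ≤ B) {y : ℝ} (hy : y ∈ Icc a b) :
    |f.eval y| ≤ W * B := by
  obtain ⟨s, hs, rfl⟩ := exists_elemMap_eq hab hy
  rw [← eval_pull]
  exact hW o _ B ((natDegree_pull_le f).trans hf) (fun l hl => by rw [eval_pull]; exact hB l hl) s hs

/-- The interpolant on `[a, b]` at all points but the one with index `o`. -/
def elemInterp (p : Fin (k + 2) → ℝ) (a b : ℝ) (o : Fin (k + 2)) (f : ℝ → ℝ) : ℝ[X] :=
  Lagrange.interpolate (Finset.univ.erase o) (fun l => elemMap a b (p l))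
    (fun l => f (elemMap a b (p l)))

/-- The nodal polynomial of the interpolation points. -/
def elemNodal (p : Fin (k + 2) → ℝ) (a b : ℝ) (o : Fin (k + 2)) : ℝ[X] :=
  Lagrange.nodal (Finset.univ.erase o) (fun l => elemMap a b (p l))

variable {p : Fin (k + 2) → ℝ}

lemma elemMap_comp_injective (hp : IsRefPartition p) (hab : a < b) :
    Function.Injective fun l => elemMap a b (p l) :=
  (elemMap_injective hab).comp hp.1.injective

lemma eval_elemInterp (hp : IsRefPartition p) (hab : a < b) {o l : Fin (k + 2)} (hl : l ≠ o)
    (f : ℝ → ℝ) :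
    (elemInterp p a b o f).eval (elemMap a b (p l)) = f (elemMap a b (p l)) :=
  Lagrange.eval_interpolate_at_node _ (elemMap_comp_injective hp hab).injOn
    (Finset.mem_erase.2 ⟨hl, Finset.mem_univ l⟩)

lemma natDegree_elemInterp_le (hp : IsRefPartition p) (hab : a < b) (o : Fin (k + 2))
    (f : ℝ → ℝ) : (elemInterp p a b o f).natDegree ≤ k := by
  have h := Lagrange.degree_interpolate_lt (fun l => f (elemMap a b (p l)))
    (elemMap_comp_injective hp hab).injOn (s := Finset.univ.erase o)
  rw [card_univ_erase] at h
  exact Nat.lt_succ_iff.1 (natDegree_lt_of_degree_lt (Nat.succ_pos k) h)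

lemma abs_eval_elemInterp_le {W : ℝ} (hW : LebesgueBound p W) (hp : IsRefPartition p)
    (hab : a < b) (o : Fin (k + 2)) {f : ℝ → ℝ} {B : ℝ}
    (hB : ∀ l, |f (elemMap a b (p l))| ≤ B) {y : ℝ} (hy : y ∈ Icc a b) :
    |(elemInterp p a b o f).eval y| ≤ W * B :=
  hW.elem hab o (natDegree_elemInterp_le hp hab o f)
    (fun l hl => by rw [eval_elemInterp hp hab hl]; exact hB l) hy

lemma natDegree_elemNodal (o : Fin (k + 2)) : (elemNodal p a b o).natDegree = k + 1 := by
  rw [elemNodal, Lagrange.natDegree_nodal, card_univ_erase]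

lemma coeff_elemNodal (o : Fin (k + 2)) : (elemNodal p a b o).coeff (k + 1) = 1 := by
  have h : (elemNodal p a b o).Monic := Lagrange.nodal_monic
  have := h.coeff_natDegree
  rwa [natDegree_elemNodal] at this

lemma eval_elemNodal_node {o l : Fin (k + 2)} (hl : l ≠ o) :
    (elemNodal p a b o).eval (elemMap a b (p l)) = 0 :=
  Lagrange.eval_nodal_at_node (v := fun l => elemMap a b (p l))
    (Finset.mem_erase.2 ⟨hl, Finset.mem_univ l⟩)

lemma abs_eval_elemNodal_le (hp : IsRefPartition p) (hab : a ≤ b) (o : Fin (k + 2)) {y : ℝ}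
    (hy : y ∈ Icc a b) : |(elemNodal p a b o).eval y| ≤ (b - a) ^ (k + 1) := by
  rw [elemNodal, Lagrange.eval_nodal, Finset.abs_prod]
  refine (Finset.prod_le_prod (g := fun _ => b - a) (fun _ _ => abs_nonneg _)
    fun l _ => ?_).trans (by rw [Finset.prod_const, card_univ_erase])
  have := elemMap_mem hab (hp.mem_Icc l)
  rw [abs_le]
  constructor <;> linarith [hy.1, hy.2, this.1, this.2]

lemma eval_elemNodal_elemMap (o : Fin (k + 2)) (s : ℝ) :
    (elemNodal p a b o).eval (elemMap a b s) =
      ((b - a) / 2) ^ (k + 1) * (Lagrange.nodal (Finset.univ.erase o) p).eval s := by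
  rw [elemNodal, Lagrange.eval_nodal, Lagrange.eval_nodal, ← card_univ_erase o,
    ← Finset.prod_const, ← Finset.prod_mul_distrib]
  refine Finset.prod_congr rfl fun l _ => ?_
  simp only [elemMap]
  ring

lemma integral_elemMap (f : ℝ → ℝ) (s t : ℝ) :
    (b - a) / 2 * ∫ r in s..t, f (elemMap a b r) =
      ∫ y in (elemMap a b s)..(elemMap a b t), f y := by
  simp only [elemMap]
  exact intervalIntegral.mul_integral_comp_mul_add (c := (b - a) / 2) (d := (a + b) / 2)

lemma elemMap_neg_one : elemMap a b (-1) = a := by rw [elemMap]; ring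

lemma elemMap_one : elemMap a b 1 = b := by rw [elemMap]; ring

lemma integral_elemNodal (o : Fin (k + 2)) :
    ∫ y in a..b, (elemNodal p a b o).eval y =
      ((b - a) / 2) ^ (k + 2) * refInt (Lagrange.nodal (Finset.univ.erase o) p) := by
  have h := integral_elemMap (a := a) (b := b) (fun y => (elemNodal p a b o).eval y) (-1) 1
  rw [elemMap_neg_one, elemMap_one] at h
  rw [← h]
  simp only [eval_elemNodal_elemMap]
  rw [intervalIntegral.integral_const_mul, ← refInt_apply]
  ring

/-- The interpolation error is the multiple of the nodal polynomial given by a polynomial of degree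
`k + 1`, up to the error of approximation by that polynomial. -/
lemma abs_interp_error_le {W : ℝ} (hW : LebesgueBound p W) (hp : IsRefPartition p)
    (hab : a < b) (o : Fin (k + 2)) {f : ℝ → ℝ} {P : ℝ[X]} (hP : P.natDegree ≤ k + 1) {ε : ℝ}
    (hf : ∀ y ∈ Icc a b, |f y - P.eval y| ≤ ε) {y : ℝ} (hy : y ∈ Icc a b) :
    |f y - (elemInterp p a b o f).eval y - P.coeff (k + 1) * (elemNodal p a b o).eval y| ≤
      (1 + W) * ε := by
  -- Subtracting the multiple of the nodal polynomial brings `P` down to degree `k` without changing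
  -- its values at the nodes. `R` is then bounded by `ε` at the nodes, and stability of
  -- interpolation applies.
  set R : ℝ[X] := elemInterp p a b o f - (P - C (P.coeff (k + 1)) * elemNodal p a b o) with hR
  have hdeg : (P - C (P.coeff (k + 1)) * elemNodal p a b o).natDegree ≤ k := by
    refine Nat.lt_succ_iff.1 (natDegree_lt_of_degree_lt (Nat.succ_pos k)
      ((degree_lt_iff_coeff_zero _ _).2 fun j hj => ?_))
    rw [coeff_sub, coeff_C_mul]
    rcases hj.eq_or_lt with rfl | hj
    · rw [coeff_elemNodal]; ring
    · rw [coeff_eq_zero_of_natDegree_lt (hP.trans_lt hj),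
        coeff_eq_zero_of_natDegree_lt ((natDegree_elemNodal o).trans_lt hj)]
      ring
  have hRdeg : R.natDegree ≤ k :=
    (natDegree_sub_le _ _).trans (max_le (natDegree_elemInterp_le hp hab o f) hdeg)
  have hRy := hW.elem hab o (B := ε) hRdeg (fun l hl => by
    rw [hR, eval_sub, eval_elemInterp hp hab hl, eval_sub, eval_mul,
      eval_elemNodal_node hl, mul_zero, sub_zero]
    exact hf _ (elemMap_mem hab.le (hp.mem_Icc l))) hy
  have h1 : f y - (elemInterp p a b o f).eval y - P.coeff (k + 1) * (elemNodal p a b o).eval y =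
      (f y - P.eval y) - R.eval y := by
    rw [hR, eval_sub, eval_sub, eval_mul, eval_C]; ring
  rw [h1, add_mul, one_mul]
  exact (abs_sub _ _).trans (add_le_add (hf y hy) hRy)

lemma abs_interp_error_le_of_reg {I : Set ℝ} {M W : ℝ} (hW : LebesgueBound p W)
    (hp : IsRefPartition p) (hab : a < b) (hI : Icc a b ⊆ I) (o : Fin (k + 2)) {f : ℝ → ℝ}
    (hf : Reg I k M f) {y : ℝ} (hy : y ∈ Icc a b) :
    |f y - (elemInterp p a b o f).eval y| ≤ (1 + W) * (M * (b - a) ^ (k + 1)) := by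
  obtain ⟨P, hP, hPf⟩ := hf.exists_polynomial hab.le hI
  have := abs_interp_error_le hW hp hab o (hP.trans (Nat.le_succ k)) hPf hy
  rwa [coeff_eq_zero_of_natDegree_lt (Nat.lt_succ_of_le hP), zero_mul, sub_zero] at this

/-! ### The leading coefficient of the interpolation error -/

/-- An approximation of the derivative of order `k + 1` of `(f - F') / (k + 1)!`, built without
derivatives of `F`. -/
def leadCoeff (k : ℕ) (a b : ℝ) (f F : ℝ → ℝ) : ℝ :=
  (finiteDiff (k + 1) a ((b - a) / (k + 2)) f -
      finiteDiff (k + 2) a ((b - a) / (k + 2)) F / ((b - a) / (k + 2))) /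
    ((k + 1).factorial * ((b - a) / (k + 2)) ^ (k + 1))

/-- The constant in the bounds of `leadCoeff`. -/
def leadConst (k : ℕ) : ℝ := (k + 2) ^ (k + 1) * (2 ^ (k + 1) + 2 ^ (k + 2) * (k + 2))

lemma leadConst_nonneg (k : ℕ) : 0 ≤ leadConst k := by rw [leadConst]; positivity

lemma step_mem (hab : a ≤ b) {j : ℕ} (hj : j ≤ k + 2) :
    a + j * ((b - a) / (k + 2)) ∈ Icc a b := by
  have h1 : 0 ≤ (b - a) / (k + 2) := div_nonneg (by linarith) (by positivity)
  have h2 : (j : ℝ) ≤ k + 2 := by exact_mod_cast hj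
  have h3 : (k + 2 : ℝ) * ((b - a) / (k + 2)) = b - a := by field_simp
  constructor
  · have : (0 : ℝ) ≤ j * ((b - a) / (k + 2)) := by positivity
    linarith
  · have := mul_le_mul_of_nonneg_right h2 h1
    linarith

/-- The powers of two in `leadConst` are the sums of the binomial coefficients of the two
differences; the powers of `k + 2` convert the step `(b - a) / (k + 2)` back into the length. The
step is such that all `k + 3` points lie in the element. -/
lemma abs_diff_quotient_le (hab : a < b) {M d₁ d₂ : ℝ} {m : ℕ}
    (h1 : |d₁| ≤ 2 ^ (k + 1) * (M * (b - a) ^ m))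
    (h2 : |d₂| ≤ 2 ^ (k + 2) * (M * (b - a) ^ (m + 1))) :
    |(d₁ - d₂ / ((b - a) / (k + 2))) /
      ((k + 1).factorial * ((b - a) / (k + 2)) ^ (k + 1))| * (b - a) ^ (k + 1) ≤
      leadConst k * (M * (b - a) ^ m) := by
  have hh : 0 < b - a := sub_pos.2 hab
  have hδ : 0 < (b - a) / (k + 2) := by positivity
  have hf : (1 : ℝ) ≤ (k + 1).factorial := by exact_mod_cast Nat.succ_le_of_lt (Nat.factorial_pos _)
  have h3 : |d₁ - d₂ / ((b - a) / (k + 2))| ≤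
      (2 ^ (k + 1) + 2 ^ (k + 2) * (k + 2)) * (M * (b - a) ^ m) := by
    refine (abs_sub _ _).trans ?_
    rw [abs_div, abs_of_pos hδ, add_mul]
    refine add_le_add h1 ((div_le_iff₀ hδ).2 (h2.trans (le_of_eq ?_)))
    field_simp
    ring
  rw [abs_div, abs_of_pos (by positivity : (0 : ℝ) < (k + 1).factorial * ((b - a) / (k + 2)) ^ (k + 1)),
    div_mul_eq_mul_div, div_le_iff₀ (by positivity)]
  have h4 : (b - a) ^ (k + 1) = (k + 2) ^ (k + 1) * ((b - a) / (k + 2)) ^ (k + 1) := by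
    rw [← mul_pow]; congr 1; field_simp
  have h5 : 0 ≤ leadConst k * (M * (b - a) ^ m) * ((b - a) / (k + 2)) ^ (k + 1) := by
    have : 0 ≤ M * (b - a) ^ m := by
      have := (abs_nonneg _).trans h1
      exact nonneg_of_mul_nonneg_right this (by positivity)
    have := leadConst_nonneg k
    positivity
  calc |d₁ - d₂ / ((b - a) / (k + 2))| * (b - a) ^ (k + 1)
      ≤ (2 ^ (k + 1) + 2 ^ (k + 2) * (k + 2)) * (M * (b - a) ^ m) * (b - a) ^ (k + 1) :=
        mul_le_mul_of_nonneg_right h3 (by positivity)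
    _ = 1 * (leadConst k * (M * (b - a) ^ m) * ((b - a) / (k + 2)) ^ (k + 1)) := by
        rw [leadConst]
        linear_combination (2 ^ (k + 1) + 2 ^ (k + 2) * (k + 2)) * (M * (b - a) ^ m) * h4
    _ ≤ (k + 1).factorial * (leadConst k * (M * (b - a) ^ m) * ((b - a) / (k + 2)) ^ (k + 1)) :=
        mul_le_mul_of_nonneg_right hf h5
    _ = _ := by ring

/-- The differences annihilate Taylor polynomials of degrees `k` and `k + 1`, so boundedness costs
one derivative less of `f` and of the derivative of `F` than the approximation property. This is
what makes the bound available for the time derivative of the coefficient. -/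
lemma abs_leadCoeff_le {I : Set ℝ} {M : ℝ} (hab : a < b) (hI : Icc a b ⊆ I) {f F : ℝ → ℝ}
    (hf : Reg I k M f) (hF : Reg I (k + 1) M F) : |leadCoeff k a b f F| ≤ leadConst k * M := by
  have hh : 0 < b - a := sub_pos.2 hab
  have hδ : (b - a) / (k + 2) ≠ 0 := by positivity
  obtain ⟨P, hP, hPf⟩ := hf.exists_polynomial hab.le hI
  obtain ⟨Q, hQ, hQF⟩ := hF.exists_polynomial hab.le hI
  have h1 : |finiteDiff (k + 1) a ((b - a) / (k + 2)) f| ≤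
      2 ^ (k + 1) * (M * (b - a) ^ (k + 1)) := by
    have h := finiteDiff_sub (k + 1) a ((b - a) / (k + 2)) f (fun y => P.eval y)
    rw [finiteDiff_eval a _ hδ (hP.trans (Nat.le_succ k)),
      coeff_eq_zero_of_natDegree_lt (Nat.lt_succ_of_le hP), mul_zero, sub_zero] at h
    rw [← h]
    exact abs_finiteDiff_le fun j hj => hPf _ (step_mem hab.le (by omega))
  have h2 : |finiteDiff (k + 2) a ((b - a) / (k + 2)) F| ≤
      2 ^ (k + 2) * (M * (b - a) ^ (k + 1 + 1)) := by
    have h := finiteDiff_sub (k + 2) a ((b - a) / (k + 2)) F (fun y => Q.eval y)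
    rw [finiteDiff_eval a _ hδ (hQ.trans (Nat.le_succ _)),
      coeff_eq_zero_of_natDegree_lt (Nat.lt_succ_of_le hQ), mul_zero, sub_zero] at h
    rw [← h]
    exact abs_finiteDiff_le fun j hj => hQF _ (step_mem hab.le (by omega))
  have := abs_diff_quotient_le hab h1 h2
  rw [← mul_assoc] at this
  exact le_of_mul_le_mul_right this (by positivity)

/-- With `F'` the derivative of `F`, `leadCoeff` recovers the coefficient of degree `k + 1` of `f -
F'` well enough to remove the leading interpolation error and gain one power of the length. -/
lemma abs_corrected_interp_error_le {I : Set ℝ} {M W : ℝ} (hW : LebesgueBound p W)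
    (hp : IsRefPartition p) (hab : a < b) (hI : Icc a b ⊆ I) (o : Fin (k + 2))
    {f F F' : ℝ → ℝ} (hf : Reg I (k + 1) M f) (hF' : Reg I (k + 1) M F')
    (hder : ∀ y ∈ I, HasDerivWithinAt F (F' y) I y) {y : ℝ} (hy : y ∈ Icc a b) :
    |f y - F' y - (elemInterp p a b o (fun z => f z - F' z)).eval y -
        leadCoeff k a b f F * (elemNodal p a b o).eval y| ≤
      (2 * (1 + W) + leadConst k) * (M * (b - a) ^ (k + 2)) := by
  have hh : 0 < b - a := sub_pos.2 hab
  have hδ : 0 < (b - a) / (k + 2) := by positivity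
  obtain ⟨P, hP, hPf⟩ := hf.exists_polynomial hab.le hI
  obtain ⟨Q, hQ, hQF⟩ := hF'.exists_polynomial hab.le hI
  obtain ⟨G, hGQ, hG, hGF⟩ := exists_polynomial_of_deriv hab.le
    (fun y hy => (hder y (hI hy)).mono hI) hQF
  have hG' : G.natDegree ≤ k + 2 := hG.trans (by omega)
  have hinterp := abs_interp_error_le hW hp hab o (P := P - Q)
    (f := fun z => f z - F' z) (ε := 2 * (M * (b - a) ^ (k + 2)))
    ((natDegree_sub_le _ _).trans (max_le hP hQ)) (fun z hz => by
      rw [eval_sub, sub_sub_sub_comm]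
      refine (abs_sub _ _).trans ?_
      have := hPf z hz
      have := hQF z hz
      linarith) hy
  have hd1 : |finiteDiff (k + 1) a ((b - a) / (k + 2)) (fun z => f z - P.eval z)| ≤
      2 ^ (k + 1) * (M * (b - a) ^ (k + 2)) :=
    abs_finiteDiff_le fun j hj => hPf _ (step_mem hab.le (by omega))
  have hd2 : |finiteDiff (k + 2) a ((b - a) / (k + 2)) (fun z => F z - G.eval z)| ≤
      2 ^ (k + 2) * (M * (b - a) ^ (k + 2 + 1)) :=
    abs_finiteDiff_le fun j hj =>
      (hGF _ (step_mem hab.le (by omega))).trans (le_of_eq (by ring))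
  -- `leadCoeff` is exact on the polynomials `P` and `G`: the top coefficient of `G` times `(k +
  -- 2)!` is that of `Q = G'` times `(k + 1)!`. Only differences of the remainders are left.
  have hcoeff : leadCoeff k a b f F - (P - Q).coeff (k + 1) =
      (finiteDiff (k + 1) a ((b - a) / (k + 2)) (fun z => f z - P.eval z) -
        finiteDiff (k + 2) a ((b - a) / (k + 2)) (fun z => F z - G.eval z) /
          ((b - a) / (k + 2))) / ((k + 1).factorial * ((b - a) / (k + 2)) ^ (k + 1)) := by
    rw [finiteDiff_sub, finiteDiff_sub, finiteDiff_eval a _ hδ.ne' hP, finiteDiff_eval a _ hδ.ne' hG',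
      leadCoeff, ← hGQ, coeff_sub, coeff_derivative, Nat.factorial_succ (k + 1)]
    have hf : ((k + 1).factorial : ℝ) ≠ 0 := by exact_mod_cast (Nat.factorial_ne_zero _)
    generalize (b - a) / ((k : ℝ) + 2) = δ at hδ
    have hδ' := hδ.ne'
    field_simp
    push_cast
    ring
  have hlead := abs_diff_quotient_le hab hd1 hd2
  rw [← hcoeff] at hlead
  have hnod := abs_eval_elemNodal_le hp hab.le o hy
  have h2 : |(leadCoeff k a b f F - (P - Q).coeff (k + 1)) * (elemNodal p a b o).eval y| ≤
      leadConst k * (M * (b - a) ^ (k + 2)) := by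
    rw [abs_mul]
    exact (mul_le_mul_of_nonneg_left hnod (abs_nonneg _)).trans hlead
  have h3 : f y - F' y - (elemInterp p a b o (fun z => f z - F' z)).eval y -
        leadCoeff k a b f F * (elemNodal p a b o).eval y =
      (f y - F' y - (elemInterp p a b o (fun z => f z - F' z)).eval y -
        (P - Q).coeff (k + 1) * (elemNodal p a b o).eval y) -
      (leadCoeff k a b f F - (P - Q).coeff (k + 1)) * (elemNodal p a b o).eval y := by ring
  rw [h3]
  refine (abs_sub _ _).trans ((add_le_add hinterp h2).trans (le_of_eq ?_))
  ring

end Element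

/-! ### Regularity of solutions of the continuous problem -/

lemma Reg.deriv_of_hasDerivWithinAt {a b : ℝ} (hab : a < b) {n : ℕ} {M : ℝ} {F F' : ℝ → ℝ}
    (h : Reg (Icc a b) (n + 1) M F)
    (hF : ∀ y ∈ Icc a b, HasDerivWithinAt F (F' y) (Icc a b) y) : Reg (Icc a b) n M F' := by
  obtain ⟨-, f', hf', h2⟩ := h
  exact h2.congr fun y hy => (uniqueDiffOn_Icc hab y hy).eq_deriv _ (hF y hy) (hf' y hy)

lemma Reg.of_le {I : Set ℝ} (hI : Convex ℝ I) {m n : ℕ} (hmn : m ≤ n) {M : ℝ} {f : ℝ → ℝ}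
    (h : Reg I n M f) : Reg I m M f := by
  induction n, hmn using Nat.le_induction with
  | base => exact h
  | succ n _ ih => exact ih (h.of_succ hI)

/-- A solution with its time derivative and bounds for all derivatives that occur in the error
analysis. -/
structure SolutionData (k : ℕ) (α : ℝ → ℝ) (g gt : ℝ → ℝ → ℝ) (T M : ℝ) (u ut : ℝ → ℝ → ℝ) :
    Prop where
  time : ∀ y ∈ Icc 0 (2 * Real.pi), ∀ t ∈ Icc 0 T,
    HasDerivWithinAt (fun τ => u y τ) (ut y t) (Icc 0 T) t
  space : ∀ t ∈ Icc 0 T, ∀ y ∈ Icc 0 (2 * Real.pi),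
    HasDerivWithinAt (fun z => α z * u z t) (g y t - ut y t) (Icc 0 (2 * Real.pi)) y
  time_source : ∀ y ∈ Icc 0 (2 * Real.pi), ∀ t ∈ Icc 0 T,
    HasDerivWithinAt (fun τ => g y τ) (gt y t) (Icc 0 T) t
  reg_sol : ∀ t ∈ Icc 0 T, Reg (Icc 0 (2 * Real.pi)) (k + 2) M (fun y => u y t)
  reg_flux : ∀ t ∈ Icc 0 T, Reg (Icc 0 (2 * Real.pi)) (k + 2) M (fun y => α y * u y t)
  reg_source : ∀ t ∈ Icc 0 T, Reg (Icc 0 (2 * Real.pi)) (k + 1) M (fun y => g y t)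
  reg_source_time : ∀ t ∈ Icc 0 T, Reg (Icc 0 (2 * Real.pi)) (k + 1) M (fun y => gt y t)
  reg_time : ∀ t ∈ Icc 0 T, Reg (Icc 0 (2 * Real.pi)) (k + 1) M (fun y => ut y t)
  reg_flux_time : ∀ t ∈ Icc 0 T, Reg (Icc 0 (2 * Real.pi)) (k + 1) M (fun y => α y * ut y t)

section

variable {k : ℕ} {α : ℝ → ℝ} {g : ℝ → ℝ → ℝ} {T : ℝ}

lemma exists_reg_coefficient (hα : ContDiffOn ℝ ∞ α (Icc 0 (2 * Real.pi))) (n : ℕ) :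
    ∃ K, 0 ≤ K ∧ Reg (Icc 0 (2 * Real.pi)) n K α := by
  -- A dummy second variable turns `α` into a function on a rectangle.
  obtain ⟨K, hK0, hK⟩ := exists_reg_of_contDiffOn (c := 0) (d := 1) (G := fun p => α p.1)
    Real.two_pi_pos one_pos (hα.comp contDiffOn_fst fun p hp => hp.1) n
  exact ⟨K, hK0, hK 0 (by norm_num)⟩

/-- A nonzero source term bounds every solution from below. -/
lemma exists_lower_bound (hT : 0 < T)
    (hg : ContDiffOn ℝ ∞ (Function.uncurry g) (Icc 0 (2 * Real.pi) ×ˢ Icc 0 T))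
    {K : ℝ} (hne : ∃ y ∈ Icc 0 (2 * Real.pi), ∃ t ∈ Icc 0 T, g y t ≠ 0) :
    ∃ C, 0 ≤ C ∧ ∀ (M : ℝ) (u ut : ℝ → ℝ → ℝ),
      (∀ y ∈ Icc 0 (2 * Real.pi), ∀ t ∈ Icc 0 T,
        HasDerivWithinAt (fun τ => u y τ) (ut y t) (Icc 0 T) t) →
      (∀ y ∈ Icc 0 (2 * Real.pi), ∀ t ∈ Icc 0 T, |u y t| ≤ M ∧ |g y t - ut y t| ≤ K * M) →
      1 ≤ C * M := by
  obtain ⟨y₀, hy₀, t₀, ht₀, hne⟩ := hne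
  have hε : 0 < |g y₀ t₀| / 2 := by positivity
  set ε := |g y₀ t₀| / 2 with hεdef
  have hcont : ContinuousOn (fun τ => g y₀ τ) (Icc 0 T) :=
    hg.continuousOn.comp (f := fun τ => (y₀, τ)) (by fun_prop) fun τ hτ => ⟨hy₀, hτ⟩
  obtain ⟨δ, hδ, hδ'⟩ := Metric.continuousWithinAt_iff.1 (hcont t₀ ht₀) ε hε
  set t₁ := max 0 (t₀ - δ / 2) with ht₁
  set t₂ := min T (t₀ + δ / 2) with ht₂
  have h12 : t₁ < t₂ :=
    max_lt (lt_min hT (by linarith [ht₀.1])) (lt_min (by linarith [ht₀.2]) (by linarith))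
  have hsub : Icc t₁ t₂ ⊆ Icc 0 T := Icc_subset_Icc (le_max_left _ _) (min_le_left _ _)
  have hlow : ∀ τ ∈ Icc t₁ t₂, ε ≤ |g y₀ τ| := fun τ hτ => by
    have hd : dist τ t₀ < δ := by
      rw [Real.dist_eq, abs_lt]
      have h1 := (le_max_right 0 (t₀ - δ / 2)).trans hτ.1
      have h2 := hτ.2.trans (min_le_right T (t₀ + δ / 2))
      constructor <;> linarith
    have h3 := hδ' (hsub hτ) hd
    rw [Real.dist_eq] at h3
    have h4 := abs_sub_abs_le_abs_sub (g y₀ t₀) (g y₀ τ)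
    rw [abs_sub_comm] at h4
    linarith
  have hpos : 0 < t₂ - t₁ := sub_pos.2 h12
  refine ⟨max 0 ((2 / (t₂ - t₁) + K) / ε), le_max_left _ _, fun M u ut hder hb => ?_⟩
  -- At an intermediate time the time derivative is a difference quotient of `u`, hence at most `2M
  -- / (t₂ - t₁)`. The equation then bounds `g`, which is at least `ε` there, by a multiple of `M`.
  obtain ⟨τ, hτ, hslope⟩ := exists_hasDerivAt_eq_slope (fun τ => u y₀ τ) (fun τ => ut y₀ τ) h12
    (fun τ hτ => ((hder y₀ hy₀ τ (hsub hτ)).continuousWithinAt).mono hsub)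
    (fun τ hτ => (hder y₀ hy₀ τ (hsub (Ioo_subset_Icc_self hτ))).hasDerivAt
      (Filter.mem_of_superset (Icc_mem_nhds hτ.1 hτ.2) hsub))
  have hτ' := Ioo_subset_Icc_self hτ
  have h1 : |ut y₀ τ| ≤ 2 / (t₂ - t₁) * M := by
    rw [hslope, abs_div, abs_of_pos hpos, div_mul_eq_mul_div]
    refine div_le_div_of_nonneg_right ?_ hpos.le
    have h2 := (hb y₀ hy₀ t₂ (hsub (right_mem_Icc.2 h12.le))).1
    have h3 := (hb y₀ hy₀ t₁ (hsub (left_mem_Icc.2 h12.le))).1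
    exact (abs_sub _ _).trans (by linarith)
  have h4 := (hb y₀ hy₀ τ (hsub hτ')).2
  have h5 : ε ≤ (2 / (t₂ - t₁) + K) * M := by
    have h6 := abs_add_le (g y₀ τ - ut y₀ τ) (ut y₀ τ)
    rw [sub_add_cancel] at h6
    have := hlow τ hτ'
    linarith
  have hM : 0 ≤ M := (abs_nonneg _).trans (hb y₀ hy₀ τ (hsub hτ')).1
  calc (1 : ℝ) ≤ (2 / (t₂ - t₁) + K) / ε * M := by
        rw [div_mul_eq_mul_div, le_div_iff₀ hε, one_mul]; exact h5
    _ ≤ _ := mul_le_mul_of_nonneg_right (le_max_right _ _) hM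

/-- The equation trades time for space derivatives: `α u` is as regular as `u`, its derivative is `g
- u_t`, and so `u_t` and `α u_t` lose just one order. The function `gt` is the time derivative of
`g`. -/
lemma exists_solutionData (k : ℕ) (hα : ContDiffOn ℝ ∞ α (Icc 0 (2 * Real.pi))) (hT : 0 < T)
    (hg : ContDiffOn ℝ ∞ (Function.uncurry g) (Icc 0 (2 * Real.pi) ×ˢ Icc 0 T)) :
    ∃ (gt : ℝ → ℝ → ℝ) (C : ℝ), 1 ≤ C ∧ ∀ (M : ℝ) (u₀ : ℝ → ℝ) (u : ℝ → ℝ → ℝ),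
      IsPDESolution α g T u₀ u →
      (∀ t ∈ Icc 0 T, Reg (Icc 0 (2 * Real.pi)) (k + 2) M (fun y => u y t)) →
      ∃ ut, SolutionData k α g gt T (C * M) u ut := by
  have hpi := Real.two_pi_pos
  have hconv : Convex ℝ (Icc 0 (2 * Real.pi)) := convex_Icc _ _
  obtain ⟨A, hA0, hA⟩ := exists_reg_coefficient hα (k + 2)
  have hA' : Reg (Icc 0 (2 * Real.pi)) (k + 1) A α := hA.of_succ hconv
  set K₁ := 2 ^ (k + 2 + 1) * A with hK₁
  have hK₁0 : 0 ≤ K₁ := by positivity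
  let gt : ℝ → ℝ → ℝ := fun y t =>
    rectDeriv 0 (2 * Real.pi) 0 T (Function.uncurry g) (0, 1) (y, t)
  obtain ⟨B₁, hB₁0, hB₁⟩ := exists_reg_of_contDiffOn hpi hT hg (k + 1)
  obtain ⟨B₂, hB₂0, hB₂⟩ := exists_reg_of_contDiffOn hpi hT
    (contDiffOn_rectDeriv hpi hT hg (0, 1)) (k + 1)
  -- The fixed bounds of `g` and `gt` must become multiples of `M`. If `g` is not identically zero,
  -- `M` is bounded below; otherwise both functions vanish.
  have hsource : ∃ C, 0 ≤ C ∧ ∀ (M : ℝ) (u ut : ℝ → ℝ → ℝ), 0 ≤ M →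
      (∀ y ∈ Icc 0 (2 * Real.pi), ∀ t ∈ Icc 0 T,
        HasDerivWithinAt (fun τ => u y τ) (ut y t) (Icc 0 T) t) →
      (∀ y ∈ Icc 0 (2 * Real.pi), ∀ t ∈ Icc 0 T, |u y t| ≤ M ∧ |g y t - ut y t| ≤ K₁ * M) →
      ∀ t ∈ Icc 0 T, Reg (Icc 0 (2 * Real.pi)) (k + 1) (C * M) (fun y => g y t) ∧
        Reg (Icc 0 (2 * Real.pi)) (k + 1) (C * M) (fun y => gt y t) := by
    by_cases hne : ∃ y ∈ Icc 0 (2 * Real.pi), ∃ t ∈ Icc 0 T, g y t ≠ 0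
    · obtain ⟨C, hC0, hC⟩ := exists_lower_bound hT hg (K := K₁) hne
      refine ⟨max B₁ B₂ * C, by positivity, fun M u ut _ hder hb t ht => ?_⟩
      have h1 := hC M u ut hder hb
      have hB0 : 0 ≤ max B₁ B₂ := le_max_of_le_left hB₁0
      have h2 : max B₁ B₂ ≤ max B₁ B₂ * C * M := by
        rw [mul_assoc]
        exact le_mul_of_one_le_right hB0 h1
      exact ⟨(hB₁ t ht).mono_const ((le_max_left _ _).trans h2),
        (hB₂ t ht).mono_const ((le_max_right _ _).trans h2)⟩
    · push Not at hne
      have hzero : ∀ n, ∀ M : ℝ, 0 ≤ M → Reg (Icc 0 (2 * Real.pi)) n M (fun _ => (0 : ℝ)) := by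
        intro n M hM
        induction n with
        | zero => exact ⟨fun y _ => by simpa using hM, fun y _ z _ => by
            rw [sub_zero, abs_zero]; positivity⟩
        | succ n ih => exact ⟨fun y _ => by simpa using hM, fun _ => 0,
            fun y _ => hasDerivWithinAt_const y _ 0, ih⟩
      refine ⟨0, le_rfl, fun M u ut hM _ _ t ht => ⟨?_, ?_⟩⟩
      · exact (hzero _ _ (by simp)).congr fun y hy => hne y hy t ht
      · refine (hzero _ _ (by simp)).congr fun y hy => ?_
        have h1 : HasDerivWithinAt (fun τ => g y τ) (gt y t) (Icc 0 T) t :=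
          hasDerivWithinAt_snd hg hy ht
        have h2 : HasDerivWithinAt (fun τ => g y τ) 0 (Icc 0 T) t :=
          (hasDerivWithinAt_const t _ (0 : ℝ)).congr (fun τ hτ => hne y hy τ hτ) (hne y hy t ht)
        exact (uniqueDiffOn_Icc hT t ht).eq_deriv _ h1 h2
  obtain ⟨C₁, hC₁0, hC₁⟩ := hsource
  set K₂ := K₁ + C₁ with hK₂
  set K₃ := 2 ^ (k + 1 + 1) * (A * K₂) with hK₃
  have hK₂0 : 0 ≤ K₂ := by positivity
  have hK₃0 : 0 ≤ K₃ := by positivity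
  refine ⟨gt, 1 + K₁ + C₁ + K₂ + K₃, by linarith, fun M u₀ u hu hreg => ?_⟩
  have hM : 0 ≤ M := (abs_nonneg _).trans
    ((hreg 0 (left_mem_Icc.2 hT.le)).abs_le (left_mem_Icc.2 hpi.le))
  have hex := hu.equation
  choose! ut hut using hex
  have hflux : ∀ t ∈ Icc 0 T, Reg (Icc 0 (2 * Real.pi)) (k + 2) (K₁ * M)
      (fun y => α y * u y t) := fun t ht =>
    (hA.mul hconv hA0 hM (hreg t ht)).mono_const (le_of_eq (by rw [hK₁]; ring))
  have hfluxd : ∀ t ∈ Icc 0 T, Reg (Icc 0 (2 * Real.pi)) (k + 1) (K₁ * M)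
      (fun y => g y t - ut y t) := fun t ht =>
    (hflux t ht).deriv_of_hasDerivWithinAt hpi fun y hy => (hut y hy t ht).2
  have hsrc := hC₁ M u ut hM (fun y hy t ht => (hut y hy t ht).1) fun y hy t ht =>
    ⟨(hreg t ht).abs_le hy, (hfluxd t ht).abs_le hy⟩
  have htime : ∀ t ∈ Icc 0 T, Reg (Icc 0 (2 * Real.pi)) (k + 1) (K₂ * M)
      (fun y => ut y t) := fun t ht =>
    (((hsrc t ht).1.sub (hfluxd t ht)).congr fun y _ => by ring).mono_const
      (le_of_eq (by rw [hK₂]; ring))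
  refine ⟨ut, fun y hy t ht => (hut y hy t ht).1, fun t ht y hy => (hut y hy t ht).2,
    fun y hy t ht => hasDerivWithinAt_snd hg hy ht,
    fun t ht => (hreg t ht).mono_const ?_,
    fun t ht => (hflux t ht).mono_const ?_,
    fun t ht => (hsrc t ht).1.mono_const ?_,
    fun t ht => (hsrc t ht).2.mono_const ?_,
    fun t ht => (htime t ht).mono_const ?_,
    fun t ht => (hA'.mul hconv hA0 (by positivity) (htime t ht)).mono_const
      (K := (1 + K₁ + C₁ + K₂ + K₃) * M) ?_⟩
  · exact le_mul_of_one_le_left hM (by linarith)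
  · exact mul_le_mul_of_nonneg_right (by linarith) hM
  · exact mul_le_mul_of_nonneg_right (by linarith) hM
  · exact mul_le_mul_of_nonneg_right (by linarith) hM
  · exact mul_le_mul_of_nonneg_right (by linarith) hM
  · have : 2 ^ (k + 1 + 1) * (A * (K₂ * M)) = K₃ * M := by rw [hK₃]; ring
    rw [this]
    exact mul_le_mul_of_nonneg_right (by linarith) hM

end

/-! ### Meshes -/

namespace Mesh

variable {N : ℕ} (x : Mesh N)

lemma left_lt_right (i : Fin N) : x.left i < x.right i := x.strictMono i.castSucc_lt_succ

lemma len_pos (i : Fin N) : 0 < x.len i := sub_pos.2 (x.left_lt_right i)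

lemma node_mem (i : Fin (N + 1)) : x.node i ∈ Icc 0 (2 * Real.pi) :=
  ⟨x.first ▸ x.strictMono.monotone (Fin.zero_le i), x.last ▸ x.strictMono.monotone (Fin.le_last i)⟩

lemma left_mem (i : Fin N) : x.left i ∈ Icc 0 (2 * Real.pi) := x.node_mem _

lemma right_mem (i : Fin N) : x.right i ∈ Icc 0 (2 * Real.pi) := x.node_mem _

lemma Icc_subset (i : Fin N) : Icc (x.left i) (x.right i) ⊆ Icc 0 (2 * Real.pi) :=
  Icc_subset_Icc (x.left_mem i).1 (x.right_mem i).2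

lemma len_le_size (i : Fin N) : x.len i ≤ x.size :=
  le_ciSup (Finite.bddAbove_range x.len) i

lemma pos {N : ℕ} (x : Mesh N) : 0 < N := by
  rcases Nat.eq_zero_or_pos N with rfl | h
  · have h1 := x.first
    have h2 := x.last
    rw [show Fin.last 0 = 0 from rfl, h1] at h2
    exact absurd h2 Real.two_pi_pos.ne
  · exact h

lemma size_pos : 0 < x.size := (x.len_pos ⟨0, x.pos⟩).trans_le (x.len_le_size _)

lemma sum_len : ∑ i, x.len i = 2 * Real.pi := by
  have h := sum_ite_le_sub x.node 0
  simp only [Fin.zero_le, if_true, x.first, x.last, sub_zero] at h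
  exact h

lemma pos_of_shapeRegular {σ : ℝ} (h : x.ShapeRegular σ) : 0 < σ := by
  have h1 := h ⟨0, x.pos⟩
  have h2 := x.len_pos ⟨0, x.pos⟩
  have h3 := x.size_pos
  by_contra hσ
  have := mul_nonpos_of_nonpos_of_nonneg (not_lt.1 hσ) h2.le
  linarith

lemma periodic {α : ℝ → ℝ} (hα : α 0 = α (2 * Real.pi)) (i : Fin N) :
    α (x.left (finRotate N i)) = α (x.right i) := by
  obtain ⟨n, rfl⟩ := Nat.exists_eq_succ_of_ne_zero x.pos.ne'
  refine Fin.lastCases ?_ (fun j => ?_) i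
  · have h1 := x.first
    have h2 := x.last
    rw [finRotate_last, left, right, Fin.castSucc_zero, Fin.succ_last, h1, h2, hα]
  · have h1 : finRotate (n + 1) j.castSucc = j.succ := by
      rw [finRotate_apply]
      exact Fin.coeSucc_eq_succ
    rw [h1, left, right, Fin.succ_castSucc]

end Mesh

/-! ### The numerical flux of a finite element function -/

/-- The data of an element that the analysis uses. `W` bounds the weights and the Lebesgue constant,
`τ` is the threshold below which the coefficient is treated as degenerate. -/
structure IsElementRule {k : ℕ} (W τ : ℝ) (a : ℝ) (p A : Fin (k + 2) → ℝ) : Prop where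
  partition : IsRefPartition p
  quadrature : IsQuadrature p A
  weight_le : ∀ l, |A l| ≤ W
  lebesgue : LebesgueBound p W
  right : τ < a → IsRightAdapted p A
  left : a < -τ → IsLeftAdapted p A

/-- With the coefficient frozen at `c 0` the quadrature sum is exact on `Z' Z`, of degree below
`2k`, and reduces to boundary values. The error consists of the oscillation `d` of the coefficient
and of the two end points, where the upwind value may come from a neighbour; those terms carry the
end weights. -/
lemma abs_fluxPairing_sub_le {k : ℕ} (hk : 1 ≤ k) {p A : Fin (k + 2) → ℝ} (hA : IsQuadrature p A)
    (hp : IsRefPartition p) {W K n d : ℝ} (hW : ∀ l, |A l| ≤ W) {Z : ℝ[X]} (hZ : Z.natDegree ≤ k)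
    (hK : ∀ s ∈ Icc (-1 : ℝ) 1, |Z.eval s| ≤ K * n ∧ |(derivative Z).eval s| ≤ K * n)
    {c F : Fin (k + 2) → ℝ} (hc : ∀ l, |c l - c 0| ≤ d)
    (hF : ∀ l, l ≠ 0 → l ≠ Fin.last (k + 1) → F l = c l * Z.eval (p l)) :
    |fluxPairing p A Z F - (Z.eval 1 * F (Fin.last (k + 1)) - Z.eval (-1) * F 0 -
      (c (Fin.last (k + 1)) * Z.eval 1 ^ 2 - c 0 * Z.eval (-1) ^ 2) / 2)| ≤
      ((k + 2) * W + 1) * K ^ 2 * d * n ^ 2 +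
        |A 0| * (K * n) * |F 0 - c 0 * Z.eval (-1)| +
        |A (Fin.last (k + 1))| * (K * n) *
          |F (Fin.last (k + 1)) - c (Fin.last (k + 1)) * Z.eval 1| := by
  have h0l : (0 : Fin (k + 2)) ≠ Fin.last (k + 1) := (Fin.last_pos).ne
  have hKn : 0 ≤ K * n := (abs_nonneg _).trans (hK 0 (by norm_num)).1
  have hW0 : 0 ≤ W := (abs_nonneg _).trans (hW 0)
  have hd0 : 0 ≤ d := (abs_nonneg _).trans (hc 0)
  have hquad : ∑ l, A l * ((derivative Z).eval (p l) * Z.eval (p l)) =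
      (Z.eval 1 ^ 2 - Z.eval (-1) ^ 2) / 2 := by
    have h1 := hA.exact (derivative Z * Z) ((natDegree_mul_le).trans_lt (by
      have := natDegree_derivative_le Z
      omega))
    simp only [eval_mul] at h1
    have h2 := refInt_derivative_mul Z Z
    rw [mul_comm Z] at h2
    linarith
  set D : Fin (k + 2) → ℝ := fun l => A l * (derivative Z).eval (p l) * (F l - c l * Z.eval (p l))
    with hD
  have hDsum : ∑ l, D l = D 0 + D (Fin.last (k + 1)) := by
    refine Finset.sum_eq_add (0 : Fin (k + 2)) (Fin.last (k + 1)) h0l ?_ (by simp) (by simp)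
    intro l _ hl
    simp only [hD]
    rw [hF l hl.1 hl.2]
    ring
  set S := ∑ l, A l * (derivative Z).eval (p l) * Z.eval (p l) * (c l - c 0) with hS
  have hSbd : |S| ≤ (k + 2) * (W * (K * n) * (K * n) * d) := by
    refine (Finset.abs_sum_le_sum_abs _ _).trans ?_
    refine (Finset.sum_le_sum (g := fun _ => W * (K * n) * (K * n) * d) fun l _ => ?_).trans
      (by simp)
    have hb := hK _ (hp.mem_Icc l)
    rw [abs_mul, abs_mul, abs_mul]
    exact mul_le_mul (mul_le_mul (mul_le_mul (hW l) hb.2 (abs_nonneg _) hW0) hb.1 (abs_nonneg _)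
      (by positivity)) (hc l) (abs_nonneg _) (by positivity)
  have hsplit : ∑ l, A l * (derivative Z).eval (p l) * F l =
      D 0 + D (Fin.last (k + 1)) + S + c 0 * ((Z.eval 1 ^ 2 - Z.eval (-1) ^ 2) / 2) := by
    rw [← hDsum, ← hquad, hS, Finset.mul_sum, ← Finset.sum_add_distrib, ← Finset.sum_add_distrib]
    refine Finset.sum_congr rfl fun l _ => ?_
    simp only [hD]
    ring
  have hD0 : |D 0| ≤ |A 0| * (K * n) * |F 0 - c 0 * Z.eval (-1)| := by
    simp only [hD]
    rw [abs_mul, abs_mul, hp.2.1]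
    exact mul_le_mul_of_nonneg_right
      (mul_le_mul_of_nonneg_left (hK (-1) (by norm_num)).2 (abs_nonneg _)) (abs_nonneg _)
  have hD1 : |D (Fin.last (k + 1))| ≤ |A (Fin.last (k + 1))| * (K * n) *
      |F (Fin.last (k + 1)) - c (Fin.last (k + 1)) * Z.eval 1| := by
    simp only [hD]
    rw [abs_mul, abs_mul, hp.2.2]
    exact mul_le_mul_of_nonneg_right
      (mul_le_mul_of_nonneg_left (hK 1 (by norm_num)).2 (abs_nonneg _)) (abs_nonneg _)
  have hlast : |(c (Fin.last (k + 1)) - c 0) * Z.eval 1 ^ 2 / 2| ≤ d * (K * n) ^ 2 := by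
    have h1 : Z.eval 1 ^ 2 ≤ (K * n) ^ 2 := sq_le_sq' (by
      have := (abs_le.1 (hK 1 (by norm_num)).1).1
      linarith) ((le_abs_self _).trans (hK 1 (by norm_num)).1)
    rw [abs_div, abs_mul, abs_of_nonneg (sq_nonneg (Z.eval 1)), abs_two]
    have h2 := mul_le_mul (hc (Fin.last (k + 1))) h1 (sq_nonneg _) hd0
    have h3 : 0 ≤ d * (K * n) ^ 2 := by positivity
    linarith
  have hident : fluxPairing p A Z F - (Z.eval 1 * F (Fin.last (k + 1)) - Z.eval (-1) * F 0 -
      (c (Fin.last (k + 1)) * Z.eval 1 ^ 2 - c 0 * Z.eval (-1) ^ 2) / 2) =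
      (c (Fin.last (k + 1)) - c 0) * Z.eval 1 ^ 2 / 2 - S - D 0 - D (Fin.last (k + 1)) := by
    rw [fluxPairing, hsplit]
    ring
  rw [hident]
  have t1 := abs_sub ((c (Fin.last (k + 1)) - c 0) * Z.eval 1 ^ 2 / 2 - S - D 0)
    (D (Fin.last (k + 1)))
  have t2 := abs_sub ((c (Fin.last (k + 1)) - c 0) * Z.eval 1 ^ 2 / 2 - S) (D 0)
  have t3 := abs_sub ((c (Fin.last (k + 1)) - c 0) * Z.eval 1 ^ 2 / 2) S
  have e : ((k + 2) * W + 1) * K ^ 2 * d * n ^ 2 =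
      (k + 2) * (W * (K * n) * (K * n) * d) + d * (K * n) ^ 2 := by ring
  rw [e]
  linarith

/-- The balance of the weighted fluxes at an interface, with the upwind value on the side of `x`. -/
lemma interface_bound {Λ h K a A b r r' n n' x y : ℝ} (hΛ : 0 ≤ Λ) (hh : 0 < h)
    (hA : 0 < A) (ha : |a - A| ≤ Λ * h) (hb : |b - A| ≤ Λ * h) (hr0 : 0 ≤ r) (hr0' : 0 ≤ r')
    (hr : r ^ 2 = a ^ 2 + A ^ 2) (hr' : r' ^ 2 = A ^ 2 + b ^ 2)
    (hx : |x| ≤ K * n) (hy : |y| ≤ K * n') :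
    -((2 + 2 * Λ) ^ 2 * K ^ 2 * h * ((r * n) ^ 2 + (r' * n') ^ 2)) ≤
      A / 2 * (r ^ 2 * x ^ 2 + r' ^ 2 * y ^ 2) - A * r' ^ 2 * (x * y) := by
  have ha' := abs_le.1 ha
  have hb' := abs_le.1 hb
  have hAr : A ≤ r := (sq_le_sq₀ hA.le hr0).1 (by rw [hr]; linarith [sq_nonneg a])
  have hx2 : x ^ 2 ≤ (K * n) ^ 2 := sq_le_sq' (by linarith [(abs_le.1 hx).1]) ((le_abs_self _).trans hx)
  have hy2 : y ^ 2 ≤ (K * n') ^ 2 := sq_le_sq' (by linarith [(abs_le.1 hy).1]) ((le_abs_self _).trans hy)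
  have hrx : r ^ 2 * x ^ 2 ≤ K ^ 2 * (r * n) ^ 2 := by
    calc r ^ 2 * x ^ 2 ≤ r ^ 2 * (K * n) ^ 2 := mul_le_mul_of_nonneg_left hx2 (sq_nonneg r)
      _ = _ := by ring
  have hry : r' ^ 2 * y ^ 2 ≤ K ^ 2 * (r' * n') ^ 2 := by
    calc r' ^ 2 * y ^ 2 ≤ r' ^ 2 * (K * n') ^ 2 := mul_le_mul_of_nonneg_left hy2 (sq_nonneg r')
      _ = _ := by ring
  have hh2 : 0 ≤ (2 + 2 * Λ) ^ 2 * K ^ 2 * h * (r' * n') ^ 2 := by positivity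
  -- The right side is `A / 2 * ((r² - r'²) x² + r'² (x - y)²)`. For `A ≥ h` the difference `r² -
  -- r'² = a² - b²` is of order `h A`, and `A² ≤ r²`. For `A < h` the number `r'` is itself of order
  -- `h`, and only the cross term has to be estimated.
  rcases le_or_gt h A with hA' | hA'
  · have hab : |a ^ 2 - b ^ 2| ≤ 2 * Λ * h * ((2 + 2 * Λ) * A) := by
      have h1 : |a - b| ≤ 2 * Λ * h := abs_le.2 ⟨by linarith, by linarith⟩
      have h2 : |a + b| ≤ (2 + 2 * Λ) * A := by
        have := mul_le_mul_of_nonneg_left hA' hΛ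
        exact abs_le.2 ⟨by linarith, by linarith⟩
      rw [sq_sub_sq, mul_comm, abs_mul]
      exact mul_le_mul h1 h2 (abs_nonneg _) (by positivity)
    have h3 : -(2 * Λ * h * ((2 + 2 * Λ) * A)) ≤ r ^ 2 - r' ^ 2 := by
      have := (abs_le.1 hab).1
      rw [hr, hr']; linarith
    have h4 : -(2 * Λ * h * ((2 + 2 * Λ) * A)) * (A / 2 * x ^ 2) ≤
        (r ^ 2 - r' ^ 2) * (A / 2 * x ^ 2) :=
      mul_le_mul_of_nonneg_right h3 (by positivity)
    have h5 : A ^ 2 * x ^ 2 ≤ r ^ 2 * x ^ 2 :=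
      mul_le_mul_of_nonneg_right (pow_le_pow_left₀ hA.le hAr 2) (sq_nonneg x)
    have h6 : Λ * (2 + 2 * Λ) * h * (A ^ 2 * x ^ 2) ≤
        Λ * (2 + 2 * Λ) * h * (K ^ 2 * (r * n) ^ 2) :=
      mul_le_mul_of_nonneg_left (h5.trans hrx) (by positivity)
    have h7 : Λ * (2 + 2 * Λ) * h * (K ^ 2 * (r * n) ^ 2) ≤
        (2 + 2 * Λ) * (2 + 2 * Λ) * h * (K ^ 2 * (r * n) ^ 2) := by
      gcongr
      linarith
    have h8 : 0 ≤ A / 2 * (r' ^ 2 * (y - x) ^ 2) := by positivity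
    linarith
  · have hr'h : r' ≤ (2 + 2 * Λ) * h := by
      refine (sq_le_sq₀ hr0' (by positivity)).1 ?_
      have hbA : |b| ≤ (1 + Λ) * h := abs_le.2 ⟨by linarith, by linarith⟩
      have h1 : b ^ 2 ≤ ((1 + Λ) * h) ^ 2 := sq_le_sq' (by linarith [(abs_le.1 hbA).1])
        ((le_abs_self _).trans hbA)
      have h2 : A ^ 2 ≤ h ^ 2 := pow_le_pow_left₀ hA.le hA'.le 2
      rw [hr']
      linarith [mul_nonneg hΛ (sq_nonneg h), mul_nonneg (mul_nonneg hΛ hΛ) (sq_nonneg h), sq_nonneg h]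
    have h1 : A * r' ^ 2 * (x * y) ≤ (2 + 2 * Λ) * h * ((r * |x|) * (r' * |y|)) := by
      have h2 : A * r' ^ 2 * (x * y) ≤ A * r' ^ 2 * (|x| * |y|) := by
        rw [← abs_mul]
        exact mul_le_mul_of_nonneg_left (le_abs_self _) (by positivity)
      have h3 : A * r' ≤ r * ((2 + 2 * Λ) * h) := mul_le_mul hAr hr'h hr0' hr0
      have h4 := mul_le_mul_of_nonneg_right h3 (by positivity : 0 ≤ r' * (|x| * |y|))
      linarith
    have h5 : (r * |x|) * (r' * |y|) ≤ K ^ 2 * ((r * n) ^ 2 + (r' * n') ^ 2) := by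
      have h6 := two_mul_le_add_sq (r * |x|) (r' * |y|)
      rw [mul_pow, mul_pow r' |y|, sq_abs, sq_abs] at h6
      have h7 : 0 ≤ K ^ 2 * (r * n) ^ 2 := by positivity
      have h8 : 0 ≤ K ^ 2 * (r' * n') ^ 2 := by positivity
      linarith
    have h9 : (2 + 2 * Λ) * h * ((r * |x|) * (r' * |y|)) ≤
        (2 + 2 * Λ) * h * (K ^ 2 * ((r * n) ^ 2 + (r' * n') ^ 2)) :=
      mul_le_mul_of_nonneg_left h5 (by positivity)
    have h10 : (2 + 2 * Λ) * h * (K ^ 2 * ((r * n) ^ 2 + (r' * n') ^ 2)) ≤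
        (2 + 2 * Λ) ^ 2 * h * (K ^ 2 * ((r * n) ^ 2 + (r' * n') ^ 2)) := by
      refine mul_le_mul_of_nonneg_right (mul_le_mul_of_nonneg_right ?_ hh.le) (by positivity)
      nlinarith
    have h11 : 0 ≤ A / 2 * (r ^ 2 * x ^ 2 + r' ^ 2 * y ^ 2) := by positivity
    linarith

/-! ### The weighted coercivity of the numerical flux -/

/-- One factor of `r ^ 2` is at most `D`, which will be of order `h`. The other is paired with `n`,
and `c`, being below both `r` and `r'`, turns the flux jump `δ` into weighted norms of the two
neighbours. -/
lemma degenerate_term_bound {r r' n n' c A δ W K D : ℝ} (hn : 0 ≤ n) (hn' : 0 ≤ n')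
    (hK : 0 ≤ K) (hD : 0 ≤ D) (hr : 0 ≤ r) (hr' : 0 ≤ r')
    (hrD : r ≤ D) (hA : |A| ≤ W) (hcr : c ≤ r) (hcr' : c ≤ r')
    (hδ0 : 0 ≤ δ) (hδ : δ ≤ c * (K * n' + K * n)) :
    r ^ 2 * (|A| * (K * n) * δ) ≤ 2 * (W * K ^ 2) * D * ((r * n) ^ 2 + (r' * n') ^ 2) := by
  have hW : 0 ≤ W := (abs_nonneg A).trans hA
  have h1 : δ ≤ K * (r' * n' + r * n) := by
    refine hδ.trans ?_
    have h2 := mul_le_mul_of_nonneg_right hcr' (mul_nonneg hK hn')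
    have h3 := mul_le_mul_of_nonneg_right hcr (mul_nonneg hK hn)
    linarith
  calc r ^ 2 * (|A| * (K * n) * δ)
      ≤ r ^ 2 * (W * (K * n) * (K * (r' * n' + r * n))) := by gcongr
    _ = W * K ^ 2 * r * ((r * n) * (r' * n' + r * n)) := by ring
    _ ≤ W * K ^ 2 * D * (2 * ((r * n) ^ 2 + (r' * n') ^ 2)) := by
        have h3 := two_mul_le_add_sq (r * n) (r' * n')
        have h4 := sq_nonneg (r * n)
        have h5 := sq_nonneg (r' * n')
        exact mul_le_mul (mul_le_mul_of_nonneg_left hrD (by positivity)) (by linarith)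
          (by positivity) (by positivity)
    _ = _ := by ring

section

variable {N k : ℕ} {α : ℝ → ℝ} {x : Mesh N} {s : Fin N → Fin (k + 2) → ℝ}

/-- The weight of an element in the norm `‖·‖_α`. -/
def elemWeight (α : ℝ → ℝ) (x : Mesh N) (i : Fin N) : ℝ := α (x.left i) ^ 2 + α (x.right i) ^ 2

/-- The restriction of a finite element function to an element, on the reference element. -/
def refFun (x : Mesh N) (v : Fin N → ℝ[X]) (i : Fin N) : ℝ[X] :=
  pull (x.left i) (x.right i) (v i)

lemma pt_eq_elemMap (i : Fin N) (l : Fin (k + 2)) :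
    x.pt s i l = elemMap (x.left i) (x.right i) (s i l) := rfl

lemma pt_zero {i : Fin N} (hp : IsRefPartition (s i)) : x.pt s i 0 = x.left i := by
  rw [pt_eq_elemMap, hp.2.1, elemMap_neg_one]

lemma pt_last {i : Fin N} (hp : IsRefPartition (s i)) :
    x.pt s i (Fin.last (k + 1)) = x.right i := by
  rw [pt_eq_elemMap, hp.2.2, elemMap_one]

lemma pt_mem {i : Fin N} (hp : IsRefPartition (s i)) (l : Fin (k + 2)) :
    x.pt s i l ∈ Icc (x.left i) (x.right i) :=
  elemMap_mem (x.left_lt_right i).le (hp.mem_Icc l)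

lemma refFun_eval_one (v : Fin N → ℝ[X]) (i : Fin N) :
    (refFun x v i).eval 1 = (v i).eval (x.right i) := by
  rw [refFun, eval_pull, elemMap_one]

lemma refFun_eval_neg_one (v : Fin N → ℝ[X]) (i : Fin N) :
    (refFun x v i).eval (-1) = (v i).eval (x.left i) := by
  rw [refFun, eval_pull, elemMap_neg_one]

lemma flux_zero (v : Fin N → ℝ[X]) (i : Fin N) :
    flux α x s v i 0 = α (x.left i) * upwind α x v ((finRotate N).symm i) := if_pos rfl

lemma flux_last (v : Fin N → ℝ[X]) (i : Fin N) :
    flux α x s v i (Fin.last (k + 1)) = α (x.right i) * upwind α x v i := by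
  rw [flux, if_neg (Fin.last_pos).ne', if_pos rfl]

lemma flux_interior (v : Fin N → ℝ[X]) (i : Fin N) {l : Fin (k + 2)} (h0 : l ≠ 0)
    (hl : l ≠ Fin.last (k + 1)) :
    flux α x s v i l = α (x.pt s i l) * (v i).eval (x.pt s i l) := by
  rw [flux, if_neg h0, if_neg hl]

/-- Within an element the pairing is a boundary term up to order `h`; summed over the interfaces,
the boundary terms are bounded below by upwinding. The weights differ from one element to the next,
and `interface_bound` shows that this costs only order `h`. -/
lemma neg_sum_fluxPairing_le (hk : 1 ≤ k) {Λ W : ℝ} (hΛ : 0 ≤ Λ) (hW : 0 ≤ W) :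
    ∃ C, 0 ≤ C ∧ ∀ (N : ℕ) (x : Mesh N) (α : ℝ → ℝ) (s A : Fin N → Fin (k + 2) → ℝ)
      (v : Fin N → ℝ[X]), α 0 = α (2 * Real.pi) →
      (∀ y ∈ Icc 0 (2 * Real.pi), ∀ z ∈ Icc 0 (2 * Real.pi), |α y - α z| ≤ Λ * |y - z|) →
      (∀ i, IsElementRule W (2 * Λ * x.size) (α (x.left i)) (s i) (A i)) →
      (∀ i, (v i).natDegree ≤ k) →
      -∑ i, elemWeight α x i * fluxPairing (s i) (A i) (refFun x v i) (flux α x s v i) ≤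
        C * x.size * ∑ i, elemWeight α x i * refNorm (refFun x v i) ^ 2 := by
  obtain ⟨K, hK1, hK⟩ := exists_inverse_const k
  have hK0 : 0 ≤ K := zero_le_one.trans hK1
  set C₁ := ((k + 2) * W + 1) * K ^ 2 * Λ with hC₁
  set C₂ := 2 * (W * K ^ 2) * (5 * Λ) with hC₂
  set C₃ := (2 + 2 * Λ) ^ 2 * K ^ 2 with hC₃
  have hC₁0 : 0 ≤ C₁ := by positivity
  have hC₂0 : 0 ≤ C₂ := by positivity
  have hC₃0 : 0 ≤ C₃ := by positivity
  refine ⟨C₁ + 4 * C₂ + 2 * C₃, by positivity, fun N x α s A v hper hlip hrule hdeg => ?_⟩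
  set h := x.size with hh
  have hh0 : 0 < h := x.size_pos
  let e := finRotate N
  let Z := refFun x v
  let n : Fin N → ℝ := fun i => refNorm (Z i)
  let r : Fin N → ℝ := fun i => Real.sqrt (elemWeight α x i)
  have hn0 : ∀ i, 0 ≤ n i := fun i => refNorm_nonneg _
  have hr0 : ∀ i, 0 ≤ r i := fun i => Real.sqrt_nonneg _
  have hr2 : ∀ i, r i ^ 2 = elemWeight α x i := fun i =>
    Real.sq_sqrt (add_nonneg (sq_nonneg _) (sq_nonneg _))
  have hZdeg : ∀ i, (Z i).natDegree ≤ k := fun i => (natDegree_pull_le _).trans (hdeg i)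
  have hZ : ∀ i, ∀ s ∈ Icc (-1 : ℝ) 1, |(Z i).eval s| ≤ K * n i ∧
      |(derivative (Z i)).eval s| ≤ K * n i := fun i => (hK (Z i) (hZdeg i)).2
  have hlipE : ∀ i, ∀ y ∈ Icc (x.left i) (x.right i), ∀ z ∈ Icc (x.left i) (x.right i),
      |α y - α z| ≤ Λ * h := fun i y hy z hz => by
    refine (hlip y (x.Icc_subset i hy) z (x.Icc_subset i hz)).trans
      (mul_le_mul_of_nonneg_left ?_ hΛ)
    refine le_trans ?_ (x.len_le_size i)
    rw [Mesh.len, abs_le]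
    constructor <;> linarith [hy.1, hy.2, hz.1, hz.2]
  have hlr : ∀ i, |α (x.left i) - α (x.right i)| ≤ Λ * h := fun i =>
    hlipE i _ (left_mem_Icc.2 (x.left_lt_right i).le) _ (right_mem_Icc.2 (x.left_lt_right i).le)
  have hαl : ∀ i, |α (x.left i)| ≤ r i := fun i => Real.abs_le_sqrt (by
    rw [elemWeight]; linarith [sq_nonneg (α (x.right i))])
  have hαr : ∀ i, |α (x.right i)| ≤ r i := fun i => Real.abs_le_sqrt (by
    rw [elemWeight]; linarith [sq_nonneg (α (x.left i))])
  -- The value at the right end is then at most `3Λh`, and `4 + 9 ≤ 25`.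
  have hdegen : ∀ i, |α (x.left i)| ≤ 2 * Λ * h → r i ≤ 5 * Λ * h := fun i hi => by
    have hΛh : 0 ≤ Λ * h := by positivity
    have h1 := abs_le.1 hi
    have h2 := abs_le.1 (hlr i)
    have h3 : α (x.left i) ^ 2 ≤ (2 * Λ * h) ^ 2 := sq_le_sq' h1.1 h1.2
    have h4 : α (x.right i) ^ 2 ≤ (3 * Λ * h) ^ 2 := sq_le_sq' (by linarith) (by linarith)
    refine Real.sqrt_le_iff.2 ⟨by positivity, ?_⟩
    rw [elemWeight]
    have h5 : 0 ≤ (Λ * h) ^ 2 := sq_nonneg _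
    linarith
  have hperi : ∀ i, α (x.left (e i)) = α (x.right i) := x.periodic hper
  have helem : ∀ i, elemWeight α x i *
      (refFun x v i).eval 1 * flux α x s v i (Fin.last (k + 1)) -
      elemWeight α x i * (refFun x v i).eval (-1) * flux α x s v i 0 -
      elemWeight α x i *
        ((α (x.right i) * (Z i).eval 1 ^ 2 - α (x.left i) * (Z i).eval (-1) ^ 2) / 2) -
      C₁ * h * (r i * n i) ^ 2 -
      C₂ * h * ((r i * n i) ^ 2 + (r (e.symm i) * n (e.symm i)) ^ 2) -
      C₂ * h * ((r i * n i) ^ 2 + (r (e i) * n (e i)) ^ 2) ≤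
      elemWeight α x i * fluxPairing (s i) (A i) (refFun x v i) (flux α x s v i) := fun i => by
    have hp := (hrule i).partition
    have hmain := abs_fluxPairing_sub_le hk (hrule i).quadrature hp (hrule i).weight_le (hZdeg i)
      (hZ i) (c := fun l => α (x.pt s i l)) (d := Λ * h) (F := flux α x s v i)
      (fun l => hlipE i _ (pt_mem hp l) _ (pt_mem hp 0))
      (fun l h0 hl => by rw [flux_interior v i h0 hl]; simp only [Z, refFun, eval_pull]; rfl)
    simp only [pt_zero hp, pt_last hp] at hmain
    have hw : 0 ≤ elemWeight α x i := add_nonneg (sq_nonneg _) (sq_nonneg _)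
    -- The end point error vanishes if the upwind value is taken inside the element, and also beyond
    -- the threshold, where the end weight is zero. Otherwise the element is degenerate.
    have he0 : r i ^ 2 * (|A i 0| * (K * n i) *
        |flux α x s v i 0 - α (x.left i) * (Z i).eval (-1)|) ≤
        C₂ * h * ((r i * n i) ^ 2 + (r (e.symm i) * n (e.symm i)) ^ 2) := by
      have hnn : 0 ≤ C₂ * h * ((r i * n i) ^ 2 + (r (e.symm i) * n (e.symm i)) ^ 2) := by
        positivity
      have hpe : α (x.right (e.symm i)) = α (x.left i) := by
        rw [← hperi, Equiv.apply_symm_apply]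
      rw [flux_zero, ← mul_sub, abs_mul]
      rcases le_or_gt (α (x.left i)) 0 with hneg | hpos
      · have : upwind α x v (e.symm i) = (Z i).eval (-1) := by
          rw [upwind, if_neg (by rw [hpe]; exact not_lt.2 hneg), refFun_eval_neg_one]
          simp only [e, Equiv.apply_symm_apply]
        rw [this, sub_self, abs_zero, mul_zero, mul_zero, mul_zero]
        exact hnn
      rcases lt_or_ge (2 * Λ * h) (α (x.left i)) with hfar | hnear
      · rw [((hrule i).right hfar).1, abs_zero, zero_mul, zero_mul, mul_zero]
        exact hnn
      · have hup : upwind α x v (e.symm i) = (Z (e.symm i)).eval 1 := by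
          rw [upwind, if_pos (by rw [hpe]; exact hpos), refFun_eval_one]
        have hC : C₂ * h = 2 * (W * K ^ 2) * (5 * Λ * h) := by rw [hC₂]; ring
        rw [hC]
        refine degenerate_term_bound (c := |α (x.left i)|)
          (δ := |α (x.left i)| * |upwind α x v (e.symm i) - (Z i).eval (-1)|)
          (hn0 i) (hn0 _) hK0 (by positivity) (hr0 i) (hr0 _)
          (hdegen i (by rwa [abs_of_pos hpos])) ((hrule i).weight_le 0) (hαl i)
          (by rw [← hpe]; exact hαr _) (by positivity) ?_
        · rw [hup]
          refine mul_le_mul_of_nonneg_left ((abs_sub _ _).trans (add_le_add ?_ ?_)) (abs_nonneg _)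
          · exact (hZ _ 1 (by norm_num)).1
          · exact (hZ _ (-1) (by norm_num)).1
    have he1 : r i ^ 2 * (|A i (Fin.last (k + 1))| * (K * n i) *
        |flux α x s v i (Fin.last (k + 1)) - α (x.right i) * (Z i).eval 1|) ≤
        C₂ * h * ((r i * n i) ^ 2 + (r (e i) * n (e i)) ^ 2) := by
      have hnn : 0 ≤ C₂ * h * ((r i * n i) ^ 2 + (r (e i) * n (e i)) ^ 2) := by positivity
      rw [flux_last, ← mul_sub, abs_mul]
      rcases lt_or_ge 0 (α (x.right i)) with hpos | hneg
      · rw [upwind, if_pos hpos, refFun_eval_one, sub_self, abs_zero, mul_zero, mul_zero, mul_zero]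
        exact hnn
      rcases lt_or_ge (α (x.left i)) (-(2 * Λ * h)) with hfar | hnear
      · rw [((hrule i).left hfar).1, abs_zero, zero_mul, zero_mul, mul_zero]
        exact hnn
      · have hup : upwind α x v i = (Z (e i)).eval (-1) := by
          rw [upwind, if_neg (not_lt.2 hneg), refFun_eval_neg_one]
        have hC : C₂ * h = 2 * (W * K ^ 2) * (5 * Λ * h) := by rw [hC₂]; ring
        have hαle : |α (x.left i)| ≤ 2 * Λ * h := by
          have h2 := abs_le.1 (hlr i)
          have : 0 ≤ Λ * h := by positivity
          exact abs_le.2 ⟨hnear, by linarith⟩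
        rw [hC]
        refine degenerate_term_bound (c := |α (x.right i)|)
          (δ := |α (x.right i)| * |upwind α x v i - (Z i).eval 1|)
          (hn0 i) (hn0 _) hK0 (by positivity) (hr0 i) (hr0 _)
          (hdegen i hαle) ((hrule i).weight_le _) (hαr i)
          (by rw [← hperi]; exact hαl _) (by positivity) ?_
        · rw [hup]
          refine mul_le_mul_of_nonneg_left ((abs_sub _ _).trans (add_le_add ?_ ?_)) (abs_nonneg _)
          · exact (hZ _ (-1) (by norm_num)).1
          · exact (hZ _ 1 (by norm_num)).1
    have hlow := (abs_le.1 hmain).1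
    have h1 := mul_le_mul_of_nonneg_left hlow hw
    rw [← hr2] at h1 ⊢
    have hC1 : r i ^ 2 * (((k + 2) * W + 1) * K ^ 2 * (Λ * h) * n i ^ 2) =
        C₁ * h * (r i * n i) ^ 2 := by rw [hC₁]; ring
    linarith
  -- For negative `α` the interface estimate is used in mirrored form, with the roles of the two
  -- elements exchanged.
  have hint : ∀ i, -(C₃ * h * ((r i * n i) ^ 2 + (r (e i) * n (e i)) ^ 2)) ≤
      elemWeight α x i * ((Z i).eval 1 * (α (x.right i) * upwind α x v i) -
        α (x.right i) * (Z i).eval 1 ^ 2 / 2) -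
      elemWeight α x (e i) * ((Z (e i)).eval (-1) * (α (x.right i) * upwind α x v i) -
        α (x.right i) * (Z (e i)).eval (-1) ^ 2 / 2) := fun i => by
    have hZ1 := (hZ i 1 (by norm_num)).1
    have hZ2 := (hZ (e i) (-1) (by norm_num)).1
    have hl1 : |α (x.left i) - α (x.right i)| ≤ Λ * h := hlr i
    have hl2 : |α (x.right (e i)) - α (x.right i)| ≤ Λ * h := by
      rw [← hperi i, abs_sub_comm]; exact hlr (e i)
    have hw1 : r i ^ 2 = α (x.left i) ^ 2 + α (x.right i) ^ 2 := hr2 i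
    have hw2 : r (e i) ^ 2 = α (x.right i) ^ 2 + α (x.right (e i)) ^ 2 := by
      rw [hr2, elemWeight, hperi]
    rw [← hr2, ← hr2]
    rcases lt_trichotomy 0 (α (x.right i)) with hpos | hzero | hneg
    · have hup : upwind α x v i = (Z i).eval 1 := by
        rw [upwind, if_pos hpos, refFun_eval_one]
      have := interface_bound hΛ hh0 hpos hl1 hl2 (hr0 i) (hr0 (e i)) hw1 hw2 hZ1 hZ2
      rw [hup]
      linarith
    · rw [← hzero]
      have : 0 ≤ C₃ * h * ((r i * n i) ^ 2 + (r (e i) * n (e i)) ^ 2) := by positivity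
      linarith
    · have hup : upwind α x v i = (Z (e i)).eval (-1) := by
        rw [upwind, if_neg (not_lt.2 hneg.le), refFun_eval_neg_one]
      have := interface_bound (A := -α (x.right i)) (a := -α (x.right (e i)))
        (b := -α (x.left i)) hΛ hh0 (by linarith)
        (by rw [neg_sub_neg, abs_sub_comm]; exact hl2)
        (by rw [neg_sub_neg, abs_sub_comm]; exact hl1) (hr0 (e i)) (hr0 i)
        (by rw [hw2]; ring) (by rw [hw1]; ring) hZ2 hZ1
      rw [hup]
      linarith
  -- Shifting the left-end terms by the periodic rotation pairs the two sides of each interface.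
  have hsum : ∑ i, elemWeight α x i *
        ((Z i).eval 1 * (α (x.right i) * upwind α x v i) - α (x.right i) * (Z i).eval 1 ^ 2 / 2) -
      ∑ i, elemWeight α x i * ((Z i).eval (-1) * flux α x s v i 0 -
        α (x.left i) * (Z i).eval (-1) ^ 2 / 2) ≥
      -∑ i, C₃ * h * ((r i * n i) ^ 2 + (r (e i) * n (e i)) ^ 2) := by
    rw [← Equiv.sum_comp e (fun i => elemWeight α x i * ((Z i).eval (-1) * flux α x s v i 0 -
        α (x.left i) * (Z i).eval (-1) ^ 2 / 2)), ← Finset.sum_sub_distrib,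
      ← Finset.sum_neg_distrib]
    refine Finset.sum_le_sum fun i _ => ?_
    have := hint i
    rw [flux_zero, hperi i]
    simp only [e, Equiv.symm_apply_apply] at this ⊢
    exact this
  have htot := Finset.sum_le_sum fun i (_ : i ∈ Finset.univ) => helem i
  set S := ∑ i, (r i * n i) ^ 2 with hS
  have hSe : ∑ i, (r (e i) * n (e i)) ^ 2 = S :=
    Equiv.sum_comp e fun i => (r i * n i) ^ 2
  have hSe' : ∑ i, (r (e.symm i) * n (e.symm i)) ^ 2 = S :=
    Equiv.sum_comp e.symm fun i => (r i * n i) ^ 2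
  have hSS : ∑ i, elemWeight α x i * refNorm (refFun x v i) ^ 2 = S :=
    Finset.sum_congr rfl fun i _ => by rw [mul_pow, hr2]
  rw [hSS]
  simp only [Finset.sum_sub_distrib, ← Finset.mul_sum, Finset.sum_add_distrib, hSe, hSe'] at htot
  simp only [mul_sub, Finset.sum_sub_distrib, ← Finset.mul_sum, Finset.sum_add_distrib, hSe] at hsum
  have e1 : ∑ i, elemWeight α x i * (refFun x v i).eval 1 * flux α x s v i (Fin.last (k + 1)) =
      ∑ i, elemWeight α x i * ((Z i).eval 1 * (α (x.right i) * upwind α x v i)) :=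
    Finset.sum_congr rfl fun i _ => by rw [flux_last]; simp only [Z]; ring
  have e2 : ∑ i, elemWeight α x i * (refFun x v i).eval (-1) * flux α x s v i 0 =
      ∑ i, elemWeight α x i * ((Z i).eval (-1) * flux α x s v i 0) :=
    Finset.sum_congr rfl fun i _ => by simp only [Z]; ring
  have e3 : ∑ i, elemWeight α x i *
        ((α (x.right i) * (Z i).eval 1 ^ 2 - α (x.left i) * (Z i).eval (-1) ^ 2) / 2) =
      ∑ i, elemWeight α x i * (α (x.right i) * (Z i).eval 1 ^ 2 / 2) -
        ∑ i, elemWeight α x i * (α (x.left i) * (Z i).eval (-1) ^ 2 / 2) := by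
    rw [← Finset.sum_sub_distrib]
    exact Finset.sum_congr rfl fun i _ => by ring
  rw [e1, e2, e3] at htot
  linarith

end

/-! ### Differentiation of forms evaluated at time-dependent polynomials -/

section

variable {S : Set ℝ} {t : ℝ} {k : ℕ} {P : ℝ → ℝ[X]} {P' : ℝ[X]}

lemma linearMap_eq_sum_coeff {M : Type*} [AddCommGroup M] [Module ℝ M] (L : ℝ[X] →ₗ[ℝ] M)
    {f : ℝ[X]} (hf : f.natDegree ≤ k) :
    L f = ∑ m ∈ Finset.range (k + 1), f.coeff m • L (X ^ m) := by
  conv_lhs => rw [as_sum_range_C_mul_X_pow' f (Nat.lt_succ_of_le hf)]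
  rw [map_sum]
  exact Finset.sum_congr rfl fun m _ => by rw [← smul_eq_C_mul, map_smul]

lemma hasDerivWithinAt_linearMap (L : ℝ[X] →ₗ[ℝ] ℝ) (hdeg : ∀ τ ∈ S, (P τ).natDegree ≤ k)
    (hdeg' : P'.natDegree ≤ k) (ht : t ∈ S)
    (h : ∀ m, HasDerivWithinAt (fun τ => (P τ).coeff m) (P'.coeff m) S t) :
    HasDerivWithinAt (fun τ => L (P τ)) (L P') S t := by
  rw [linearMap_eq_sum_coeff L hdeg']
  refine (HasDerivWithinAt.fun_sum fun m _ => (h m).smul_const (L (X ^ m))).congr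
    (fun τ hτ => linearMap_eq_sum_coeff L (hdeg τ hτ)) (linearMap_eq_sum_coeff L (hdeg t ht))

lemma hasDerivWithinAt_bilinear (B : ℝ[X] →ₗ[ℝ] ℝ[X] →ₗ[ℝ] ℝ)
    (hdeg : ∀ τ ∈ S, (P τ).natDegree ≤ k)
    (hdeg' : P'.natDegree ≤ k) (ht : t ∈ S)
    (h : ∀ m, HasDerivWithinAt (fun τ => (P τ).coeff m) (P'.coeff m) S t) :
    HasDerivWithinAt (fun τ => B (P τ) (P τ)) (B P' (P t) + B (P t) P') S t := by
  have hsum : ∀ f g : ℝ[X], f.natDegree ≤ k →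
      B f g = ∑ m ∈ Finset.range (k + 1), f.coeff m * B (X ^ m) g := fun f g hf => by
    rw [linearMap_eq_sum_coeff B hf, LinearMap.sum_apply]
    rfl
  rw [hsum P' (P t) hdeg', hsum (P t) P' (hdeg t ht), ← Finset.sum_add_distrib]
  exact (HasDerivWithinAt.fun_sum fun m _ => (h m).mul
    (hasDerivWithinAt_linearMap (B (X ^ m)) hdeg hdeg' ht h)).congr
      (fun τ hτ => hsum _ _ (hdeg τ hτ)) (hsum _ _ (hdeg t ht))

end

/-- Pulling back to the reference element, as a linear map. -/
def pullₗ (a b : ℝ) : ℝ[X] →ₗ[ℝ] ℝ[X] :=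
  (aeval (C ((b - a) / 2) * X + C ((a + b) / 2) : ℝ[X])).toLinearMap

lemma pullₗ_apply (a b : ℝ) (v : ℝ[X]) : pullₗ a b v = pull a b v := by
  rw [pull, comp_eq_aeval]; rfl

/-! ### Gronwall's inequality -/

lemma le_exp_mul_of_deriv_le {f f' : ℝ → ℝ} {T C : ℝ}
    (hf : ∀ t ∈ Icc 0 T, HasDerivWithinAt f (f' t) (Icc 0 T) t)
    (h : ∀ t ∈ Icc 0 T, f' t ≤ C * f t) {t : ℝ} (ht : t ∈ Icc 0 T) :
    f t ≤ Real.exp (C * t) * f 0 := by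
  have hder : ∀ t ∈ Icc 0 T, HasDerivWithinAt (fun t => Real.exp (-(C * t)) * f t)
      (Real.exp (-(C * t)) * (f' t - C * f t)) (Icc 0 T) t := fun t ht => by
    have h1 : HasDerivAt (fun t => Real.exp (-(C * t))) (Real.exp (-(C * t)) * -(C * 1)) t :=
      (((hasDerivAt_id t).const_mul C).neg).exp
    convert! h1.hasDerivWithinAt.mul (hf t ht) using 1
    ring
  have hanti : AntitoneOn (fun t => Real.exp (-(C * t)) * f t) (Icc 0 T) := by
    refine antitoneOn_of_deriv_nonpos (convex_Icc _ _)
      (fun t ht => (hder t ht).continuousWithinAt) (fun t ht => ?_) fun t ht => ?_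
    · exact ((hder t (interior_subset ht)).mono interior_subset).differentiableWithinAt
    · rw [((hder t (interior_subset ht)).hasDerivAt (mem_interior_iff_mem_nhds.1 ht)).deriv]
      exact mul_nonpos_of_nonneg_of_nonpos (Real.exp_pos _).le
        (by linarith [h t (interior_subset ht)])
  have h0 : (0 : ℝ) ∈ Icc 0 T := ⟨le_rfl, ht.1.trans ht.2⟩
  have h1 := hanti h0 ht ht.1
  simp only [mul_zero, neg_zero, Real.exp_zero, one_mul] at h1
  calc f t = Real.exp (C * t) * (Real.exp (-(C * t)) * f t) := by
        rw [← mul_assoc, ← Real.exp_add, add_neg_cancel, Real.exp_zero, one_mul]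
    _ ≤ _ := mul_le_mul_of_nonneg_left h1 (Real.exp_pos _).le

/-! ### The weighted norm on the reference element -/

section

variable {N k : ℕ} {α : ℝ → ℝ} {x : Mesh N}

lemma elemWeight_nonneg (α : ℝ → ℝ) (x : Mesh N) (i : Fin N) : 0 ≤ elemWeight α x i :=
  add_nonneg (sq_nonneg _) (sq_nonneg _)

/-- The factor `len / 2` matters for stability: `h` times the squared reference norm is comparable
to the squared norm on the element, so errors of order `h` in the flux are of the order of the
energy. -/
lemma integral_sq_eq_refNorm (v : Fin N → ℝ[X]) (i : Fin N) :
    ∫ y in (x.left i)..(x.right i), (v i).eval y ^ 2 =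
      x.len i / 2 * refNorm (refFun x v i) ^ 2 := by
  have h := integral_elemMap (a := x.left i) (b := x.right i) (fun y => (v i).eval y ^ 2) (-1) 1
  rw [elemMap_neg_one, elemMap_one] at h
  rw [← h, refNorm_sq, refInt_apply, Mesh.len]
  simp only [eval_mul, refFun, eval_pull, sq]

lemma weightedNorm_sq (v : Fin N → ℝ[X]) :
    weightedNorm α x v ^ 2 =
      ∑ i, elemWeight α x i * (x.len i / 2 * refNorm (refFun x v i) ^ 2) := by
  rw [weightedNorm, Real.sq_sqrt]
  · exact Finset.sum_congr rfl fun i _ => by rw [integral_sq_eq_refNorm]; rfl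
  · refine Finset.sum_nonneg fun i _ => mul_nonneg (elemWeight_nonneg α x i) ?_
    rw [integral_sq_eq_refNorm]
    have := (x.len_pos i).le
    positivity

end

/-- Stability of the scheme in the weighted norm: a finite element function satisfying the scheme up
to a residual is bounded by its initial value and the residual. -/
lemma exists_stability_const {k : ℕ} (hk : 1 ≤ k) {Λ W σ T : ℝ} (hΛ : 0 ≤ Λ) (hW : 0 ≤ W)
    (hσ : 0 ≤ σ) :
    ∃ C, 0 ≤ C ∧ ∀ (N : ℕ) (x : Mesh N) (α : ℝ → ℝ) (s A : Fin N → Fin (k + 2) → ℝ)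
      (ζ ζ' : ℝ → Fin N → ℝ[X]) (ρ : ℝ), α 0 = α (2 * Real.pi) →
      (∀ y ∈ Icc 0 (2 * Real.pi), ∀ z ∈ Icc 0 (2 * Real.pi), |α y - α z| ≤ Λ * |y - z|) →
      x.ShapeRegular σ →
      (∀ i, IsElementRule W (2 * Λ * x.size) (α (x.left i)) (s i) (A i)) →
      (∀ t ∈ Icc 0 T, ∀ i, (ζ t i).natDegree ≤ k) →
      (∀ t ∈ Icc 0 T, ∀ i, (ζ' t i).natDegree ≤ k) →
      (∀ t ∈ Icc 0 T, ∀ i m,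
        HasDerivWithinAt (fun τ => (ζ τ i).coeff m) ((ζ' t i).coeff m) (Icc 0 T) t) →
      (∀ t ∈ Icc 0 T, ∀ i, ∀ j : Fin (k + 1), Real.sqrt (elemWeight α x i) *
        |(∫ y in (x.pt s i j.castSucc)..(x.pt s i j.succ), (ζ' t i).eval y) +
          flux α x s (ζ t) i j.succ - flux α x s (ζ t) i j.castSucc| ≤ ρ * x.size) →
      ∀ t ∈ Icc 0 T, weightedNorm α x (ζ t) ^ 2 ≤ C * (weightedNorm α x (ζ 0) ^ 2 + ρ ^ 2) := by
  obtain ⟨K, hK1, hK⟩ := exists_inverse_const k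
  have hK0 : 0 ≤ K := zero_le_one.trans hK1
  obtain ⟨Cf, hCf0, hCf⟩ := neg_sum_fluxPairing_le hk hΛ hW
  set Cw := (k + 1) * ((1 + (k + 2) * W) * K) with hCw
  have hCw0 : 0 ≤ Cw := by positivity
  -- The factor `2 * σ` passes from `h` times the squared reference norms to the energy; `σ * (2 *
  -- π)` bounds `h` times the number of elements.
  set G := 2 * (Cw + Cf) * (2 * σ) + 2 * Cw * (σ * (2 * Real.pi)) with hG
  have hpi := Real.pi_pos
  have hG0 : 0 ≤ G := by positivity
  set κ := 2 + (k + 2) * W with hκ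
  have hκ0 : 0 ≤ κ := by positivity
  refine ⟨Real.exp (G * |T|) * (1 + κ * K ^ 2), by positivity,
    fun N x α s A ζ ζ' ρ hper hlip hreg hrule hdeg hdeg' hder hres => ?_⟩
  set h := x.size with hh
  have hh0 : 0 < h := x.size_pos
  let Z : ℝ → Fin N → ℝ[X] := fun t => refFun x (ζ t)
  let Z' : ℝ → Fin N → ℝ[X] := fun t => refFun x (ζ' t)
  let n : ℝ → Fin N → ℝ := fun t i => refNorm (Z t i)
  let r : Fin N → ℝ := fun i => Real.sqrt (elemWeight α x i)
  let κi : Fin N → ℝ := fun i => massDefect (s i) (A i)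
  have hr2 : ∀ i, r i ^ 2 = elemWeight α x i := fun i => Real.sq_sqrt (elemWeight_nonneg α x i)
  have hr0 : ∀ i, 0 ≤ r i := fun i => Real.sqrt_nonneg _
  have hκi0 : ∀ i, 0 ≤ κi i := fun i => massDefect_nonneg (hrule i).quadrature
  have hκile : ∀ i, κi i ≤ κ := fun i => massDefect_le (hrule i).partition (hrule i).weight_le
  -- The energy is built on the mass form since this is what testing the scheme produces. It is
  -- equivalent to the squared weighted norm, the top coefficient being controlled by the reference
  -- norm.
  let E : ℝ → ℝ := fun t => ∑ i, elemWeight α x i * (x.len i / 2 * massForm k (κi i) (Z t i) (Z t i))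
  let E' : ℝ → ℝ := fun t =>
    ∑ i, elemWeight α x i * (x.len i / 2 * (2 * massForm k (κi i) (Z' t i) (Z t i)))
  have hEder : ∀ t ∈ Icc 0 T, HasDerivWithinAt E (E' t) (Icc 0 T) t := fun t ht => by
    refine HasDerivWithinAt.fun_sum fun i _ => ((HasDerivWithinAt.const_mul _ ?_).const_mul _)
    have hb := hasDerivWithinAt_bilinear
      ((massForm k (κi i)).compl₁₂ (pullₗ (x.left i) (x.right i)) (pullₗ (x.left i) (x.right i)))
      (fun τ hτ => hdeg τ hτ i) (hdeg' t ht i) ht (hder t ht i)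
    simp only [LinearMap.compl₁₂_apply, pullₗ_apply] at hb
    rw [massForm_comm k _ (pull _ _ (ζ t i)), ← two_mul] at hb
    exact hb
  have hElow : ∀ t, weightedNorm α x (ζ t) ^ 2 ≤ E t := fun t => by
    rw [weightedNorm_sq]
    refine Finset.sum_le_sum fun i _ => mul_le_mul_of_nonneg_left
      (mul_le_mul_of_nonneg_left (refNorm_sq_le_massForm (hκi0 i) _)
        (by have := (x.len_pos i).le; positivity)) (elemWeight_nonneg α x i)
  have hEup : ∀ t ∈ Icc 0 T, E t ≤ (1 + κ * K ^ 2) * weightedNorm α x (ζ t) ^ 2 := fun t ht => by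
    rw [weightedNorm_sq, Finset.mul_sum]
    refine Finset.sum_le_sum fun i _ => ?_
    have hc := (hK (Z t i) ((natDegree_pull_le _).trans (hdeg t ht i))).1 k
    have hm : massForm k (κi i) (Z t i) (Z t i) ≤ (1 + κ * K ^ 2) * refNorm (Z t i) ^ 2 := by
      rw [massForm_apply, ← refNorm_sq, ← sq]
      have h1 : (Z t i).coeff k ^ 2 ≤ (K * refNorm (Z t i)) ^ 2 :=
        sq_le_sq' (by linarith [(abs_le.1 hc).1]) ((le_abs_self _).trans hc)
      have h2 := mul_le_mul (hκile i) h1 (sq_nonneg _) hκ0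
      linarith
    have hl := (x.len_pos i).le
    calc elemWeight α x i * (x.len i / 2 * massForm k (κi i) (Z t i) (Z t i))
        ≤ elemWeight α x i * (x.len i / 2 * ((1 + κ * K ^ 2) * refNorm (Z t i) ^ 2)) :=
          mul_le_mul_of_nonneg_left (mul_le_mul_of_nonneg_left hm (by positivity))
            (elemWeight_nonneg α x i)
      _ = _ := by ring
  have hEderle : ∀ t ∈ Icc 0 T, E' t ≤ G * (E t + ρ ^ 2) := fun t ht => by
    have hflux := hCf N x α s A (ζ t) hper hlip hrule (hdeg t ht)
    set S := ∑ i, elemWeight α x i * refNorm (refFun x (ζ t) i) ^ 2 with hS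
    have hterm : ∀ i, elemWeight α x i * (x.len i / 2 * (2 * massForm k (κi i) (Z' t i) (Z t i))) ≤
        2 * (Cw * h * (elemWeight α x i * n t i ^ 2 + ρ ^ 2)) -
        2 * (elemWeight α x i * fluxPairing (s i) (A i) (refFun x (ζ t) i) (flux α x s (ζ t) i)) :=
      fun i => by
      have hZd : (Z t i).natDegree ≤ k := (natDegree_pull_le _).trans (hdeg t ht i)
      have hZd' : (Z' t i).natDegree ≤ k := (natDegree_pull_le _).trans (hdeg' t ht i)
      obtain ⟨c, hc, hcF⟩ := exists_test_function hk (hrule i).quadrature (hrule i).partition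
        (hrule i).weight_le hZd (hK _ hZd).2
      have hprim := fluxPairing_primitive hk (hrule i).quadrature (hrule i).partition hZd' hZd
      let F : Fin (k + 2) → ℝ := fun l => ∫ s in (-1 : ℝ)..s i l, (Z' t i).eval s
      have hFdiff : ∀ j : Fin (k + 1), x.len i / 2 * (F j.succ - F j.castSucc) =
          ∫ y in (x.pt s i j.castSucc)..(x.pt s i j.succ), (ζ' t i).eval y := fun j => by
        have hi : ∀ a b : ℝ, IntervalIntegrable (fun s => (Z' t i).eval s) volume a b :=
          fun a b => (Z' t i).continuous.intervalIntegrable a b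
        simp only [F]
        rw [intervalIntegral.integral_interval_sub_left (hi _ _) (hi _ _), pt_eq_elemMap,
          pt_eq_elemMap, ← integral_elemMap, Mesh.len]
        simp only [Z', refFun, eval_pull]
      -- The residual is tested with the step function of `Z`: its time derivative part yields the
      -- mass form and its fluxes the flux pairing.
      have hsum : x.len i / 2 * massForm k (κi i) (Z' t i) (Z t i) =
          ∑ j, c j * ((∫ y in (x.pt s i j.castSucc)..(x.pt s i j.succ), (ζ' t i).eval y) +
            flux α x s (ζ t) i j.succ - flux α x s (ζ t) i j.castSucc) -
          fluxPairing (s i) (A i) (refFun x (ζ t) i) (flux α x s (ζ t) i) := by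
        rw [← hprim, ← hcF F, ← hcF (flux α x s (ζ t) i), Finset.mul_sum, ← Finset.sum_sub_distrib]
        refine Finset.sum_congr rfl fun j _ => ?_
        rw [← hFdiff j]
        ring
      have hres' : elemWeight α x i *
          ∑ j, c j * ((∫ y in (x.pt s i j.castSucc)..(x.pt s i j.succ), (ζ' t i).eval y) +
            flux α x s (ζ t) i j.succ - flux α x s (ζ t) i j.castSucc) ≤
          Cw * h * (elemWeight α x i * n t i ^ 2 + ρ ^ 2) := by
        rw [← hr2, Finset.mul_sum]
        have hn0 : 0 ≤ n t i := refNorm_nonneg _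
        have hρh : 0 ≤ ρ * h := le_trans (mul_nonneg (hr0 i) (abs_nonneg _)) (hres t ht i 0)
        calc _ ≤ ∑ _j : Fin (k + 1), r i * ((1 + (k + 2) * W) * (K * n t i)) * (ρ * h) := by
              refine Finset.sum_le_sum fun j _ => ?_
              refine (le_abs_self _).trans ?_
              rw [abs_mul, abs_mul, abs_of_nonneg (sq_nonneg _)]
              have h1 := mul_le_mul (mul_le_mul_of_nonneg_left (hc j) (hr0 i)) (hres t ht i j)
                (mul_nonneg (hr0 i) (abs_nonneg _)) (by have := hr0 i; positivity)
              refine le_trans (le_of_eq ?_) h1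
              ring
          _ = Cw * h * ((r i * n t i) * ρ) := by
              rw [Finset.sum_const, Finset.card_univ, Fintype.card_fin, nsmul_eq_mul, hCw]
              push_cast
              ring
          _ ≤ _ := by
              refine mul_le_mul_of_nonneg_left ?_ (by positivity)
              have h1 := two_mul_le_add_sq (r i * n t i) ρ
              rw [← mul_pow]
              have h2 := sq_nonneg (r i * n t i)
              have h3 := sq_nonneg ρ
              linarith
      have e1 : elemWeight α x i * (x.len i / 2 * (2 * massForm k (κi i) (Z' t i) (Z t i))) =
          2 * (elemWeight α x i * (x.len i / 2 * massForm k (κi i) (Z' t i) (Z t i))) := by ring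
      rw [e1, hsum, mul_sub]
      linarith
    have htot : E' t ≤ 2 * (Cw * h * (S + N * ρ ^ 2)) + 2 * (Cf * h * S) := by
      refine (Finset.sum_le_sum fun i _ => hterm i).trans ?_
      rw [Finset.sum_sub_distrib, ← Finset.mul_sum, ← Finset.mul_sum, ← Finset.mul_sum,
        Finset.sum_add_distrib, Finset.sum_const, Finset.card_univ, Fintype.card_fin, nsmul_eq_mul]
      have : ∑ i, elemWeight α x i * n t i ^ 2 = S := rfl
      rw [this]
      linarith
    have hhS : h * S ≤ 2 * σ * E t := by
      have h1 : E t ≥ ∑ i, elemWeight α x i * (x.len i / 2 * refNorm (refFun x (ζ t) i) ^ 2) := by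
        rw [← weightedNorm_sq]; exact hElow t
      have h2 : h * S ≤ 2 * σ *
          ∑ i, elemWeight α x i * (x.len i / 2 * refNorm (refFun x (ζ t) i) ^ 2) := by
        rw [hS, Finset.mul_sum, Finset.mul_sum]
        refine Finset.sum_le_sum fun i _ => ?_
        have h3 := mul_le_mul_of_nonneg_right (hreg i)
          (mul_nonneg (elemWeight_nonneg α x i) (sq_nonneg (refNorm (refFun x (ζ t) i))))
        linarith
      exact h2.trans (mul_le_mul_of_nonneg_left h1 (by positivity))
    -- By shape regularity each `h` is at most `σ` times an element length, so the `N` equal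
    -- residual contributions stay bounded.
    have hhN : h * N ≤ σ * (2 * Real.pi) := by
      rw [← x.sum_len, Finset.mul_sum]
      have : h * N = ∑ _i : Fin N, h := by
        rw [Finset.sum_const, Finset.card_univ, Fintype.card_fin, nsmul_eq_mul, mul_comm]
      rw [this]
      exact Finset.sum_le_sum fun i _ => hreg i
    have hE0 : 0 ≤ E t := (sq_nonneg _).trans (hElow t)
    have h4 : 2 * (Cw + Cf) * (h * S) ≤ 2 * (Cw + Cf) * (2 * σ * E t) :=
      mul_le_mul_of_nonneg_left hhS (by positivity)
    have h5 : 2 * Cw * (h * N) * ρ ^ 2 ≤ 2 * Cw * (σ * (2 * Real.pi)) * ρ ^ 2 :=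
      mul_le_mul_of_nonneg_right (mul_le_mul_of_nonneg_left hhN (by positivity)) (sq_nonneg ρ)
    have h6 : 0 ≤ 2 * (Cw + Cf) * (2 * σ) * ρ ^ 2 := by positivity
    have h7 : 0 ≤ 2 * Cw * (σ * (2 * Real.pi)) * E t := by positivity
    rw [hG]
    linarith
  intro t ht
  -- Adding the constant `ρ ^ 2` to the energy makes the differential inequality homogeneous.
  have hgr := le_exp_mul_of_deriv_le (f := fun t => E t + ρ ^ 2) (C := G)
    (fun t ht => (hEder t ht).add_const _) hEderle ht
  have h0 : (0 : ℝ) ∈ Icc 0 T := ⟨le_rfl, ht.1.trans ht.2⟩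
  have hexp : Real.exp (G * t) ≤ Real.exp (G * |T|) :=
    Real.exp_le_exp.2 (mul_le_mul_of_nonneg_left (ht.2.trans (le_abs_self T)) hG0)
  have hE00 := hEup 0 h0
  have hρ2 := sq_nonneg ρ
  have hκK : 0 ≤ κ * K ^ 2 := by positivity
  have h8 : E 0 + ρ ^ 2 ≤ (1 + κ * K ^ 2) * (weightedNorm α x (ζ 0) ^ 2 + ρ ^ 2) := by
    have := mul_nonneg hκK hρ2
    linarith
  have h9 : 0 ≤ E 0 + ρ ^ 2 := add_nonneg ((sq_nonneg _).trans (hElow 0)) hρ2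
  calc weightedNorm α x (ζ t) ^ 2 ≤ E t + ρ ^ 2 := by linarith [hElow t]
    _ ≤ Real.exp (G * t) * (E 0 + ρ ^ 2) := hgr
    _ ≤ Real.exp (G * |T|) * ((1 + κ * K ^ 2) * (weightedNorm α x (ζ 0) ^ 2 + ρ ^ 2)) :=
        mul_le_mul hexp h8 h9 (Real.exp_pos _).le
    _ = _ := by ring

/-! ### The corrected interpolant -/

section

variable {N k : ℕ} {α : ℝ → ℝ} {x : Mesh N} {s A : Fin N → Fin (k + 2) → ℝ} {Λ W : ℝ}

/-- The omitted point of the element `i`. -/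
def omitIdx (k : ℕ) (α : ℝ → ℝ) (x : Mesh N) (i : Fin N) : Fin (k + 2) :=
  omitted k (α (x.left i)) (α (x.right i))

/-- The nodal polynomial of the interpolation points of the element `i`. -/
def nodalPoly (α : ℝ → ℝ) (x : Mesh N) (s : Fin N → Fin (k + 2) → ℝ) (i : Fin N) : ℝ[X] :=
  elemNodal (s i) (x.left i) (x.right i) (omitIdx k α x i)

open Classical in
/-- The correction of the interpolant in an element, for the interpolation error `nodalPoly`; there
is none where the coefficient is degenerate. -/
def correction (Λ : ℝ) (α : ℝ → ℝ) (x : Mesh N) (s : Fin N → Fin (k + 2) → ℝ) (i : Fin N) :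
    ℝ[X] :=
  if 2 * Λ * x.size < |α (x.left i)| then
    elemInterp (s i) (x.left i) (x.right i) (omitIdx k α x i)
      (fun y => (∫ z in (x.left i)..y, (nodalPoly α x s i).eval z) / α y)
  else 0

/-- The interpolant of `φ`, corrected by the multiples `c i` of `correction`. -/
def correctedInterp (Λ : ℝ) (α : ℝ → ℝ) (x : Mesh N) (s : Fin N → Fin (k + 2) → ℝ)
    (φ : ℝ → ℝ) (c : Fin N → ℝ) (i : Fin N) : ℝ[X] :=
  interp α x s φ i + C (c i) * correction Λ α x s i

lemma interp_eq_elemInterp (φ : ℝ → ℝ) (i : Fin N) : interp α x s φ i =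
    elemInterp (s i) (x.left i) (x.right i) (omitIdx k α x i) φ := rfl

/-- Together with `omitIdx_ne_zero` this says that an end point at which the element supplies the
upwind value with `α ≠ 0` is an interpolation node. -/
lemma omitIdx_ne_last {i : Fin N} (h : 0 < α (x.right i)) : omitIdx k α x i ≠ Fin.last (k + 1) := by
  rw [omitIdx, omitted]
  split_ifs with h1 h2
  · exact (Fin.last_pos).ne
  · exact absurd h2.2 h.not_gt
  · exact (Fin.castSucc_lt_last _).ne

lemma omitIdx_ne_zero (hk : 1 ≤ k) {i : Fin N} (h : α (x.left i) < 0) : omitIdx k α x i ≠ 0 := by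
  rw [omitIdx, omitted]
  split_ifs with h1 h2
  · exact absurd h1.1 h.not_ge
  · exact (Fin.last_pos).ne'
  · rw [Ne, Fin.ext_iff]
    simp only [Fin.val_castSucc, Fin.val_last, Fin.val_zero]
    omega

variable (hα : Reg (Icc 0 (2 * Real.pi)) 0 Λ α)
include hα

lemma coeff_bound_nonneg : 0 ≤ Λ :=
  (abs_nonneg _).trans (hα.1 0 ⟨le_rfl, Real.two_pi_pos.le⟩)

lemma abs_coeff_sub_left_le (i : Fin N) {y : ℝ} (hy : y ∈ Icc (x.left i) (x.right i)) :
    |α y - α (x.left i)| ≤ Λ * x.size := by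
  refine (hα.2 y (x.Icc_subset i hy) _ (x.left_mem i)).trans
    (mul_le_mul_of_nonneg_left ?_ (coeff_bound_nonneg hα))
  rw [abs_of_nonneg (sub_nonneg.2 hy.1)]
  refine le_trans ?_ (x.len_le_size i)
  rw [Mesh.len]
  linarith [hy.2]

/-- Beyond the threshold the variation `Λh` of `α` over the element is less than half its value at
the left end, so `α` keeps its sign and its size. -/
lemma coeff_ge_of_far {i : Fin N} (h : 2 * Λ * x.size < α (x.left i)) {y : ℝ}
    (hy : y ∈ Icc (x.left i) (x.right i)) : α (x.left i) / 2 < α y := by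
  have := abs_le.1 (abs_coeff_sub_left_le hα i hy)
  linarith [this.1]

lemma coeff_le_of_far {i : Fin N} (h : α (x.left i) < -(2 * Λ * x.size)) {y : ℝ}
    (hy : y ∈ Icc (x.left i) (x.right i)) : α y < α (x.left i) / 2 := by
  have := abs_le.1 (abs_coeff_sub_left_le hα i hy)
  linarith [this.2]

lemma threshold_nonneg : 0 ≤ 2 * Λ * x.size :=
  mul_nonneg (mul_nonneg zero_le_two (coeff_bound_nonneg hα)) x.size_pos.le

lemma abs_coeff_ge_of_far {i : Fin N} (h : 2 * Λ * x.size < |α (x.left i)|) {y : ℝ}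
    (hy : y ∈ Icc (x.left i) (x.right i)) : |α (x.left i)| / 2 ≤ |α y| := by
  have h0 := threshold_nonneg (x := x) hα
  rcases lt_abs.1 h with h1 | h1
  · rw [abs_of_pos (h0.trans_lt h1)]
    exact (coeff_ge_of_far hα h1 hy).le.trans (le_abs_self _)
  · have h2 : α (x.left i) < -(2 * Λ * x.size) := by linarith
    rw [abs_of_neg (by linarith)]
    have := coeff_le_of_far hα h2 hy
    linarith [neg_abs_le (α y)]

lemma sqrt_elemWeight_le_of_far {i : Fin N} (h : 2 * Λ * x.size < |α (x.left i)|) :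
    Real.sqrt (elemWeight α x i) ≤ 3 * |α (x.left i)| := by
  have h0 := threshold_nonneg (x := x) hα
  have h1 := abs_le.1 (abs_coeff_sub_left_le hα i (right_mem_Icc.2 (x.left_lt_right i).le))
  have h2 := neg_abs_le (α (x.left i))
  have h3 := le_abs_self (α (x.left i))
  have h4 : α (x.right i) ^ 2 ≤ (2 * |α (x.left i)|) ^ 2 := sq_le_sq' (by linarith) (by linarith)
  refine Real.sqrt_le_iff.2 ⟨by positivity, ?_⟩
  rw [elemWeight, ← sq_abs (α (x.left i))]
  linarith [sq_nonneg |α (x.left i)|]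

lemma sqrt_elemWeight_le_of_near {i : Fin N} (h : |α (x.left i)| ≤ 2 * Λ * x.size) :
    Real.sqrt (elemWeight α x i) ≤ 5 * Λ * x.size := by
  have h0 : 0 ≤ Λ * x.size := mul_nonneg (coeff_bound_nonneg hα) x.size_pos.le
  have h1 := abs_le.1 (abs_coeff_sub_left_le hα i (right_mem_Icc.2 (x.left_lt_right i).le))
  have h2 := abs_le.1 h
  have h3 : α (x.left i) ^ 2 ≤ (2 * Λ * x.size) ^ 2 := sq_le_sq' h2.1 h2.2
  have h4 : α (x.right i) ^ 2 ≤ (3 * Λ * x.size) ^ 2 := sq_le_sq' (by linarith) (by linarith)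
  refine Real.sqrt_le_iff.2 ⟨by linarith, ?_⟩
  rw [elemWeight]
  linarith [sq_nonneg (Λ * x.size)]

variable (hrule : ∀ i, IsElementRule W (2 * Λ * x.size) (α (x.left i)) (s i) (A i))
include hrule

/-- As `α` keeps its sign, the omitted point is the end that receives its value from the neighbour,
and the moment condition of the adapted rule concerns precisely the remaining nodes. -/
lemma omitIdx_of_far {i : Fin N} (h : 2 * Λ * x.size < |α (x.left i)|) :
    (∫ y in (x.left i)..(x.right i), (nodalPoly α x s i).eval y = 0) ∧
      (omitIdx k α x i = 0 ∨ omitIdx k α x i = Fin.last (k + 1)) := by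
  have h0 := threshold_nonneg (x := x) hα
  rcases lt_abs.1 h with h1 | h1
  · have h2 := coeff_ge_of_far hα h1 (right_mem_Icc.2 (x.left_lt_right i).le)
    have ho : omitIdx k α x i = 0 := by
      rw [omitIdx, omitted, if_pos ⟨by linarith, by linarith⟩]
    refine ⟨?_, Or.inl ho⟩
    rw [nodalPoly, integral_elemNodal, ho, ((hrule i).right h1).2, mul_zero]
  · have h1' : α (x.left i) < -(2 * Λ * x.size) := by linarith
    have h2 := coeff_le_of_far hα h1' (right_mem_Icc.2 (x.left_lt_right i).le)
    have ho : omitIdx k α x i = Fin.last (k + 1) := by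
      rw [omitIdx, omitted, if_neg fun hc => absurd hc.1 (by linarith),
        if_pos ⟨by linarith, by linarith⟩]
    refine ⟨?_, Or.inr ho⟩
    rw [nodalPoly, integral_elemNodal, ho, ((hrule i).left h1').2, mul_zero]

omit hα in
lemma natDegree_correction_le (i : Fin N) : (correction Λ α x s i).natDegree ≤ k := by
  rw [correction]
  split_ifs
  · exact natDegree_elemInterp_le (hrule i).partition (x.left_lt_right i) _ _
  · simp

omit hα in
lemma eval_correction_of_far {i : Fin N} (h : 2 * Λ * x.size < |α (x.left i)|) {l : Fin (k + 2)}
    (hl : l ≠ omitIdx k α x i) : (correction Λ α x s i).eval (x.pt s i l) =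
      (∫ z in (x.left i)..(x.pt s i l), (nodalPoly α x s i).eval z) / α (x.pt s i l) := by
  rw [correction, if_pos h, pt_eq_elemMap,
    eval_elemInterp (hrule i).partition (x.left_lt_right i) hl]

omit hα in
lemma abs_integral_nodalPoly_le (i : Fin N) {y : ℝ} (hy : y ∈ Icc (x.left i) (x.right i)) :
    |∫ z in (x.left i)..y, (nodalPoly α x s i).eval z| ≤ x.size ^ (k + 2) := by
  have h := intervalIntegral.norm_integral_le_of_norm_le_const (a := x.left i) (b := y)
    (f := fun z => (nodalPoly α x s i).eval z) (C := x.size ^ (k + 1)) fun z hz => by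
      rw [uIoc_of_le hy.1] at hz
      refine (abs_eval_elemNodal_le (hrule i).partition (x.left_lt_right i).le _
        ⟨hz.1.le, hz.2.trans hy.2⟩).trans ?_
      exact pow_le_pow_left₀ (x.len_pos i).le (x.len_le_size i) _
  refine h.trans ?_
  rw [abs_of_nonneg (sub_nonneg.2 hy.1), pow_succ x.size (k + 1)]
  refine mul_le_mul_of_nonneg_left ?_ (pow_nonneg x.size_pos.le _)
  refine le_trans ?_ (x.len_le_size i)
  rw [Mesh.len]
  linarith [hy.2]

/-- This is where the weight pays off: `correction` interpolates a function of size `h^{k+2} / |α|`,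
and `|α|` is comparable to the square root of the weight beyond the threshold. -/
lemma sqrt_elemWeight_mul_correction_le (i : Fin N) {y : ℝ}
    (hy : y ∈ Icc (x.left i) (x.right i)) :
    Real.sqrt (elemWeight α x i) * |(correction Λ α x s i).eval y| ≤
      6 * W * x.size ^ (k + 2) := by
  have hh := x.size_pos
  have hW : 0 ≤ W := (abs_nonneg _).trans ((hrule i).weight_le 0)
  by_cases h : 2 * Λ * x.size < |α (x.left i)|
  · have ha : 0 < |α (x.left i)| := (threshold_nonneg (x := x) hα).trans_lt h
    have h1 : |(correction Λ α x s i).eval y| ≤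
        W * (x.size ^ (k + 2) / (|α (x.left i)| / 2)) := by
      rw [correction, if_pos h]
      refine abs_eval_elemInterp_le (hrule i).lebesgue (hrule i).partition (x.left_lt_right i) _
        (fun l => ?_) hy
      rw [abs_div]
      have hl := pt_mem (x := x) (hrule i).partition l
      exact div_le_div₀ (by positivity) (abs_integral_nodalPoly_le hrule i hl) (by positivity)
        (abs_coeff_ge_of_far hα h hl)
    calc _ ≤ 3 * |α (x.left i)| * (W * (x.size ^ (k + 2) / (|α (x.left i)| / 2))) :=
          mul_le_mul (sqrt_elemWeight_le_of_far hα h) h1 (abs_nonneg _) (by positivity)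
      _ = _ := by field_simp; ring
  · rw [correction, if_neg h, eval_zero, abs_zero, mul_zero]
    positivity

/-- The upwind end is a node, and the correction vanishes there: at the left end the primitive
starts from zero, at the right end it is the vanishing integral of the nodal polynomial. If `α` is
zero at the interface the upwind value plays no role. -/
lemma coeff_mul_upwind_correctedInterp (hk : 1 ≤ k) (hper : α 0 = α (2 * Real.pi)) {φ : ℝ → ℝ}
    (hφ : φ 0 = φ (2 * Real.pi)) (c : Fin N → ℝ) (i : Fin N) :
    α (x.right i) * upwind α x (correctedInterp Λ α x s φ c) i =
      α (x.right i) * φ (x.right i) := by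
  have h0 := threshold_nonneg (x := x) hα
  rcases lt_trichotomy (α (x.right i)) 0 with hneg | hzero | hpos
  · rw [upwind, if_neg hneg.not_gt]
    have hp := (hrule (finRotate N i)).partition
    have hl : α (x.left (finRotate N i)) < 0 := by rwa [x.periodic hper]
    have ho := (omitIdx_ne_zero hk hl).symm
    have e1 : (interp α x s φ (finRotate N i)).eval (x.left (finRotate N i)) =
        φ (x.right i) := by
      rw [← x.periodic hφ i, ← pt_zero hp, interp_eq_elemInterp]
      exact eval_elemInterp hp (x.left_lt_right _) ho φ
    have e2 : (correction Λ α x s (finRotate N i)).eval (x.left (finRotate N i)) = 0 := by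
      by_cases h : 2 * Λ * x.size < |α (x.left (finRotate N i))|
      · have := eval_correction_of_far hrule h ho
        rwa [pt_zero hp, intervalIntegral.integral_same, zero_div] at this
      · rw [correction, if_neg h, eval_zero]
    rw [correctedInterp, eval_add, eval_mul, e1, e2, mul_zero, add_zero]
  · rw [hzero, zero_mul, zero_mul]
  · rw [upwind, if_pos hpos]
    have hp := (hrule i).partition
    have ho := (omitIdx_ne_last (k := k) hpos).symm
    have e1 : (interp α x s φ i).eval (x.right i) = φ (x.right i) := by
      rw [← pt_last hp, interp_eq_elemInterp]
      exact eval_elemInterp hp (x.left_lt_right _) ho φ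
    have e2 : (correction Λ α x s i).eval (x.right i) = 0 := by
      by_cases h : 2 * Λ * x.size < |α (x.left i)|
      · have := eval_correction_of_far hrule h ho
        rwa [pt_last hp, (omitIdx_of_far hα hrule h).1, zero_div] at this
      · rw [correction, if_neg h, eval_zero]
    rw [correctedInterp, eval_add, eval_mul, e1, e2, mul_zero, add_zero]

lemma flux_correctedInterp_last (hk : 1 ≤ k) (hper : α 0 = α (2 * Real.pi)) {φ : ℝ → ℝ}
    (hφ : φ 0 = φ (2 * Real.pi)) (c : Fin N → ℝ) (i : Fin N) :
    flux α x s (correctedInterp Λ α x s φ c) i (Fin.last (k + 1)) =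
      α (x.right i) * φ (x.right i) := by
  rw [flux_last, coeff_mul_upwind_correctedInterp hα hrule hk hper hφ]

lemma flux_correctedInterp_zero (hk : 1 ≤ k) (hper : α 0 = α (2 * Real.pi)) {φ : ℝ → ℝ}
    (hφ : φ 0 = φ (2 * Real.pi)) (c : Fin N → ℝ) (i : Fin N) :
    flux α x s (correctedInterp Λ α x s φ c) i 0 = α (x.left i) * φ (x.left i) := by
  have h1 := x.periodic hper ((finRotate N).symm i)
  have h2 := x.periodic hφ ((finRotate N).symm i)
  rw [Equiv.apply_symm_apply] at h1 h2
  rw [flux_zero, h1, h2, coeff_mul_upwind_correctedInterp hα hrule hk hper hφ]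

/-- The omitted point is an end, so all interior points are nodes; there the interpolant is exact
and `α` times the correction is the primitive of the nodal polynomial. At both ends the two sides
vanish. -/
lemma flux_error_of_far (hk : 1 ≤ k) (hper : α 0 = α (2 * Real.pi)) {φ : ℝ → ℝ}
    (hφ : φ 0 = φ (2 * Real.pi)) (c : Fin N → ℝ) {i : Fin N}
    (h : 2 * Λ * x.size < |α (x.left i)|) (l : Fin (k + 2)) :
    α (x.pt s i l) * φ (x.pt s i l) - flux α x s (correctedInterp Λ α x s φ c) i l =
      -(c i * ∫ z in (x.left i)..(x.pt s i l), (nodalPoly α x s i).eval z) := by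
  have hp := (hrule i).partition
  obtain ⟨hint, ho⟩ := omitIdx_of_far hα hrule h
  by_cases h0 : l = 0
  · rw [h0, flux_correctedInterp_zero hα hrule hk hper hφ, pt_zero hp,
      intervalIntegral.integral_same]
    ring
  by_cases hl : l = Fin.last (k + 1)
  · rw [hl, flux_correctedInterp_last hα hrule hk hper hφ, pt_last hp, hint]
    ring
  have hlo : l ≠ omitIdx k α x i := by rcases ho with ho | ho <;> rw [ho] <;> assumption
  have hne : α (x.pt s i l) ≠ 0 := by
    have := abs_coeff_ge_of_far hα h (pt_mem hp l)
    have h3 := (threshold_nonneg (x := x) hα).trans_lt h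
    exact abs_pos.1 (by linarith)
  have e1 : (interp α x s φ i).eval (x.pt s i l) = φ (x.pt s i l) := by
    rw [interp_eq_elemInterp]
    exact eval_elemInterp hp (x.left_lt_right _) hlo φ
  rw [flux_interior _ i h0 hl, correctedInterp, eval_add, eval_mul, eval_C, e1,
    eval_correction_of_far hrule h hlo]
  field_simp
  ring

/-- An interior point may be the omitted one, but `|α| ≤ 3Λh` on the element raises the
interpolation error `h^{k+1}` by one order. -/
lemma abs_flux_error_le_of_near (hk : 1 ≤ k) (hper : α 0 = α (2 * Real.pi)) {φ : ℝ → ℝ}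
    (hφ : φ 0 = φ (2 * Real.pi)) (c : Fin N → ℝ) {i : Fin N}
    (h : |α (x.left i)| ≤ 2 * Λ * x.size) {M : ℝ} (hM : 0 ≤ M)
    (hreg : Reg (Icc 0 (2 * Real.pi)) k M φ) (l : Fin (k + 2)) :
    |α (x.pt s i l) * φ (x.pt s i l) - flux α x s (correctedInterp Λ α x s φ c) i l| ≤
      3 * Λ * (1 + W) * (M * x.size ^ (k + 2)) := by
  have hp := (hrule i).partition
  have hh := x.size_pos
  have hΛ := coeff_bound_nonneg hα
  have hW : 0 ≤ W := (abs_nonneg _).trans ((hrule i).weight_le 0)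
  have hnn : 0 ≤ 3 * Λ * (1 + W) * (M * x.size ^ (k + 2)) := by positivity
  by_cases h0 : l = 0
  · rw [h0, flux_correctedInterp_zero hα hrule hk hper hφ, pt_zero hp, sub_self, abs_zero]
    exact hnn
  by_cases hl : l = Fin.last (k + 1)
  · rw [hl, flux_correctedInterp_last hα hrule hk hper hφ, pt_last hp, sub_self, abs_zero]
    exact hnn
  have hmem := pt_mem (x := x) hp l
  rw [flux_interior _ i h0 hl, correctedInterp, correction, if_neg h.not_gt, mul_zero, add_zero,
    ← mul_sub, abs_mul]
  have h1 : |α (x.pt s i l)| ≤ 3 * Λ * x.size := by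
    have h2 := abs_le.1 (abs_coeff_sub_left_le hα i hmem)
    have h3 := abs_le.1 h
    exact abs_le.2 ⟨by linarith, by linarith⟩
  have h2 := abs_interp_error_le_of_reg (hrule i).lebesgue hp (x.left_lt_right i) (x.Icc_subset i)
    (omitIdx k α x i) hreg hmem
  have h3 : (x.right i - x.left i) ^ (k + 1) ≤ x.size ^ (k + 1) :=
    pow_le_pow_left₀ (x.len_pos i).le (x.len_le_size i) _
  calc _ ≤ 3 * Λ * x.size * ((1 + W) * (M * x.size ^ (k + 1))) :=
        mul_le_mul h1 (h2.trans (by gcongr)) (abs_nonneg _) (by positivity)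
    _ = _ := by ring

/-- Bound of the residual of the corrected interpolant in the scheme. -/
lemma abs_residual_le (hk : 1 ≤ k) (hper : α 0 = α (2 * Real.pi)) {φ G D : ℝ → ℝ} {M : ℝ}
    (hM : 0 ≤ M) (hφ : φ 0 = φ (2 * Real.pi))
    (hder : ∀ y ∈ Icc 0 (2 * Real.pi),
      HasDerivWithinAt (fun z => α z * φ z) (G y - D y) (Icc 0 (2 * Real.pi)) y)
    (hregφ : Reg (Icc 0 (2 * Real.pi)) (k + 2) M φ)
    (hregF : Reg (Icc 0 (2 * Real.pi)) (k + 2) M (fun y => α y * φ y))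
    (hregG : Reg (Icc 0 (2 * Real.pi)) (k + 1) M G)
    (hregD : Reg (Icc 0 (2 * Real.pi)) (k + 1) M D) {c c' : Fin N → ℝ}
    (hc : ∀ i, c i = leadCoeff k (x.left i) (x.right i) G (fun y => α y * φ y))
    (hc' : ∀ i, |c' i| ≤ leadConst k * M) (i : Fin N) (j : Fin (k + 1)) :
    Real.sqrt (elemWeight α x i) *
      |(∫ y in (x.pt s i j.castSucc)..(x.pt s i j.succ), G y) -
        (∫ y in (x.pt s i j.castSucc)..(x.pt s i j.succ),
          (correctedInterp Λ α x s D c' i).eval y) -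
        flux α x s (correctedInterp Λ α x s φ c) i j.succ +
        flux α x s (correctedInterp Λ α x s φ c) i j.castSucc| ≤
      (3 * Λ * (2 * (1 + W) + leadConst k) + 6 * W * leadConst k + 5 * Λ * (1 + W) * (1 + 6 * Λ)) *
        (M * x.size ^ (k + 2)) * x.size := by
  have hconv : Convex ℝ (Icc (0 : ℝ) (2 * Real.pi)) := convex_Icc _ _
  have hp := (hrule i).partition
  have hh := x.size_pos
  have hΛ := coeff_bound_nonneg hα
  have hB := leadConst_nonneg k
  have hW : 0 ≤ W := (abs_nonneg _).trans ((hrule i).weight_le 0)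
  set y₀ := x.pt s i j.castSucc with hy₀
  set y₁ := x.pt s i j.succ with hy₁
  have hm₀ : y₀ ∈ Icc (x.left i) (x.right i) := pt_mem hp _
  have hm₁ : y₁ ∈ Icc (x.left i) (x.right i) := pt_mem hp _
  have hsub : uIcc y₀ y₁ ⊆ Icc (x.left i) (x.right i) := uIcc_subset_Icc hm₀ hm₁
  have hsub' : uIoc y₀ y₁ ⊆ Icc (x.left i) (x.right i) := uIoc_subset_uIcc.trans hsub
  have hlen : |y₁ - y₀| ≤ x.size := by
    refine le_trans ?_ (x.len_le_size i)
    rw [Mesh.len, abs_le]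
    constructor <;> linarith [hm₀.1, hm₀.2, hm₁.1, hm₁.2]
  have hcont : ∀ f : ℝ → ℝ, ContinuousOn f (Icc 0 (2 * Real.pi)) →
      IntervalIntegrable f volume y₀ y₁ := fun f hf =>
    (hf.mono (hsub.trans (x.Icc_subset i))).intervalIntegrable
  have hpoly : ∀ (f : ℝ[X]) (a b : ℝ), IntervalIntegrable (fun y => f.eval y) volume a b :=
    fun f a b => f.continuous.intervalIntegrable a b
  have hGi := hcont G hregG.continuousOn
  have hDi := hcont D hregD.continuousOn
  have hftc : ∫ y in y₀..y₁, (G y - D y) = α y₁ * φ y₁ - α y₀ * φ y₀ := by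
    have hle : y₀ ≤ y₁ := by
      rw [hy₀, hy₁, Mesh.pt, Mesh.pt]
      have h1 := hp.1 (Fin.castSucc_lt_succ (i := j))
      have h2 := mul_le_mul_of_nonneg_left h1.le (half_pos (x.len_pos i)).le
      linarith
    have hs : Icc y₀ y₁ ⊆ Icc 0 (2 * Real.pi) := by
      rw [← uIcc_of_le hle]; exact hsub.trans (x.Icc_subset i)
    refine intervalIntegral.integral_eq_sub_of_hasDerivAt_of_le (f := fun y => α y * φ y) hle
      (hregF.continuousOn.mono hs) (fun y hy => ?_) (hGi.sub hDi)
    exact ((hder y (hs (Ioo_subset_Icc_self hy))).mono hs).hasDerivAt (Icc_mem_nhds hy.1 hy.2)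
  rw [intervalIntegral.integral_sub hGi hDi] at hftc
  set q := correction Λ α x s i with hq
  have hsplit : ∫ y in y₀..y₁, (correctedInterp Λ α x s D c' i).eval y =
      (∫ y in y₀..y₁, (interp α x s D i).eval y) + c' i * ∫ y in y₀..y₁, q.eval y := by
    simp only [correctedInterp, eval_add, eval_mul, eval_C]
    rw [intervalIntegral.integral_add (hpoly _ _ _) ((hpoly _ _ _).const_mul _),
      intervalIntegral.integral_const_mul]
  set F : Fin (k + 2) → ℝ := fun l => α (x.pt s i l) * φ (x.pt s i l) -
    flux α x s (correctedInterp Λ α x s φ c) i l with hF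
  -- Subtracting the exact balance of the control volume leaves the interpolation error of the time
  -- derivative, the time derivative of the correction and the flux errors.
  have hres : (∫ y in y₀..y₁, G y) - (∫ y in y₀..y₁, (correctedInterp Λ α x s D c' i).eval y) -
        flux α x s (correctedInterp Λ α x s φ c) i j.succ +
        flux α x s (correctedInterp Λ α x s φ c) i j.castSucc =
      ((∫ y in y₀..y₁, D y) - ∫ y in y₀..y₁, (interp α x s D i).eval y) -
        c' i * (∫ y in y₀..y₁, q.eval y) + F j.succ - F j.castSucc := by
    have e1 : F j.succ = α y₁ * φ y₁ -
      flux α x s (correctedInterp Λ α x s φ c) i j.succ := rfl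
    have e2 : F j.castSucc = α y₀ * φ y₀ -
      flux α x s (correctedInterp Λ α x s φ c) i j.castSucc := rfl
    rw [hsplit, e1, e2]
    linarith
  rw [hres]
  have hMh : 0 ≤ M * x.size ^ (k + 2) := by positivity
  have hr0 : 0 ≤ Real.sqrt (elemWeight α x i) := Real.sqrt_nonneg _
  by_cases hfar : 2 * Λ * x.size < |α (x.left i)|
  · have hFe : ∀ l, F l = -(c i * ∫ z in (x.left i)..(x.pt s i l), (nodalPoly α x s i).eval z) :=
      flux_error_of_far hα hrule hk hper hφ c hfar
    -- The difference of the flux errors is minus the integral of `c i` times the nodal polynomial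
    -- over the control volume, exactly the leading part of the interpolation error of `D`.
    have hcomb : ((∫ y in y₀..y₁, D y) - ∫ y in y₀..y₁, (interp α x s D i).eval y) -
        c' i * (∫ y in y₀..y₁, q.eval y) + F j.succ - F j.castSucc =
        (∫ y in y₀..y₁, (D y - (interp α x s D i).eval y - c i * (nodalPoly α x s i).eval y)) -
          c' i * (∫ y in y₀..y₁, q.eval y) := by
      rw [hFe, hFe, intervalIntegral.integral_sub (hDi.sub (hpoly _ _ _))
        ((hpoly _ _ _).const_mul _), intervalIntegral.integral_sub hDi (hpoly _ _ _),
        intervalIntegral.integral_const_mul,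
        ← intervalIntegral.integral_interval_sub_left (hpoly (nodalPoly α x s i) (x.left i) y₁)
          (hpoly _ _ y₀)]
      ring
    rw [hcomb]
    have hI1 : |∫ y in y₀..y₁,
        (D y - (interp α x s D i).eval y - c i * (nodalPoly α x s i).eval y)| ≤
        (2 * (1 + W) + leadConst k) * (M * x.size ^ (k + 2)) * x.size := by
      refine (intervalIntegral.norm_integral_le_of_norm_le_const (a := y₀) (b := y₁)
        (f := fun y => D y - (interp α x s D i).eval y - c i * (nodalPoly α x s i).eval y)
        (C := (2 * (1 + W) + leadConst k) * (M * x.size ^ (k + 2))) fun y hy => ?_).trans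
        (mul_le_mul_of_nonneg_left hlen (by positivity))
      have h1 := abs_corrected_interp_error_le (hrule i).lebesgue hp (x.left_lt_right i)
        (x.Icc_subset i) (omitIdx k α x i) hregG (hregF.deriv_of_hasDerivWithinAt Real.two_pi_pos hder)
        hder (hsub' hy)
      simp only [sub_sub_cancel] at h1
      rw [hc]
      refine h1.trans ?_
      gcongr
      · exact (x.len_pos i).le
      · exact x.len_le_size i
    have hI2 : Real.sqrt (elemWeight α x i) * |∫ y in y₀..y₁, q.eval y| ≤
        6 * W * x.size ^ (k + 2) * x.size := by
      have h1 := intervalIntegral.norm_integral_le_of_norm_le_const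
        (f := fun y => Real.sqrt (elemWeight α x i) * q.eval y) (a := y₀) (b := y₁)
        (C := 6 * W * x.size ^ (k + 2)) fun y hy => by
          rw [Real.norm_eq_abs, abs_mul, abs_of_nonneg hr0]
          exact sqrt_elemWeight_mul_correction_le hα hrule i (hsub' hy)
      rw [intervalIntegral.integral_const_mul, Real.norm_eq_abs, abs_mul, abs_of_nonneg hr0] at h1
      exact h1.trans (mul_le_mul_of_nonneg_left hlen (by positivity))
    have hr : Real.sqrt (elemWeight α x i) ≤ 3 * Λ :=
      (sqrt_elemWeight_le_of_far hα hfar).trans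
        (mul_le_mul_of_nonneg_left (hα.1 _ (x.left_mem i)) (by norm_num))
    calc _ ≤ Real.sqrt (elemWeight α x i) * (|∫ y in y₀..y₁,
            (D y - (interp α x s D i).eval y - c i * (nodalPoly α x s i).eval y)| +
            |c' i| * |∫ y in y₀..y₁, q.eval y|) := by
          refine mul_le_mul_of_nonneg_left ?_ hr0
          rw [← abs_mul]
          exact abs_sub _ _
      _ = Real.sqrt (elemWeight α x i) * |∫ y in y₀..y₁,
            (D y - (interp α x s D i).eval y - c i * (nodalPoly α x s i).eval y)| +
            |c' i| * (Real.sqrt (elemWeight α x i) * |∫ y in y₀..y₁, q.eval y|) := by ring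
      _ ≤ 3 * Λ * ((2 * (1 + W) + leadConst k) * (M * x.size ^ (k + 2)) * x.size) +
            leadConst k * M * (6 * W * x.size ^ (k + 2) * x.size) :=
          add_le_add (mul_le_mul hr hI1 (abs_nonneg _) (by positivity))
            (mul_le_mul (hc' i) hI2 (by positivity) (by positivity))
      _ ≤ _ := by
          have : 0 ≤ 5 * Λ * (1 + W) * (1 + 6 * Λ) * (M * x.size ^ (k + 2)) * x.size := by positivity
          linarith
  -- Here the residual is only of order `h^{k+2}` instead of `h^{k+3}`; the square root of the
  -- weight, at most `5Λh`, supplies the missing factor.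
  · have hnear := not_lt.1 hfar
    have hq0 : q = 0 := by rw [hq, correction, if_neg hfar]
    have hFe : ∀ l, |F l| ≤ 3 * Λ * (1 + W) * (M * x.size ^ (k + 2)) :=
      abs_flux_error_le_of_near hα hrule hk hper hφ c hnear hM (hregφ.of_le hconv (by omega))
    have hI1 : |(∫ y in y₀..y₁, D y) - ∫ y in y₀..y₁, (interp α x s D i).eval y| ≤
        (1 + W) * (M * x.size ^ (k + 2)) := by
      rw [← intervalIntegral.integral_sub hDi (hpoly _ _ _)]
      have e : (1 + W) * (M * x.size ^ (k + 2)) = (1 + W) * (M * x.size ^ (k + 1)) * x.size := by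
        ring
      rw [e]
      refine (intervalIntegral.norm_integral_le_of_norm_le_const (a := y₀) (b := y₁)
        (f := fun y => D y - (interp α x s D i).eval y)
        (C := (1 + W) * (M * x.size ^ (k + 1))) fun y hy => ?_).trans
        (mul_le_mul_of_nonneg_left hlen (by positivity))
      have h1 := abs_interp_error_le_of_reg (hrule i).lebesgue hp (x.left_lt_right i)
        (x.Icc_subset i) (omitIdx k α x i) (hregD.of_le hconv (Nat.le_succ k)) (hsub' hy)
      refine h1.trans ?_
      gcongr
      · exact (x.len_pos i).le
      · exact x.len_le_size i
    rw [hq0]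
    simp only [eval_zero, intervalIntegral.integral_zero, mul_zero, sub_zero]
    calc _ ≤ 5 * Λ * x.size * ((1 + W) * (M * x.size ^ (k + 2)) +
            3 * Λ * (1 + W) * (M * x.size ^ (k + 2)) +
            3 * Λ * (1 + W) * (M * x.size ^ (k + 2))) := by
          refine mul_le_mul (sqrt_elemWeight_le_of_near hα hnear) ?_ (abs_nonneg _) (by positivity)
          exact (abs_sub _ _).trans (add_le_add ((abs_add_le _ _).trans
            (add_le_add hI1 (hFe _))) (hFe _))
      _ = 5 * Λ * (1 + W) * (1 + 6 * Λ) * (M * x.size ^ (k + 2)) * x.size := by ring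
      _ ≤ _ := by
          have : 0 ≤ (3 * Λ * (2 * (1 + W) + leadConst k) + 6 * W * leadConst k) *
            (M * x.size ^ (k + 2)) * x.size := by positivity
          linarith

end

/-! ### Quadrature rules for the two methods -/

/-- Beyond the threshold `α` has the same sign at both ends, so RSV prescribes the Radau points of
the matching side, while the Gauss rule is adapted to both directions. In degenerate elements any
admissible rule will do. -/
lemma exists_elementRule {k : ℕ} (hk : 1 ≤ k) :
    ∃ W, 0 ≤ W ∧ ∀ (N : ℕ) (x : Mesh N) (α : ℝ → ℝ) (s : Fin N → Fin (k + 2) → ℝ) (Λ : ℝ),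
      Reg (Icc 0 (2 * Real.pi)) 0 Λ α → (IsRSV α x s ∨ (2 ≤ k ∧ IsLSV s)) →
      ∃ A : Fin N → Fin (k + 2) → ℝ,
        ∀ i, IsElementRule W (2 * Λ * x.size) (α (x.left i)) (s i) (A i) := by
  obtain ⟨W₁, hW₁, h₁⟩ := exists_uniform_weights hk
  obtain ⟨W₂, hW₂, h₂⟩ := exists_lebesgue_const k
  refine ⟨max W₁ W₂, zero_le_one.trans (hW₁.trans (le_max_left _ _)),
    fun N x α s Λ hα hs => ?_⟩
  have hth := threshold_nonneg (x := x) hα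
  have hleb : ∀ p : Fin (k + 2) → ℝ, IsAdmissible p → LebesgueBound p (max W₁ W₂) :=
    fun p hp o f B hf hB y hy => by
      obtain ⟨l, hl⟩ := exists_ne o
      exact (h₂ p hp o f B hf hB y hy).trans
        (mul_le_mul_of_nonneg_right (le_max_right _ _) ((abs_nonneg _).trans (hB l hl)))
  have hle : ∀ A : Fin (k + 2) → ℝ, (∀ l, |A l| ≤ W₁) → ∀ l, |A l| ≤ max W₁ W₂ :=
    fun A hA l => (hA l).trans (le_max_left _ _)
  suffices h : ∀ i, ∃ A, IsElementRule (max W₁ W₂) (2 * Λ * x.size) (α (x.left i)) (s i) A by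
    choose A hA using h
    exact ⟨A, hA⟩
  intro i
  have hr := right_mem_Icc.2 (x.left_lt_right i).le
  rcases hs with hs | ⟨hk2, hs⟩
  · obtain ⟨hpos, hneg, hor⟩ := hs i
    by_cases hfp : 2 * Λ * x.size < α (x.left i)
    · have h3 := coeff_ge_of_far hα hfp hr
      have hp := hpos (by linarith) (by linarith)
      obtain ⟨A, hA, hA', hAW⟩ := (h₁ (s i)).1 hp
      exact ⟨A, hp.1, hA, hle A hAW, hleb _ (Or.inr (Or.inl hp)), fun _ => hA',
        fun h => absurd h (by linarith)⟩
    by_cases hfn : α (x.left i) < -(2 * Λ * x.size)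
    · have h3 := coeff_le_of_far hα hfn hr
      have hp := hneg (by linarith) (by linarith)
      obtain ⟨A, hA, hA', hAW⟩ := (h₁ (s i)).2.1 hp
      exact ⟨A, hp.1, hA, hle A hAW, hleb _ (Or.inr (Or.inr hp)), fun h => absurd h hfp,
        fun _ => hA'⟩
    rcases hor with hp | hp
    · obtain ⟨A, hA, -, hAW⟩ := (h₁ (s i)).1 hp
      exact ⟨A, hp.1, hA, hle A hAW, hleb _ (Or.inr (Or.inl hp)), fun h => absurd h hfp,
        fun h => absurd h hfn⟩
    · obtain ⟨A, hA, -, hAW⟩ := (h₁ (s i)).2.1 hp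
      exact ⟨A, hp.1, hA, hle A hAW, hleb _ (Or.inr (Or.inr hp)), fun h => absurd h hfp,
        fun h => absurd h hfn⟩
  · have hp := hs i
    obtain ⟨A, hA, hA', hA'', hAW⟩ := (h₁ (s i)).2.2 hk2 hp
    exact ⟨A, hp.1, hA, hle A hAW, hleb _ (Or.inl hp), fun _ => hA', fun _ => hA''⟩

/-! ### Elementary properties of the weighted norm and the flux -/

section

variable {N k : ℕ} {α : ℝ → ℝ} {x : Mesh N} {s : Fin N → Fin (k + 2) → ℝ}

/-- The upwind side depends on the sign of `α` only, so the flux is linear in the function. -/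
lemma flux_sub (v w : Fin N → ℝ[X]) (i : Fin N) (l : Fin (k + 2)) :
    flux α x s (fun i => v i - w i) i l = flux α x s v i l - flux α x s w i l := by
  simp only [flux, upwind, eval_sub]
  split_ifs <;> ring

lemma weightedNorm_sq_eq (v : Fin N → ℝ[X]) : weightedNorm α x v ^ 2 =
    ∑ i, elemWeight α x i * ∫ y in (x.left i)..(x.right i), (v i).eval y ^ 2 :=
  Real.sq_sqrt (Finset.sum_nonneg fun i _ => mul_nonneg (elemWeight_nonneg α x i)
    (intervalIntegral.integral_nonneg (x.left_lt_right i).le fun _ _ => sq_nonneg _))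

lemma weightedNorm_add_sq_le (v w : Fin N → ℝ[X]) :
    weightedNorm α x (fun i => v i + w i) ^ 2 ≤
      2 * weightedNorm α x v ^ 2 + 2 * weightedNorm α x w ^ 2 := by
  rw [weightedNorm_sq_eq, weightedNorm_sq_eq, weightedNorm_sq_eq, Finset.mul_sum, Finset.mul_sum,
    ← Finset.sum_add_distrib]
  refine Finset.sum_le_sum fun i _ => ?_
  have hI : ∀ f : ℝ[X], IntervalIntegrable (fun y => f.eval y ^ 2) volume (x.left i) (x.right i) :=
    fun f => (f.continuous.pow 2).intervalIntegrable _ _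
  have h : ∫ y in (x.left i)..(x.right i), (v i + w i).eval y ^ 2 ≤
      ∫ y in (x.left i)..(x.right i), (2 * (v i).eval y ^ 2 + 2 * (w i).eval y ^ 2) := by
    refine intervalIntegral.integral_mono_on (x.left_lt_right i).le (hI _)
      (((hI _).const_mul 2).add ((hI _).const_mul 2)) fun y _ => ?_
    rw [eval_add]
    linarith [sq_nonneg ((v i).eval y - (w i).eval y)]
  rw [intervalIntegral.integral_add ((hI _).const_mul 2) ((hI _).const_mul 2),
    intervalIntegral.integral_const_mul, intervalIntegral.integral_const_mul] at h
  have := mul_le_mul_of_nonneg_left h (elemWeight_nonneg α x i)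
  linarith

lemma weightedNorm_sq_le_of_abs_le {v : Fin N → ℝ[X]} {B : ℝ}
    (h : ∀ i, ∀ y ∈ Icc (x.left i) (x.right i), Real.sqrt (elemWeight α x i) * |(v i).eval y| ≤ B) :
    weightedNorm α x v ^ 2 ≤ B ^ 2 * (2 * Real.pi) := by
  rw [weightedNorm_sq_eq, ← x.sum_len, Finset.mul_sum]
  refine Finset.sum_le_sum fun i _ => ?_
  rw [← intervalIntegral.integral_const_mul]
  refine (intervalIntegral.integral_mono_on (g := fun _ => B ^ 2) (x.left_lt_right i).le
    (((v i).continuous.pow 2).const_mul _ |>.intervalIntegrable _ _)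
    intervalIntegrable_const fun y hy => ?_).trans (le_of_eq ?_)
  · have h1 := pow_le_pow_left₀ (mul_nonneg (Real.sqrt_nonneg _) (abs_nonneg _)) (h i y hy) 2
    rwa [mul_pow, Real.sq_sqrt (elemWeight_nonneg α x i), sq_abs] at h1
  · rw [intervalIntegral.integral_const, smul_eq_mul, Mesh.len, mul_comm]

lemma coeff_interp (φ : ℝ → ℝ) (i : Fin N) (m : ℕ) : (interp α x s φ i).coeff m =
    ∑ l ∈ Finset.univ.erase (omitted k (α (x.left i)) (α (x.right i))), φ (x.pt s i l) *
      (Lagrange.basis (Finset.univ.erase (omitted k (α (x.left i)) (α (x.right i)))) (x.pt s i)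
        l).coeff m := by
  rw [interp, Lagrange.interpolate_apply, finsetSum_coeff]
  simp only [coeff_C_mul]

lemma interp_congr (hs : ∀ i, IsRefPartition (s i)) {φ ψ : ℝ → ℝ}
    (h : ∀ y ∈ Icc 0 (2 * Real.pi), φ y = ψ y) : interp α x s φ = interp α x s ψ := by
  funext i
  rw [interp, interp]
  congr 1
  funext l
  exact h _ (x.Icc_subset i (pt_mem (hs i) l))

end

/-- Only point values enter `leadCoeff`, so it can be differentiated in time without exchanging time
and space derivatives. -/
lemma hasDerivWithinAt_leadCoeff {k : ℕ} {a b t : ℝ} {S : Set ℝ} (hab : a ≤ b)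
    {f F : ℝ → ℝ → ℝ} {f' F' : ℝ → ℝ}
    (hf : ∀ y ∈ Icc a b, HasDerivWithinAt (fun τ => f τ y) (f' y) S t)
    (hF : ∀ y ∈ Icc a b, HasDerivWithinAt (fun τ => F τ y) (F' y) S t) :
    HasDerivWithinAt (fun τ => leadCoeff k a b (f τ) (F τ)) (leadCoeff k a b f' F') S t :=
  ((hasDerivWithinAt_finiteDiff fun _ hj => hf _ (step_mem hab (hj.trans (Nat.le_succ _)))).sub
    ((hasDerivWithinAt_finiteDiff fun _ hj => hF _ (step_mem hab hj)).div_const _)).div_const _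

/-! ### The time derivative of a solution of the scheme -/

/-- The derivative of a time-dependent polynomial. -/
def timeDeriv (k : ℕ) (T : ℝ) (P : ℝ → ℝ[X]) (t : ℝ) : ℝ[X] :=
  ∑ m ∈ Finset.range (k + 1), C (derivWithin (fun τ => (P τ).coeff m) (Icc 0 T) t) * X ^ m

section

variable {k : ℕ} {T t : ℝ} {P : ℝ → ℝ[X]}

lemma natDegree_timeDeriv_le : (timeDeriv k T P t).natDegree ≤ k :=
  natDegree_sum_le_of_forall_le _ _ fun _ hm =>
    (natDegree_C_mul_X_pow_le _ _).trans (Nat.lt_succ_iff.1 (Finset.mem_range.1 hm))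

lemma hasDerivWithinAt_coeff_timeDeriv (hdeg : ∀ τ ∈ Icc 0 T, (P τ).natDegree ≤ k)
    (hdiff : ∀ m, DifferentiableOn ℝ (fun τ => (P τ).coeff m) (Icc 0 T)) (ht : t ∈ Icc 0 T)
    (m : ℕ) :
    HasDerivWithinAt (fun τ => (P τ).coeff m) ((timeDeriv k T P t).coeff m) (Icc 0 T) t := by
  by_cases hm : m ≤ k
  · have : (timeDeriv k T P t).coeff m = derivWithin (fun τ => (P τ).coeff m) (Icc 0 T) t := by
      rw [timeDeriv, finsetSum_coeff]
      simp only [coeff_C_mul, coeff_X_pow, mul_ite, mul_one, mul_zero]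
      rw [Finset.sum_ite_eq, if_pos (Finset.mem_range.2 (Nat.lt_succ_of_le hm))]
    rw [this]
    exact (hdiff m t ht).hasDerivWithinAt
  · rw [coeff_eq_zero_of_natDegree_lt (natDegree_timeDeriv_le.trans_lt (not_le.1 hm))]
    have h0 : ∀ τ ∈ Icc 0 T, (P τ).coeff m = 0 := fun τ hτ =>
      coeff_eq_zero_of_natDegree_lt ((hdeg τ hτ).trans_lt (not_le.1 hm))
    exact (hasDerivWithinAt_const t (Icc 0 T) (0 : ℝ)).congr h0 (h0 t ht)

lemma derivWithin_eval_eq (hT : 0 < T) (hdeg : ∀ τ ∈ Icc 0 T, (P τ).natDegree ≤ k)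
    (hdiff : ∀ m, DifferentiableOn ℝ (fun τ => (P τ).coeff m) (Icc 0 T)) (ht : t ∈ Icc 0 T)
    (y : ℝ) :
    derivWithin (fun τ => (P τ).eval y) (Icc 0 T) t = (timeDeriv k T P t).eval y :=
  (hasDerivWithinAt_linearMap (leval y) hdeg natDegree_timeDeriv_le ht
    (hasDerivWithinAt_coeff_timeDeriv hdeg hdiff ht)).derivWithin (uniqueDiffOn_Icc hT t ht)

end

/-! ### The error estimate for regular solutions -/

/-- The error splits into `ζ`, the distance of `u_h` to the corrected interpolant, and the
correction `η`. Stability and the residual bound control `ζ`, while `η` is of order `h^{k+2}` in the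
weighted norm by itself. -/
lemma exists_error_const {k : ℕ} (hk : 1 ≤ k) {Λ W σ T : ℝ} (hΛ : 0 ≤ Λ) (hW : 0 ≤ W)
    (hσ : 0 ≤ σ) (hT : 0 < T) :
    ∃ C, 0 ≤ C ∧ ∀ (N : ℕ) (x : Mesh N) (α : ℝ → ℝ) (g gt : ℝ → ℝ → ℝ)
      (s A : Fin N → Fin (k + 2) → ℝ) (u₀ : ℝ → ℝ) (u ut : ℝ → ℝ → ℝ) (uh : ℝ → Fin N → ℝ[X])
      (M : ℝ), 0 ≤ M → α 0 = α (2 * Real.pi) → Reg (Icc 0 (2 * Real.pi)) 0 Λ α →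
      x.ShapeRegular σ → (∀ i, IsElementRule W (2 * Λ * x.size) (α (x.left i)) (s i) (A i)) →
      IsPDESolution α g T u₀ u → SolutionData k α g gt T M u ut →
      IsSVSolution α g T x s uh → uh 0 = interp α x s u₀ →
      ∀ t ∈ Icc 0 T, weightedNorm α x (fun i => uh t i - interp α x s (fun y => u y t) i) ≤
        C * (M * x.size ^ (k + 2)) := by
  obtain ⟨Cs, hCs0, hCs⟩ := exists_stability_const hk (T := T) hΛ hW hσ
  have hL := leadConst_nonneg k
  have hpi := Real.pi_pos
  set R := 3 * Λ * (2 * (1 + W) + leadConst k) + 6 * W * leadConst k +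
    5 * Λ * (1 + W) * (1 + 6 * Λ) with hR
  set Q := (leadConst k * (6 * W)) ^ 2 * (2 * Real.pi) with hQ
  have hQ0 : 0 ≤ Q := by positivity
  refine ⟨Real.sqrt (2 * (Cs * (Q + R ^ 2)) + 2 * Q), Real.sqrt_nonneg _,
    fun N x α g gt s A u₀ u ut uh M hM hper hα hreg hrule hu hd huh h0 t ht => ?_⟩
  have hconv : Convex ℝ (Icc (0 : ℝ) (2 * Real.pi)) := convex_Icc _ _
  have hp : ∀ i, IsRefPartition (s i) := fun i => (hrule i).partition
  have hh := x.size_pos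
  set ε := M * x.size ^ (k + 2) with hε
  have hε0 : 0 ≤ ε := by positivity
  -- By `u_t = g - (α u)_x` this approximates the leading coefficient of `u_t` in the element; `c'`
  -- is its time derivative.
  let c : ℝ → Fin N → ℝ := fun t i =>
    leadCoeff k (x.left i) (x.right i) (fun y => g y t) (fun y => α y * u y t)
  let c' : ℝ → Fin N → ℝ := fun t i =>
    leadCoeff k (x.left i) (x.right i) (fun y => gt y t) (fun y => α y * ut y t)
  have hc : ∀ t ∈ Icc 0 T, ∀ i, |c t i| ≤ leadConst k * M := fun t ht i =>
    abs_leadCoeff_le (x.left_lt_right i) (x.Icc_subset i)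
      ((hd.reg_source t ht).of_succ hconv) ((hd.reg_flux t ht).of_succ hconv)
  have hc' : ∀ t ∈ Icc 0 T, ∀ i, |c' t i| ≤ leadConst k * M := fun t ht i =>
    abs_leadCoeff_le (x.left_lt_right i) (x.Icc_subset i)
      ((hd.reg_source_time t ht).of_succ hconv) (hd.reg_flux_time t ht)
  let w : ℝ → Fin N → ℝ[X] := fun t => correctedInterp Λ α x s (fun y => u y t) (c t)
  let w' : ℝ → Fin N → ℝ[X] := fun t => correctedInterp Λ α x s (fun y => ut y t) (c' t)
  let η : ℝ → Fin N → ℝ[X] := fun t i => C (c t i) * correction Λ α x s i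
  let ζ : ℝ → Fin N → ℝ[X] := fun t i => uh t i - w t i
  let ζ' : ℝ → Fin N → ℝ[X] := fun t i => timeDeriv k T (fun τ => uh τ i) t - w' t i
  have hwdeg : ∀ (φ : ℝ → ℝ) (d : Fin N → ℝ) (i : Fin N),
      (correctedInterp Λ α x s φ d i).natDegree ≤ k := fun φ d i =>
    natDegree_add_le_of_degree_le (natDegree_elemInterp_le (hp i) (x.left_lt_right i) _ _)
      ((natDegree_C_mul_le _ _).trans (natDegree_correction_le hrule i))
  have hζdeg : ∀ t ∈ Icc 0 T, ∀ i, (ζ t i).natDegree ≤ k := fun t ht i =>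
    (natDegree_sub_le _ _).trans (max_le (huh.degree_le t ht i) (hwdeg _ _ i))
  have hζdeg' : ∀ t ∈ Icc 0 T, ∀ i, (ζ' t i).natDegree ≤ k := fun t _ i =>
    (natDegree_sub_le _ _).trans (max_le natDegree_timeDeriv_le (hwdeg _ _ i))
  have hζder : ∀ t ∈ Icc 0 T, ∀ i m,
      HasDerivWithinAt (fun τ => (ζ τ i).coeff m) ((ζ' t i).coeff m) (Icc 0 T) t :=
    fun t ht i m => by
      have h1 := hasDerivWithinAt_coeff_timeDeriv (fun τ hτ => huh.degree_le τ hτ i)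
        (huh.differentiableOn i) ht m
      have h2 : HasDerivWithinAt (fun τ => (interp α x s (fun y => u y τ) i).coeff m)
          ((interp α x s (fun y => ut y t) i).coeff m) (Icc 0 T) t := by
        simp only [coeff_interp]
        exact HasDerivWithinAt.fun_sum fun l _ =>
          (hd.time _ (x.Icc_subset i (pt_mem (hp i) l)) t ht).mul_const _
      have h3 : HasDerivWithinAt (fun τ => c τ i) (c' t i) (Icc 0 T) t :=
        hasDerivWithinAt_leadCoeff (x.left_lt_right i).le
          (fun y hy => hd.time_source y (x.Icc_subset i hy) t ht)
          (fun y hy => (hd.time y (x.Icc_subset i hy) t ht).const_mul _)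
      simp only [ζ, ζ', w, w', correctedInterp, coeff_sub, coeff_add, coeff_C_mul]
      exact h1.sub (h2.add (h3.mul_const _))
  have hres : ∀ t ∈ Icc 0 T, ∀ i, ∀ j : Fin (k + 1), Real.sqrt (elemWeight α x i) *
      |(∫ y in (x.pt s i j.castSucc)..(x.pt s i j.succ), (ζ' t i).eval y) +
        flux α x s (ζ t) i j.succ - flux α x s (ζ t) i j.castSucc| ≤ R * ε * x.size :=
    fun t ht i j => by
      have h1 := abs_residual_le hα hrule hk hper hM (hu.periodic t ht) (hd.space t ht)
        (hd.reg_sol t ht) (hd.reg_flux t ht) (hd.reg_source t ht) (hd.reg_time t ht)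
        (c := c t) (fun _ => rfl) (hc' t ht) i j
      have h2 := huh.scheme t ht i j
      simp only [derivWithin_eval_eq hT (fun τ hτ => huh.degree_le τ hτ i)
        (huh.differentiableOn i) ht] at h2
      have h3 : ∫ y in (x.pt s i j.castSucc)..(x.pt s i j.succ), (ζ' t i).eval y =
          (∫ y in (x.pt s i j.castSucc)..(x.pt s i j.succ),
            (timeDeriv k T (fun τ => uh τ i) t).eval y) -
          ∫ y in (x.pt s i j.castSucc)..(x.pt s i j.succ), (w' t i).eval y := by
        simp only [ζ', eval_sub]
        exact intervalIntegral.integral_sub ((Polynomial.continuous _).intervalIntegrable _ _)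
          ((Polynomial.continuous _).intervalIntegrable _ _)
      refine le_trans (le_of_eq ?_) h1
      congr 2
      rw [h3, flux_sub, flux_sub, ← h2]
      simp only [w, w']
      ring
  have hη : ∀ t ∈ Icc 0 T, weightedNorm α x (η t) ^ 2 ≤ Q * ε ^ 2 := fun t ht => by
    refine (weightedNorm_sq_le_of_abs_le (B := leadConst k * M * (6 * W * x.size ^ (k + 2)))
      fun i y hy => ?_).trans (le_of_eq ?_)
    · simp only [η]
      rw [eval_mul, eval_C, abs_mul, mul_left_comm]
      exact mul_le_mul (hc t ht i) (sqrt_elemWeight_mul_correction_le hα hrule i hy)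
        (mul_nonneg (Real.sqrt_nonneg _) (abs_nonneg _)) (by positivity)
    · rw [hQ, hε]
      ring
  have h00 : (0 : ℝ) ∈ Icc 0 T := ⟨le_rfl, hT.le⟩
  -- As the scheme starts from `I_h u₀`, the initial value of `ζ` is the correction with opposite
  -- sign.
  have hζ0 : weightedNorm α x (ζ 0) ^ 2 ≤ Q * ε ^ 2 := by
    refine le_trans (le_of_eq ?_) (hη 0 h00)
    rw [weightedNorm_sq_eq, weightedNorm_sq_eq]
    have h1 : ∀ i, ζ 0 i = -η 0 i := fun i => by
      simp only [ζ, w, η, correctedInterp]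
      rw [h0, interp_congr hp hu.initial]
      ring
    simp only [h1, eval_neg, neg_sq]
  have hstab := hCs N x α s A ζ ζ' (R * ε) hper hα.2 hreg hrule hζdeg hζdeg' hζder hres t ht
  have hsplit : (fun i => uh t i - interp α x s (fun y => u y t) i) = fun i => ζ t i + η t i := by
    funext i
    simp only [ζ, w, η, correctedInterp]
    ring
  rw [hsplit]
  have hfin : weightedNorm α x (fun i => ζ t i + η t i) ^ 2 ≤
      (2 * (Cs * (Q + R ^ 2)) + 2 * Q) * ε ^ 2 := by
    have h1 := weightedNorm_add_sq_le (α := α) (x := x) (ζ t) (η t)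
    have h2 := mul_le_mul_of_nonneg_left (add_le_add_left hζ0 ((R * ε) ^ 2)) hCs0
    have h3 := hη t ht
    linarith
  have h4 := Real.sqrt_le_sqrt hfin
  have h5 : 0 ≤ weightedNorm α x fun i => ζ t i + η t i := Real.sqrt_nonneg _
  rwa [Real.sqrt_sq h5, Real.sqrt_mul (by positivity), Real.sqrt_sq hε0] at h4

end SpectralVolume

end

/-! ### The error estimate in Sobolev norms -/

theorem corollary5p1 (k : ℕ) (hk : 1 ≤ k)
    (α : ℝ → ℝ) (hα : ContDiffOn ℝ ∞ α (Set.Icc 0 (2 * Real.pi)))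
    (hαper : α 0 = α (2 * Real.pi))
    (T : ℝ) (hT : 0 < T)
    (g : ℝ → ℝ → ℝ)
    (hg : ContDiffOn ℝ ∞ (Function.uncurry g) (Set.Icc 0 (2 * Real.pi) ×ˢ Set.Icc 0 T))
    (σ : ℝ) :
    ∃ C : ℝ, 0 < C ∧
      ∀ (u₀ : ℝ → ℝ) (u : ℝ → ℝ → ℝ), SpectralVolume.IsPDESolution α g T u₀ u →
      (∀ t ∈ Set.Icc 0 T,
        SpectralVolume.MemSobolevInfty 0 (2 * Real.pi) (k + 3) (fun y => u y t)) →
      ∀ (N : ℕ) (x : SpectralVolume.Mesh N), x.ShapeRegular σ →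
      ∀ s : Fin N → Fin (k + 2) → ℝ,
        (SpectralVolume.IsRSV α x s ∨ (2 ≤ k ∧ SpectralVolume.IsLSV s)) →
      ∀ uh : ℝ → Fin N → Polynomial ℝ, SpectralVolume.IsSVSolution α g T x s uh →
        uh 0 = SpectralVolume.interp α x s u₀ →
      ∀ t ∈ Set.Icc 0 T,
        ENNReal.ofReal (SpectralVolume.weightedNorm α x
            (fun i => uh t i - SpectralVolume.interp α x s (fun y => u y t) i))
          ≤ ENNReal.ofReal (C * x.size ^ (k + 2)) *
            ⨆ τ ∈ Set.Icc 0 T,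
              SpectralVolume.sobolevInftyNorm 0 (2 * Real.pi) (k + 3) (fun y => u y τ) := by
  obtain ⟨Λ, hΛ0, hΛ⟩ := SpectralVolume.exists_reg_coefficient hα 0
  obtain ⟨W, hW0, hW⟩ := SpectralVolume.exists_elementRule hk
  obtain ⟨gt, Cd, hCd1, hCd⟩ := SpectralVolume.exists_solutionData k hα hT hg
  have hCd0 : 0 ≤ Cd := zero_le_one.trans hCd1
  obtain ⟨Ce, hCe0, hCe⟩ := SpectralVolume.exists_error_const hk hΛ0 hW0 (abs_nonneg σ) hT
  -- Adding one makes the constant positive, which also settles an infinite supremum on the right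
  -- side.
  refine ⟨Ce * Cd + 1, by positivity, fun u₀ u hu _ N x hx s hs uh huh h0 t ht => ?_⟩
  have hh : 0 < x.size := x.size_pos
  have hK : 0 < (Ce * Cd + 1) * x.size ^ (k + 2) := by positivity
  have hx' : x.ShapeRegular |σ| := by rwa [abs_of_pos (x.pos_of_shapeRegular hx)]
  obtain ⟨A, hA⟩ := hW N x α s Λ hΛ hs
  set S := ⨆ τ ∈ Set.Icc 0 T,
    SpectralVolume.sobolevInftyNorm 0 (2 * Real.pi) (k + 3) (fun y => u y τ) with hS
  rcases eq_or_ne S ⊤ with hST | hST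
  · rw [hST, ENNReal.mul_top (ENNReal.ofReal_pos.2 hK).ne']
    exact le_top
  set e := SpectralVolume.weightedNorm α x
    (fun i => uh t i - SpectralVolume.interp α x s (fun y => u y t) i) with he
  -- The Sobolev norm is an infimum over families of weak derivatives, so derivative bounds are
  -- extracted for every `M` strictly above the supremum; letting `M` decrease to it gives the
  -- estimate.
  have hbound : ∀ M > S.toReal, e ≤ (Ce * Cd + 1) * x.size ^ (k + 2) * M := fun M hM => by
    have hM0 : 0 ≤ M := ENNReal.toReal_nonneg.trans hM.le
    have hreg : ∀ τ ∈ Set.Icc 0 T,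
        SpectralVolume.Reg (Set.Icc 0 (2 * Real.pi)) (k + 2) M (fun y => u y τ) := fun τ hτ => by
      refine SpectralVolume.reg_of_sobolevInftyNorm_lt Real.two_pi_pos ?_ ?_
      · exact hu.continuousOn.comp (f := fun y => (y, τ)) (by fun_prop) fun y hy => ⟨hy, hτ⟩
      · refine lt_of_le_of_lt ?_ ((ENNReal.lt_ofReal_iff_toReal_lt hST).2 hM)
        exact le_iSup₂ (f := fun τ (_ : τ ∈ Set.Icc 0 T) =>
          SpectralVolume.sobolevInftyNorm 0 (2 * Real.pi) (k + 3) (fun y => u y τ)) τ hτ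
    obtain ⟨ut, hd⟩ := hCd M u₀ u hu hreg
    have h1 := hCe N x α g gt s A u₀ u ut uh (Cd * M) (by positivity) hαper hΛ hx' hA hu hd huh h0
      t ht
    have h2 : 0 ≤ x.size ^ (k + 2) * M := by positivity
    linarith
  have hlim : e ≤ (Ce * Cd + 1) * x.size ^ (k + 2) * S.toReal := by
    refine le_of_forall_pos_le_add fun δ hδ => ?_
    have h1 := hbound (S.toReal + δ / ((Ce * Cd + 1) * x.size ^ (k + 2)))
      (lt_add_of_pos_right _ (by positivity))
    rwa [mul_add, mul_div_cancel₀ _ hK.ne'] at h1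
  calc ENNReal.ofReal e ≤ ENNReal.ofReal ((Ce * Cd + 1) * x.size ^ (k + 2) * S.toReal) :=
        ENNReal.ofReal_le_ofReal hlim
    _ = _ := by rw [ENNReal.ofReal_mul hK.le, ENNReal.ofReal_toReal hST]
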